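/- **Setting.** $n\ge 1$ nodes solve $\min_{x\in\mathbb R^p}\max_{y\in\mathcal Y} f(x,y)=\frac1n\sum_{i=1}^n f_i(x,y)$, $f_i(x,y)=\mathbb E_{\xi\sim\mathcal D_i}[F_i(x,y;\xi)]$, where $\mathcal Y\subset\mathbb R^d$ is closed and convex. Assume that there are constants $\mu,L,C>0$ such that, for all $i$, all $x,x'\in\mathbb R^p$, all $y,y'\in\mathcal Y$ and $z\in\{x,y\}$: * $f_i(x,y)-f_i(x,y')\ge\langle\nabla_yf_i(x,y),y-y'\rangle+\frac\mu2\|y-y'\|^2$; * $\|\nabla_zf_i(x,y)-\nabla_zf_i(x',y')\|^2\le L^2(\|x-x'\|^2+\|y-y'\|^2)$ and $\|\nabla^2_{zy}f_i(x,y)-\nabla^2_{zy}f_i(x',y')\|^2\le L^2(\|x-x'\|^2+\|y-y'\|^2)$; * $\mathbb E_{\xi\sim\mathcal D_i}[\nabla_zF_i(x,y;\xi)]=\nabla_zf_i(x,y)$ and $\|\nabla_zF_i(x,y;\xi)\|\le C$ almost surely. Let $W\in\mathbb R^{n\times n}$ be doubly stochastic with $\rho_W:=\|W-\mathbf 1\mathbf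 1^T/n\|_2^2<1$. Put $\kappa=L/\mu$, $y^*(x)=\arg\max_{y\in\mathcal Y}f(x,y)$, $\Phi(x)=f(x,y^*(x))$, and assume that $\Phi$ is bounded, $\sup\Phi-\inf\Phi\le\Delta$. **Algorithm (D-TiAda).** Let $\gamma_x,\gamma_y,c>0$ and $0<\beta<\alpha<1$. Start from $x_{i,0}\in\mathbb R^p$, $y_{i,0}\in\mathcal Y$ and $m^x_{i,0}=m^y_{i,0}=c$. With mutually independent samples $\xi^x_{i,k},\xi^y_{i,k}\sim\mathcal D_i$ let $g^z_{i,k}=\nabla_zF_i(x_{i,k},y_{i,k};\xi^z_{i,k})$, $m^z_{i,k+1}=m^z_{i,k}+\|g^z_{i,k}\|^2$, $v_{i,k}=\max\{m^x_{i,k},m^y_{i,k}\}$, $u_{i,k}=m^y_{i,k}$ and $$x_{i,k+1}=\sum_jW_{ij}\bigl(x_{j,k}-\gamma_xv_{j,k+1}^{-\alpha}g^x_{j,k}\bigr),\qquad y_{i,k+1}=\mathcal P_{\mathcal Y}\Bigl(\sum_jW_{ij}\bigl(y_{j,k}+\gamma_yu_{j,k+1}^{-\beta}g^y_{j,k}\bigr)\Bigr).$$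 Let $\bar x_k,\bar v_k,\bar u_k$ be the averages over the nodes of $x_{i,k},v_{i,k},u_{i,k}$, and $$\zeta_v^2=\sup_{i,\,k>0}\frac{(v_{i,k}^{-\alpha}-\bar v_k^{-\alpha})^2}{(\bar v_k^{-\alpha})^2},\qquad \zeta_u^2=\sup_{i,\,k>0}\frac{(u_{i,k}^{-\beta}-\bar u_k^{-\beta})^2}{(\bar u_k^{-\beta})^2}$$ (worst case over the nodes, the iterations and, up to null sets, the randomness; values in $[0,\infty]$). **Claim.** $y^*(x)$ exists for every $x$, $\Phi$ is differentiable, and each $\|\nabla\Phi(\bar x_k)\|^2$ is integrable. There is a universal constant $A>0$ such that for all $\alpha,\beta,\gamma_x,\gamma_y,c,L,\mu,C,\Delta,R$ as above and every $c_0>0$ there are $M>0$ and $q\in\mathbb N$, depending only on these numbers (so not on $n,p,d$, the $F_i$, the $\mathcal D_i$, $\mathcal Y$, $W$, $\rho_W$, $\zeta_v$, $\zeta_u$ or $K$), such that whenever $\frac1n\sum_i\|x_{i,0}-\bar x_0\|^2\le R$ and $$K\ \ge\ c_0\max\Bigl\{\Bigl(\frac{\gamma_x^2\kappa^4}{\gamma_y^2}\Bigr)^{\frac1{\alpha-\beta}},\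 \Bigl(\frac1{(1-\rho_W)^2}\Bigr)^{\max\{\frac1\alpha,\frac1\beta\}}\Bigr\},$$ we have $$\frac1K\sum_{k=0}^{K-1}\mathbb E\bigl[\|\nabla\Phi(\bar x_k)\|^2\bigr]\le M(1+\log K)^q\Bigl(\frac1{K^{1-\alpha}}+\frac1{(1-\rho_W)^\alpha K^\alpha}+\frac1{K^{1-\beta}}+\frac1{(1-\rho_W)K^\beta}\Bigr)+A\,(\zeta_v^2+\kappa^2\zeta_u^2)\,C^2 .$$ -/

import Mathlib

open MeasureTheory ProbabilityTheory
open scoped ENNReal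

noncomputable section

namespace DTiAda

/-- `ℝ^m` with the Euclidean norm. -/
abbrev Vec (m : ℕ) : Type := EuclideanSpace ℝ (Fin m)

/-- Partial gradient `∇ₓ g(x, y)`. -/
def gradX {p d : ℕ} (g : Vec p → Vec d → ℝ) (x : Vec p) (y : Vec d) : Vec p :=
  gradient (fun x' => g x' y) x

/-- Partial gradient `∇_y g(x, y)`. -/
def gradY {p d : ℕ} (g : Vec p → Vec d → ℝ) (x : Vec p) (y : Vec d) : Vec d :=
  gradient (fun y' => g x y') y

/-- Second derivative `∇²_{xy} g(x, y)`: the derivative in `x` of `∇_y g`. -/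
def hessXY {p d : ℕ} (g : Vec p → Vec d → ℝ) (x : Vec p) (y : Vec d) : Vec p →L[ℝ] Vec d :=
  fderiv ℝ (fun x' => gradY g x' y) x

/-- Second derivative `∇²_{yy} g(x, y)`: the derivative in `y` of `∇_y g`. -/
def hessYY {p d : ℕ} (g : Vec p → Vec d → ℝ) (x : Vec p) (y : Vec d) : Vec d →L[ℝ] Vec d :=
  fderiv ℝ (fun y' => gradY g x y') y

/-- The data of a distributed stochastic minimax problem
`min_{x ∈ ℝ^p} max_{y ∈ Y} (1/n) ∑ i, E_{ξ ∼ D i} [F i x y ξ]` with `n` nodes. -/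
structure Problem (n p d : ℕ) (Ξ : Type*) [MeasurableSpace Ξ] where
  /-- the feasible set of the dual variable -/
  Y : Set (Vec d)
  /-- the local sample losses -/
  F : Fin n → Vec p → Vec d → Ξ → ℝ
  /-- the local data distributions -/
  D : Fin n → Measure Ξ

namespace Problem

variable {n p d : ℕ} {Ξ : Type*} [MeasurableSpace Ξ]

/-- Stochastic partial gradient `∇ₓ Fᵢ(x, y; ξ)`. -/
def sgradX (Q : Problem n p d Ξ) (i : Fin n) (x : Vec p) (y : Vec d) (ξ : Ξ) : Vec p :=
  gradX (fun x' y' => Q.F i x' y' ξ) x y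

/-- Stochastic partial gradient `∇_y Fᵢ(x, y; ξ)`. -/
def sgradY (Q : Problem n p d Ξ) (i : Fin n) (x : Vec p) (y : Vec d) (ξ : Ξ) : Vec d :=
  gradY (fun x' y' => Q.F i x' y' ξ) x y

/-- Local objective `fᵢ(x, y) = E_{ξ ∼ Dᵢ} [Fᵢ(x, y; ξ)]`. -/
def local_f (Q : Problem n p d Ξ) (i : Fin n) (x : Vec p) (y : Vec d) : ℝ :=
  ∫ ξ, Q.F i x y ξ ∂(Q.D i)

/-- Global objective `f = (1/n) ∑ fᵢ`. -/
def f (Q : Problem n p d Ξ) (x : Vec p) (y : Vec d) : ℝ :=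
  (1 / (n : ℝ)) * ∑ i, Q.local_f i x y

/-- `y` maximizes `f(x, ·)` over `Y`. -/
def IsArgmax (Q : Problem n p d Ξ) (x : Vec p) (y : Vec d) : Prop :=
  y ∈ Q.Y ∧ ∀ y' ∈ Q.Y, Q.f x y' ≤ Q.f x y

/-- `y*(x) = argmax_{y ∈ Y} f(x, y)`. -/
def yStar (Q : Problem n p d Ξ) (x : Vec p) : Vec d :=
  Classical.epsilon (Q.IsArgmax x)

/-- The primal function `Φ(x) = f(x, y*(x))`. -/
def Phi (Q : Problem n p d Ξ) (x : Vec p) : ℝ :=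
  Q.f x (Q.yStar x)

/-- What makes the problem well posed: `Y` is closed and convex, the data distributions are
probability measures, the expectations defining `fᵢ` exist, the sample losses are differentiable
at the points of `ℝ^p × Y`, and the stochastic gradients are measurable. -/
structure WellPosed (Q : Problem n p d Ξ) : Prop where
  isClosed : IsClosed Q.Y
  convex : Convex ℝ Q.Y
  prob : ∀ i, IsProbabilityMeasure (Q.D i)
  integrable : ∀ i x y, Integrable (fun ξ => Q.F i x y ξ) (Q.D i)
  differentiable : ∀ i ξ x, ∀ y ∈ Q.Y,
    DifferentiableAt ℝ (fun z : Vec p × Vec d => Q.F i z.1 z.2 ξ) (x, y)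
  measurable_sgradX : ∀ i,
    Measurable (fun q : (Vec p × Vec d) × Ξ => Q.sgradX i q.1.1 q.1.2 q.2)
  measurable_sgradY : ∀ i,
    Measurable (fun q : (Vec p × Vec d) × Ξ => Q.sgradY i q.1.1 q.1.2 q.2)

/-- Each `fᵢ` is `μ`-strongly concave in `y`. -/
def StronglyConcave (Q : Problem n p d Ξ) (μ : ℝ) : Prop :=
  ∀ i x, ∀ y ∈ Q.Y, ∀ y' ∈ Q.Y,
    inner ℝ (gradY (Q.local_f i) x y) (y - y') + μ / 2 * ‖y - y'‖ ^ 2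
      ≤ Q.local_f i x y - Q.local_f i x y'

/-- Each `fᵢ` is jointly `L`-smooth, and its second derivatives `∇²_{xy} fᵢ`, `∇²_{yy} fᵢ` are
`L`-Lipschitz. -/
structure JointlySmooth (Q : Problem n p d Ξ) (L : ℝ) : Prop where
  differentiable : ∀ i x, ∀ y ∈ Q.Y,
    DifferentiableAt ℝ (fun z : Vec p × Vec d => Q.local_f i z.1 z.2) (x, y)
  lipschitz_gradX : ∀ i x x', ∀ y ∈ Q.Y, ∀ y' ∈ Q.Y,
    ‖gradX (Q.local_f i) x y - gradX (Q.local_f i) x' y'‖ ^ 2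
      ≤ L ^ 2 * (‖x - x'‖ ^ 2 + ‖y - y'‖ ^ 2)
  lipschitz_gradY : ∀ i x x', ∀ y ∈ Q.Y, ∀ y' ∈ Q.Y,
    ‖gradY (Q.local_f i) x y - gradY (Q.local_f i) x' y'‖ ^ 2
      ≤ L ^ 2 * (‖x - x'‖ ^ 2 + ‖y - y'‖ ^ 2)
  differentiable_gradY : ∀ i x, ∀ y ∈ Q.Y,
    DifferentiableAt ℝ (fun z : Vec p × Vec d => gradY (Q.local_f i) z.1 z.2) (x, y)
  lipschitz_hessXY : ∀ i x x', ∀ y ∈ Q.Y, ∀ y' ∈ Q.Y,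
    ‖hessXY (Q.local_f i) x y - hessXY (Q.local_f i) x' y'‖ ^ 2
      ≤ L ^ 2 * (‖x - x'‖ ^ 2 + ‖y - y'‖ ^ 2)
  lipschitz_hessYY : ∀ i x x', ∀ y ∈ Q.Y, ∀ y' ∈ Q.Y,
    ‖hessYY (Q.local_f i) x y - hessYY (Q.local_f i) x' y'‖ ^ 2
      ≤ L ^ 2 * (‖x - x'‖ ^ 2 + ‖y - y'‖ ^ 2)

/-- The stochastic gradients are unbiased and bounded by `C`. -/
structure BoundedUnbiased (Q : Problem n p d Ξ) (C : ℝ) : Prop where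
  unbiased_X : ∀ i x, ∀ y ∈ Q.Y, ∫ ξ, Q.sgradX i x y ξ ∂(Q.D i) = gradX (Q.local_f i) x y
  unbiased_Y : ∀ i x, ∀ y ∈ Q.Y, ∫ ξ, Q.sgradY i x y ξ ∂(Q.D i) = gradY (Q.local_f i) x y
  bounded_X : ∀ i x, ∀ y ∈ Q.Y, ∀ᵐ ξ ∂(Q.D i), ‖Q.sgradX i x y ξ‖ ≤ C
  bounded_Y : ∀ i x, ∀ y ∈ Q.Y, ∀ᵐ ξ ∂(Q.D i), ‖Q.sgradY i x y ξ‖ ≤ C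

/-- The samples `ξˣ_{i,k}`, `ξʸ_{i,k}` of all nodes and iterations are mutually independent, and
those of node `i` have law `D i`. -/
structure Sampling (Q : Problem n p d Ξ) {Ω : Type*} [MeasurableSpace Ω] (P : Measure Ω)
    (ξx ξy : ℕ → Fin n → Ω → Ξ) : Prop where
  measurable_x : ∀ k i, Measurable (ξx k i)
  measurable_y : ∀ k i, Measurable (ξy k i)
  law_x : ∀ k i, P.map (ξx k i) = Q.D i
  law_y : ∀ k i, P.map (ξy k i) = Q.D i
  indep : iIndepFun
    (fun a : (ℕ × Fin n) ⊕ (ℕ × Fin n) =>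
      Sum.elim (fun q : ℕ × Fin n => ξx q.1 q.2) (fun q : ℕ × Fin n => ξy q.1 q.2) a) P

end Problem

/-- `ρ_W = ‖W - J‖₂²` with `J = 𝟏𝟏ᵀ/n` and the spectral norm. -/
def rho {n : ℕ} (W : Matrix (Fin n) (Fin n) ℝ) : ℝ :=
  ‖Matrix.toEuclideanCLM (n := Fin n) (𝕜 := ℝ) (W - Matrix.of fun _ _ => 1 / (n : ℝ))‖ ^ 2

/-- Metric projection onto `Y`. -/
def proj {d : ℕ} (Y : Set (Vec d)) (y : Vec d) : Vec d :=
  Classical.epsilon fun z => z ∈ Y ∧ ∀ w ∈ Y, ‖y - z‖ ≤ ‖y - w‖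

/-- Parameters of the algorithm: stepsizes `γx, γy`, exponents `α, β`, initial buffer `c`. -/
structure Params where
  γx : ℝ
  γy : ℝ
  α : ℝ
  β : ℝ
  c : ℝ

/-- Admissible parameters. -/
structure Params.Admissible (θ : Params) : Prop where
  γx_pos : 0 < θ.γx
  γy_pos : 0 < θ.γy
  β_pos : 0 < θ.β
  β_lt_α : θ.β < θ.α
  α_lt_one : θ.α < 1
  c_pos : 0 < θ.c

/-- Local variables of all nodes: iterates and accumulated squared gradient norms. -/
structure State (n p d : ℕ) where
  x : Fin n → Vec p
  y : Fin n → Vec d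
  mx : Fin n → ℝ
  my : Fin n → ℝ

namespace State

variable {n p d : ℕ}

/-- `vᵢ = max {mᵢˣ, mᵢʸ}`. -/
def v (s : State n p d) (i : Fin n) : ℝ := max (s.mx i) (s.my i)

/-- `uᵢ = mᵢʸ`. -/
def u (s : State n p d) (i : Fin n) : ℝ := s.my i

/-- Network averages. -/
def xbar (s : State n p d) : Vec p := (1 / (n : ℝ)) • ∑ i, s.x i

def vbar (s : State n p d) : ℝ := (1 / (n : ℝ)) * ∑ i, s.v i

def ubar (s : State n p d) : ℝ := (1 / (n : ℝ)) * ∑ i, s.u i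

end State

section Algorithm

variable {n p d : ℕ} {Ξ : Type*} [MeasurableSpace Ξ]

/-- One iteration of D-TiAda, with current samples `sx`, `sy`: the local buffers are updated
without communication, then
`x⁺ = W (x - γx V⁺^{-α} ∇ₓF)` and `y⁺ = P_Y (W (y + γy U⁺^{-β} ∇_yF))`. -/
def step (Q : Problem n p d Ξ) (W : Matrix (Fin n) (Fin n) ℝ) (θ : Params)
    (sx sy : Fin n → Ξ) (s : State n p d) : State n p d :=
  let gx : Fin n → Vec p := fun i => Q.sgradX i (s.x i) (s.y i) (sx i)
  let gy : Fin n → Vec d := fun i => Q.sgradY i (s.x i) (s.y i) (sy i)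
  let mx : Fin n → ℝ := fun i => s.mx i + ‖gx i‖ ^ 2
  let my : Fin n → ℝ := fun i => s.my i + ‖gy i‖ ^ 2
  { x := fun i => ∑ j, W i j • (s.x j - (θ.γx * (max (mx j) (my j)) ^ (-θ.α)) • gx j)
    y := fun i => proj Q.Y (∑ j, W i j • (s.y j + (θ.γy * (my j) ^ (-θ.β)) • gy j))
    mx := mx
    my := my }

/-- The state of D-TiAda at iteration `k`, started from `x0`, `y0` and all buffers equal to `c`,
along the sample sequences `sx`, `sy`. -/
def run (Q : Problem n p d Ξ) (W : Matrix (Fin n) (Fin n) ℝ) (θ : Params)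
    (x0 : Fin n → Vec p) (y0 : Fin n → Vec d) (sx sy : ℕ → Fin n → Ξ) : ℕ → State n p d
  | 0 => { x := x0, y := y0, mx := fun _ => θ.c, my := fun _ => θ.c }
  | k + 1 => step Q W θ (sx k) (sy k) (run Q W θ x0 y0 sx sy k)

/-- The (random) state of D-TiAda at iteration `k`. -/
def iter (Q : Problem n p d Ξ) (W : Matrix (Fin n) (Fin n) ℝ) (θ : Params)
    (x0 : Fin n → Vec p) (y0 : Fin n → Vec d) {Ω : Type*} (ξx ξy : ℕ → Fin n → Ω → Ξ)
    (k : ℕ) (ω : Ω) : State n p d :=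
  run Q W θ x0 y0 (fun t i => ξx t i ω) (fun t i => ξy t i ω) k

end Algorithm

/-- `ζ_v² = sup_{i, k > 0} (v_{i,k}^{-α} - v̄_k^{-α})² / (v̄_k^{-α})²` for a random trajectory `S`;
the supremum is also over the randomness (up to null sets). It may be `∞`. -/
def zetaVSq {n p d : ℕ} {Ω : Type*} [MeasurableSpace Ω] (P : Measure Ω) (α : ℝ)
    (S : ℕ → Ω → State n p d) : ℝ≥0∞ :=
  ⨆ (i : Fin n) (k : ℕ) (_ : 0 < k), essSup (fun ω => ENNReal.ofReal
    (((S k ω).v i ^ (-α) - (S k ω).vbar ^ (-α)) ^ 2 / ((S k ω).vbar ^ (-α)) ^ 2)) P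

/-- `ζ_u² = sup_{i, k > 0} (u_{i,k}^{-β} - ū_k^{-β})² / (ū_k^{-β})²`, likewise. -/
def zetaUSq {n p d : ℕ} {Ω : Type*} [MeasurableSpace Ω] (P : Measure Ω) (β : ℝ)
    (S : ℕ → Ω → State n p d) : ℝ≥0∞ :=
  ⨆ (i : Fin n) (k : ℕ) (_ : 0 < k), essSup (fun ω => ENNReal.ofReal
    (((S k ω).u i ^ (-β) - (S k ω).ubar ^ (-β)) ^ 2 / ((S k ω).ubar ^ (-β)) ^ 2)) P

end DTiAda

end

open DTiAda

/-!
The proof bounds the gradients of `Φ` along almost every sample path, up to sums of products of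
predictable vectors with gradient noise, and then takes expectations, which removes these sums.

**Objective.** Bounded gradients and strong concavity make the feasible set bounded
(`Problem.norm_sub_le_of_mem`), so `y*(x)` exists; comparison of values shows that `y*` is Lipschitz
with constant `2κ` and that `Φ` satisfies a first-order expansion with quadratic remainder
(`Problem.abs_Phi_sub_sub_inner_le`), so that `∇Φ(x) = ∇ₓf(x, y*(x))`, which is bounded by `C`. Only
first-order smoothness is used: the maximizer may lie on the boundary of the feasible set, where
`y*` need not be differentiable.

**Descent in `x`.** The descent inequality is divided by the stepsize `γx v̄ₖ₊₁^{-α}` of the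
averaged iterate, and the increments of `Φ` are summed by parts (`Trajectory.sum_gradient_le`). This
costs `K^α` and leaves the noise multiplied by the predictable vector `∇Φ(x̄ₖ)`. The inconsistency
of the local stepsizes enters as `ζv² C²`.

**Tracking in `y`.** The dual variables follow the target `y*(x̃ₖ₊₁)`, where `x̃` is an exponential
moving average of `x̄` with rate `(c / v̄ₖ)^β`. This target moves slowly enough for a Lipschitz
`y*`, and it is known before the gradients of the iteration are sampled, so the noise again meets
a predictable vector (`Trajectory.sum_distY_le`). The lag `x̄ - x̃` is controlled by the ratio of the
primal stepsize to the rate of the average, of order `v̄^{β-α}`; once the accumulators exceed a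
fixed level `V`, it is a small multiple of the gradients and is absorbed, while the gradients seen
before contribute a constant (`Trajectory.sum_lag_le`).

**Consensus.** Mixing contracts the dispersion of the nodes by `ρ_W`. The quadratic consensus errors
have the order of the rate because the lower bound on `K` gives `(1 - ρ_W)^{-2} ≤ c₀^{-β} K^β`; the
first-order error in `y` is bounded by Young's inequality with a weight adapted to the stepsize
(`Trajectory.sum_inner_dispY_le`).

These estimates are combined in `Trajectory.sum_gradient_bound` and integrated in
`sum_integral_gradient_le`. They require `ζv ≤ 1`, and `ζu ≤ 1` unless the feasible set is a point.
In the remaining case `ζv² + κ² ζu² ≥ 1`, since two feasible points force `κ ≥ 1`, and the claim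
follows from `‖∇Φ‖ ≤ C`.
-/

set_option linter.unusedSectionVars false

namespace DTiAda

/-! ### Averages over the nodes -/

section Mean

variable {n : ℕ} {E : Type*} [NormedAddCommGroup E] [InnerProductSpace ℝ E]

/-- The average `(1/n) ∑ aᵢ` of a family of vectors indexed by the nodes. -/
noncomputable def mean (a : Fin n → E) : E := (1 / (n : ℝ)) • ∑ i, a i

/-- The mean square `(1/n) ∑ ‖aᵢ‖²` of a family of vectors indexed by the nodes. -/
noncomputable def msq (a : Fin n → E) : ℝ := (1 / (n : ℝ)) * ∑ i, ‖a i‖ ^ 2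

lemma msq_nonneg (a : Fin n → E) : 0 ≤ msq a := by
  unfold msq; positivity

lemma norm_sum_smul_sq_le {ι : Type*} [Fintype ι] (w : ι → ℝ) (hw : ∀ i, 0 ≤ w i)
    (hw1 : ∑ i, w i = 1) (a : ι → E) : ‖∑ i, w i • a i‖ ^ 2 ≤ ∑ i, w i * ‖a i‖ ^ 2 := by
  have hc : ConvexOn ℝ Set.univ (fun x : E => ‖x‖ ^ 2) :=
    (convexOn_norm convex_univ).pow (fun x _ => norm_nonneg x) 2
  simpa using hc.map_sum_le (t := Finset.univ) (w := w) (p := a) (fun i _ => hw i) hw1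
    (fun i _ => Set.mem_univ _)

lemma inv_card_mul_sum_const (hn : 0 < n) (c : ℝ) : (1 / (n : ℝ)) * ∑ _i : Fin n, c = c := by
  have : (n : ℝ) ≠ 0 := by positivity
  simp; field_simp

lemma norm_mean_sq_le (hn : 0 < n) (a : Fin n → E) : ‖mean a‖ ^ 2 ≤ msq a := by
  have h := norm_sum_smul_sq_le (fun _ : Fin n => 1 / (n : ℝ)) (fun _ => by positivity)
    (by simpa [mul_comm] using inv_card_mul_sum_const hn 1) a
  rwa [← Finset.smul_sum, ← Finset.mul_sum] at h

lemma mean_const (hn : 0 < n) (c : E) : mean (fun _ : Fin n => c) = c := by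
  have : (n : ℝ) ≠ 0 := by positivity
  simp [mean, ← Nat.cast_smul_eq_nsmul ℝ, smul_smul, this]

lemma mean_sub (a b : Fin n → E) : mean (fun i => a i - b i) = mean a - mean b := by
  simp [mean, Finset.sum_sub_distrib, smul_sub]

lemma mean_smul (r : ℝ) (a : Fin n → E) : mean (fun i => r • a i) = r • mean a := by
  simp [mean, ← Finset.smul_sum, smul_comm r]

lemma inner_mean (z : E) (a : Fin n → E) :
    inner ℝ z (mean a) = (1 / (n : ℝ)) * ∑ i, inner ℝ z (a i) := by
  simp [mean, inner_smul_right, inner_sum]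

lemma msq_mono {F : Type*} [NormedAddCommGroup F] [InnerProductSpace ℝ F] {a : Fin n → E}
    {b : Fin n → F} {r : ℝ} (h : ∀ i, ‖a i‖ ^ 2 ≤ r * ‖b i‖ ^ 2) : msq a ≤ r * msq b := by
  unfold msq
  rw [mul_left_comm, Finset.mul_sum (f := fun i => ‖b i‖ ^ 2)]
  exact mul_le_mul_of_nonneg_left (Finset.sum_le_sum fun i _ => h i) (by positivity)

lemma msq_le_of_forall (hn : 0 < n) {a : Fin n → E} {r : ℝ} (h : ∀ i, ‖a i‖ ^ 2 ≤ r) :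
    msq a ≤ r := by
  calc msq a ≤ (1 / (n : ℝ)) * ∑ _i : Fin n, r := by
        unfold msq; gcongr with i; exact h i
    _ = r := inv_card_mul_sum_const hn r

lemma norm_add_sq_le_young {t : ℝ} (ht : 0 < t) (a b : E) :
    ‖a + b‖ ^ 2 ≤ (1 + t) * ‖a‖ ^ 2 + (1 + 1 / t) * ‖b‖ ^ 2 := by
  have h1 : ‖a + b‖ ≤ ‖a‖ + ‖b‖ := norm_add_le a b
  have h2 : ‖a + b‖ ^ 2 ≤ (‖a‖ + ‖b‖) ^ 2 := by gcongr
  have h3 : 0 ≤ (1 / t) * (t * ‖a‖ - ‖b‖) ^ 2 := by positivity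
  have h4 : (1 / t) * (t * ‖a‖ - ‖b‖) ^ 2
      = t * ‖a‖ ^ 2 - 2 * ‖a‖ * ‖b‖ + (1 / t) * ‖b‖ ^ 2 := by field_simp; ring
  nlinarith

lemma msq_add_le {t : ℝ} (ht : 0 < t) (a b : Fin n → E) :
    msq (fun i => a i + b i) ≤ (1 + t) * msq a + (1 + 1 / t) * msq b := by
  have : (1 + t) * msq a + (1 + 1 / t) * msq b
      = (1 / (n : ℝ)) * ∑ i, ((1 + t) * ‖a i‖ ^ 2 + (1 + 1 / t) * ‖b i‖ ^ 2) := by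
    unfold msq; rw [Finset.sum_add_distrib, ← Finset.mul_sum, ← Finset.mul_sum]; ring
  rw [this]
  unfold msq
  gcongr with i
  exact norm_add_sq_le_young ht _ _

lemma two_mul_inner_le {t : ℝ} (ht : 0 < t) (a b : E) :
    2 * inner ℝ a b ≤ t * ‖a‖ ^ 2 + (1 / t) * ‖b‖ ^ 2 := by
  have h1 := real_inner_le_norm a b
  have h3 : 0 ≤ (1 / t) * (t * ‖a‖ - ‖b‖) ^ 2 := by positivity
  have h4 : (1 / t) * (t * ‖a‖ - ‖b‖) ^ 2
      = t * ‖a‖ ^ 2 - 2 * (‖a‖ * ‖b‖) + (1 / t) * ‖b‖ ^ 2 := by field_simp; ring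
  linarith

lemma two_mul_mean_inner_le {t : ℝ} (ht : 0 < t) (a b : Fin n → E) :
    2 * ((1 / (n : ℝ)) * ∑ i, inner ℝ (a i) (b i)) ≤ t * msq a + (1 / t) * msq b := by
  have : t * msq a + (1 / t) * msq b
      = (1 / (n : ℝ)) * ∑ i, (t * ‖a i‖ ^ 2 + (1 / t) * ‖b i‖ ^ 2) := by
    unfold msq; rw [Finset.sum_add_distrib, ← Finset.mul_sum, ← Finset.mul_sum]; ring
  rw [this, mul_left_comm, Finset.mul_sum]
  gcongr with i
  exact two_mul_inner_le ht _ _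

/-- Bias-variance decomposition. -/
lemma msq_sub_eq (hn : 0 < n) (a : Fin n → E) (c : E) :
    msq (fun i => a i - c) = msq (fun i => a i - mean a) + ‖mean a - c‖ ^ 2 := by
  have h : ∀ i, ‖a i - c‖ ^ 2 = ‖a i - mean a‖ ^ 2
      + 2 * inner ℝ (mean a - c) (a i - mean a) + ‖mean a - c‖ ^ 2 := by
    intro i
    rw [← sub_add_sub_cancel (a i) (mean a) c, norm_add_sq_real, real_inner_comm]
  have h0 : (1 / (n : ℝ)) * ∑ i, inner ℝ (mean a - c) (a i - mean a) = 0 := by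
    rw [← inner_mean, mean_sub, mean_const hn]; simp
  unfold msq
  simp_rw [h, Finset.sum_add_distrib, mul_add, ← Finset.mul_sum]
  rw [mul_left_comm, h0]
  have := inv_card_mul_sum_const hn (‖mean a - c‖ ^ 2)
  linarith

lemma msq_sub_mean_le (hn : 0 < n) (a : Fin n → E) (c : E) :
    msq (fun i => a i - mean a) ≤ msq (fun i => a i - c) := by
  rw [msq_sub_eq hn a c]; nlinarith [sq_nonneg ‖mean a - c‖]

end Mean

/-! ### Mixing with a doubly stochastic matrix -/

section Mixing

variable {n m : ℕ} {W : Matrix (Fin n) (Fin n) ℝ}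

lemma mean_mix (hW : W ∈ doublyStochastic ℝ (Fin n)) (a : Fin n → Vec m) :
    mean (fun i => ∑ j, W i j • a j) = mean a := by
  unfold mean
  rw [Finset.sum_comm]
  congr 1
  refine Finset.sum_congr rfl fun j _ => ?_
  rw [← Finset.sum_smul, sum_col_of_mem_doublyStochastic hW, one_smul]

lemma mix_sub (hW : W ∈ doublyStochastic ℝ (Fin n)) (a : Fin n → Vec m) (c : Vec m) (i : Fin n) :
    ∑ j, W i j • a j - c = ∑ j, W i j • (a j - c) := by
  simp_rw [smul_sub, Finset.sum_sub_distrib, ← Finset.sum_smul,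
    sum_row_of_mem_doublyStochastic hW, one_smul]

lemma msq_mix_sub_le (hW : W ∈ doublyStochastic ℝ (Fin n)) (a : Fin n → Vec m) (c : Vec m) :
    msq (fun i => ∑ j, W i j • a j - c) ≤ msq (fun i => a i - c) := by
  unfold msq
  gcongr ?_ * ?_
  calc ∑ i, ‖∑ j, W i j • a j - c‖ ^ 2 ≤ ∑ i, ∑ j, W i j * ‖a j - c‖ ^ 2 := by
        gcongr with i
        rw [mix_sub hW]
        exact norm_sum_smul_sq_le _ (fun j => nonneg_of_mem_doublyStochastic hW)
          (sum_row_of_mem_doublyStochastic hW i) _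
    _ = ∑ j, ‖a j - c‖ ^ 2 := by
        rw [Finset.sum_comm]
        refine Finset.sum_congr rfl fun j _ => ?_
        rw [← Finset.sum_mul, sum_col_of_mem_doublyStochastic hW, one_mul]

/-- Applying a matrix with scalar entries to a family of vectors enlarges the sum of squares by
at most the square of its spectral norm; this is checked coordinate by coordinate. -/
lemma sum_norm_sq_matrix_le (A : Matrix (Fin n) (Fin n) ℝ) (a : Fin n → Vec m) :
    ∑ i, ‖∑ j, A i j • a j‖ ^ 2
      ≤ ‖Matrix.toEuclideanCLM (n := Fin n) (𝕜 := ℝ) A‖ ^ 2 * ∑ j, ‖a j‖ ^ 2 := by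
  have key : ∀ l : Fin m, ∑ i, (∑ j, A i j * a j l) ^ 2
      ≤ ‖Matrix.toEuclideanCLM (n := Fin n) (𝕜 := ℝ) A‖ ^ 2 * ∑ j, (a j l) ^ 2 := by
    intro l
    have h := (Matrix.toEuclideanCLM (n := Fin n) (𝕜 := ℝ) A).le_opNorm
      (WithLp.toLp 2 fun j => a j l)
    have h2 := pow_le_pow_left₀ (norm_nonneg _) h 2
    rw [mul_pow, EuclideanSpace.norm_sq_eq, EuclideanSpace.norm_sq_eq] at h2
    simpa [Matrix.toEuclideanCLM_toLp, Matrix.mulVec, dotProduct] using h2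
  simp_rw [EuclideanSpace.norm_sq_eq, Real.norm_eq_abs, sq_abs]
  rw [Finset.sum_comm, Finset.sum_comm (f := fun j l => a j l ^ 2), Finset.mul_sum]
  refine Finset.sum_le_sum fun l _ => ?_
  simpa using key l

/-- Mixing contracts the deviation from the average by the factor `ρ_W`. -/
lemma msq_mix_sub_mean_le (hn : 0 < n) (hW : W ∈ doublyStochastic ℝ (Fin n))
    (a : Fin n → Vec m) :
    msq (fun i => ∑ j, W i j • a j - mean a) ≤ rho W * msq (fun i => a i - mean a) := by
  have h : ∀ i, ∑ j, W i j • a j - mean a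
      = ∑ j, (W - Matrix.of fun _ _ => 1 / (n : ℝ) : Matrix (Fin n) (Fin n) ℝ) i j
        • (a j - mean a) := by
    intro i
    have h0 : ∑ j, (1 / (n : ℝ)) • (a j - mean a) = 0 := by
      rw [← Finset.smul_sum]
      change mean (fun j => a j - mean a) = 0
      rw [mean_sub, mean_const hn, sub_self]
    rw [mix_sub hW]
    simp only [Matrix.sub_apply, Matrix.of_apply, sub_smul, Finset.sum_sub_distrib]
    rw [h0, sub_zero]
  unfold msq rho
  simp_rw [h]
  rw [mul_left_comm]
  gcongr
  exact sum_norm_sq_matrix_le _ _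

lemma rho_nonneg (W : Matrix (Fin n) (Fin n) ℝ) : 0 ≤ rho W := by unfold rho; positivity

/-- One round of perturbation and mixing: the dispersion of the nodes is contracted up to a
multiple of the mean square of the perturbation. -/
lemma msq_mix_add_le (hn : 0 < n) (hW : W ∈ doublyStochastic ℝ (Fin n)) (hρ : rho W < 1)
    (a b : Fin n → Vec m) :
    msq (fun i => ∑ j, W i j • (a j + b j) - mean (fun j => a j + b j))
      ≤ (1 - (1 - rho W) / 2) * msq (fun i => a i - mean a) + 2 / (1 - rho W) * msq b := by
  have hρ0 := rho_nonneg W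
  have h1 := msq_mix_sub_mean_le hn hW (fun j => a j + b j)
  have h2 := msq_sub_mean_le hn (fun j => a j + b j) (mean a)
  have h3 := msq_add_le (t := (1 - rho W) / 2) (by linarith) (fun i => a i - mean a) b
  have h4 : (fun i => a i + b i - mean a) = fun i => a i - mean a + b i := by
    funext i; abel
  rw [h4] at h2
  have hA := msq_nonneg (fun i => a i - mean a)
  have hB := msq_nonneg b
  refine h1.trans ((mul_le_mul_of_nonneg_left (h2.trans h3) hρ0).trans ?_)
  rw [mul_add, ← mul_assoc, ← mul_assoc]
  have hd : 0 < 1 - rho W := by linarith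
  gcongr
  · nlinarith
  · rw [one_div_div, le_div_iff₀ hd, mul_assoc, add_mul, div_mul_cancel₀ _ hd.ne']
    nlinarith

end Mixing

/-! ### Metric projection -/

section Projection

variable {d : ℕ} {Y : Set (Vec d)}

lemma proj_spec (hc : IsClosed Y) (hne : Y.Nonempty) (y : Vec d) :
    proj Y y ∈ Y ∧ ∀ w ∈ Y, ‖y - proj Y y‖ ≤ ‖y - w‖ := by
  refine Classical.epsilon_spec (p := fun z => z ∈ Y ∧ ∀ w ∈ Y, ‖y - z‖ ≤ ‖y - w‖) ?_
  obtain ⟨z, hz, h⟩ := hc.exists_infDist_eq_dist hne y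
  refine ⟨z, hz, fun w hw => ?_⟩
  rw [← dist_eq_norm, ← dist_eq_norm, ← h]
  exact Metric.infDist_le_dist_of_mem hw

lemma proj_inner_le (hc : IsClosed Y) (hconv : Convex ℝ Y) (hne : Y.Nonempty) (y : Vec d)
    {w : Vec d} (hw : w ∈ Y) : inner ℝ (y - proj Y y) (w - proj Y y) ≤ 0 := by
  obtain ⟨h1, h2⟩ := proj_spec hc hne y
  refine (norm_eq_iInf_iff_real_inner_le_zero hconv h1).1 ?_ w hw
  have : Nonempty Y := hne.to_subtype
  refine le_antisymm (le_ciInf fun w => h2 w w.2) ?_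
  exact ciInf_le ⟨0, by rintro _ ⟨w, rfl⟩; exact norm_nonneg _⟩ (⟨_, h1⟩ : Y)

/-- The metric projection is nonexpansive. -/
lemma norm_proj_sub_le (hc : IsClosed Y) (hconv : Convex ℝ Y) (hne : Y.Nonempty) (y y' : Vec d) :
    ‖proj Y y - proj Y y'‖ ≤ ‖y - y'‖ := by
  have h1 := proj_inner_le hc hconv hne y (proj_spec hc hne y').1
  have h2 := proj_inner_le hc hconv hne y' (proj_spec hc hne y).1
  have h3 : ‖proj Y y - proj Y y'‖ ^ 2 ≤ inner ℝ (y - y') (proj Y y - proj Y y') := by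
    rw [← real_inner_self_eq_norm_sq]
    have e1 : inner ℝ (y - proj Y y) (proj Y y' - proj Y y)
        = inner ℝ (proj Y y - y) (proj Y y - proj Y y') := by
      rw [← neg_sub y, ← neg_sub (proj Y y') (proj Y y), inner_neg_neg]
    rw [e1] at h1
    have e2 : (proj Y y - proj Y y') - (y - y') = (proj Y y - y) + (y' - proj Y y') := by abel
    have e3 : inner ℝ ((proj Y y - proj Y y') - (y - y')) (proj Y y - proj Y y') ≤ 0 := by
      rw [e2, inner_add_left]; linarith
    rw [inner_sub_left] at e3
    linarith
  have h4 := real_inner_le_norm (y - y') (proj Y y - proj Y y')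
  by_contra! hlt
  nlinarith [norm_nonneg (y - y'), norm_nonneg (proj Y y - proj Y y')]

lemma proj_eq_self (hc : IsClosed Y) {y : Vec d} (hy : y ∈ Y) : proj Y y = y := by
  have h := (proj_spec hc ⟨y, hy⟩ y).2 y hy
  rw [sub_self, norm_zero] at h
  exact (sub_eq_zero.1 (norm_le_zero_iff.1 h)).symm

lemma continuous_proj (hc : IsClosed Y) (hconv : Convex ℝ Y) (hne : Y.Nonempty) :
    Continuous (proj Y) := by
  refine (LipschitzWith.of_dist_le_mul (K := 1) fun y y' => ?_).continuous
  simpa [dist_eq_norm] using norm_proj_sub_le hc hconv hne y y'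

end Projection

/-! ### Summation lemmas -/

/-- Abel summation: the increments of a sequence bounded by `S`, weighted with nondecreasing
weights. -/
lemma sum_mul_sub_le {b a : ℕ → ℝ} (hb0 : 0 ≤ b 0) (hb : Monotone b) {S : ℝ} (K : ℕ)
    (ha : ∀ k ≤ K + 1, a k ≤ S) :
    ∑ k ∈ Finset.range (K + 1), b k * (a k - a (k + 1)) ≤ b K * (S - a (K + 1)) := by
  induction K with
  | zero =>
    simp only [zero_add, Finset.range_one, Finset.sum_singleton]
    have := ha 0 (by omega)
    gcongr
  | succ K ih =>
    rw [Finset.sum_range_succ]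
    have h1 := ih fun k hk => ha k (by omega)
    have h2 := hb (Nat.le_succ K)
    have h3 := ha (K + 1) (by omega)
    have : b K * (S - a (K + 1)) ≤ b (K + 1) * (S - a (K + 1)) :=
      mul_le_mul_of_nonneg_right h2 (by linarith)
    linarith

/-- The logarithmic bound behind adaptive stepsizes. -/
lemma sum_div_le_log {m h : ℕ → ℝ} (hm0 : 0 < m 0) (hh : ∀ k, 0 ≤ h k)
    (hm : ∀ k, m (k + 1) = m k + h k) (K : ℕ) :
    0 < m K ∧ ∑ k ∈ Finset.range K, h k / m (k + 1) ≤ Real.log (m K / m 0) := by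
  induction K with
  | zero => simp [hm0, hm0.ne']
  | succ K ih =>
    obtain ⟨h1, h2⟩ := ih
    have h3 : 0 < m (K + 1) := by rw [hm]; linarith [hh K]
    refine ⟨h3, ?_⟩
    rw [Finset.sum_range_succ]
    have h4 : h K / m (K + 1) ≤ Real.log (m (K + 1) / m K) := by
      have := Real.one_sub_inv_le_log_of_pos (div_pos h3 h1)
      rw [inv_div] at this
      have e : h K / m (K + 1) = 1 - m K / m (K + 1) := by
        rw [eq_sub_iff_add_eq, ← add_div, hm, add_comm (h K), div_self]
        rw [← hm]; exact h3.ne'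
      linarith
    have h5 : Real.log (m (K + 1) / m 0) = Real.log (m (K + 1) / m K) + Real.log (m K / m 0) := by
      rw [← Real.log_mul (by positivity) (by positivity)]
      congr 1
      field_simp
    linarith

/-- Sums of squared gradients weighted with a power of their running total. -/
lemma sum_rpow_mul_le {m h : ℕ → ℝ} {c a s : ℝ} (hc : 0 < c) (hm0 : m 0 = c) (hh : ∀ k, 0 ≤ h k)
    (hm : ∀ k, m (k + 1) = m k + h k) {K : ℕ} (hK : 1 ≤ K) (ha : m K ≤ a * K) (hca : c ≤ a) :
    ∑ k ∈ Finset.range K, m (k + 1) ^ (-s) * h k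
      ≤ (c ^ (1 - s) + a ^ (1 - s)) * (1 + Real.log (a / c))
        * ((1 + (K : ℝ) ^ (1 - s)) * (1 + Real.log K)) := by
  have hmono : Monotone m := monotone_nat_of_le_succ fun k => by rw [hm]; linarith [hh k]
  have hK' : (1 : ℝ) ≤ K := by exact_mod_cast hK
  have ha0 : 0 < a := hc.trans_le hca
  have hlog := sum_div_le_log (hm0 ▸ hc) hh hm K
  have hcm : ∀ k, c ≤ m k := fun k => hm0 ▸ hmono (Nat.zero_le k)
  have hterm : ∀ k ∈ Finset.range K, m (k + 1) ^ (-s) * h k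
      ≤ (c ^ (1 - s) + (a * K) ^ (1 - s)) * (h k / m (k + 1)) := by
    intro k hk
    have hp : 0 < m (k + 1) := hc.trans_le (hcm _)
    have hle : m (k + 1) ≤ a * K :=
      (hmono (Nat.succ_le_of_lt (Finset.mem_range.1 hk))).trans ha
    have e : m (k + 1) ^ (-s) * h k = m (k + 1) ^ (1 - s) * (h k / m (k + 1)) := by
      rw [sub_eq_neg_add, Real.rpow_add hp, Real.rpow_one]; field_simp
    rw [e]
    have hq : 0 ≤ h k / m (k + 1) := div_nonneg (hh k) hp.le
    refine mul_le_mul_of_nonneg_right ?_ hq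
    rcases le_total 0 (1 - s) with h1 | h1
    · have := Real.rpow_le_rpow hp.le hle h1
      have : 0 ≤ c ^ (1 - s) := by positivity
      linarith
    · have := Real.rpow_le_rpow_of_nonpos hc (hcm (k + 1)) h1
      have : 0 ≤ (a * K) ^ (1 - s) := by positivity
      linarith
  have hl1 : 0 ≤ Real.log (a / c) := Real.log_nonneg (by rwa [one_le_div hc])
  have hl2 : 0 ≤ Real.log K := Real.log_nonneg hK'
  have hl : Real.log (m K / m 0) ≤ (1 + Real.log (a / c)) * (1 + Real.log K) := by
    calc Real.log (m K / m 0) ≤ Real.log (a / c * K) := by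
          refine Real.log_le_log (div_pos hlog.1 (hm0 ▸ hc)) ?_
          rw [hm0, div_mul_eq_mul_div]; gcongr
      _ = Real.log (a / c) + Real.log K := by
          rw [Real.log_mul (by positivity) (by positivity)]
      _ ≤ _ := by nlinarith
  have hpow : c ^ (1 - s) + (a * K) ^ (1 - s)
      ≤ (c ^ (1 - s) + a ^ (1 - s)) * (1 + (K : ℝ) ^ (1 - s)) := by
    rw [Real.mul_rpow ha0.le (by positivity)]
    have h1 : 0 ≤ c ^ (1 - s) := by positivity
    have h2 : 0 ≤ a ^ (1 - s) := by positivity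
    have h3 : 0 ≤ (K : ℝ) ^ (1 - s) := by positivity
    nlinarith [mul_nonneg h1 h3]
  calc _ ≤ ∑ k ∈ Finset.range K, (c ^ (1 - s) + (a * K) ^ (1 - s)) * (h k / m (k + 1)) :=
        Finset.sum_le_sum hterm
    _ = (c ^ (1 - s) + (a * K) ^ (1 - s)) * ∑ k ∈ Finset.range K, h k / m (k + 1) := by
        rw [Finset.mul_sum]
    _ ≤ ((c ^ (1 - s) + a ^ (1 - s)) * (1 + (K : ℝ) ^ (1 - s)))
          * ((1 + Real.log (a / c)) * (1 + Real.log K)) := by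
        refine mul_le_mul hpow (hlog.2.trans hl)
          (Finset.sum_nonneg fun k _ => div_nonneg (hh k) (hc.le.trans (hcm _))) ?_
        positivity
    _ = _ := by ring

/-- Weighted sums along a contractive recursion with perturbations. -/
lemma sum_weighted_contraction_le {A B p : ℕ → ℝ} {δ S : ℝ} (hδ : 0 < δ) (hp0 : 0 ≤ p 0)
    (hp : Monotone p) (hA : ∀ k, 0 ≤ A k) (hAS : ∀ k, A k ≤ S)
    (hrec : ∀ k, A (k + 1) ≤ (1 - δ / 2) * A k + 2 / δ * B k) (K : ℕ) :
    ∑ k ∈ Finset.range (K + 1), p k * A k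
      ≤ 2 / δ * (p K * S) + 4 / δ ^ 2 * ∑ k ∈ Finset.range (K + 1), p k * B k := by
  have hpk : ∀ k, 0 ≤ p k := fun k => hp0.trans (hp (Nat.zero_le k))
  have h1 := sum_mul_sub_le hp0 hp K (S := S) (a := A) fun k _ => hAS k
  have h2 : δ / 2 * ∑ k ∈ Finset.range (K + 1), p k * A k
      ≤ ∑ k ∈ Finset.range (K + 1), p k * (A k - A (k + 1))
        + 2 / δ * ∑ k ∈ Finset.range (K + 1), p k * B k := by
    rw [Finset.mul_sum, Finset.mul_sum, ← Finset.sum_add_distrib]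
    refine Finset.sum_le_sum fun k _ => ?_
    have := mul_le_mul_of_nonneg_left (hrec k) (hpk k)
    linarith
  have h3 : p K * (S - A (K + 1)) ≤ p K * S := by
    have := mul_nonneg (hpk K) (hA (K + 1)); linarith
  have h4 : δ / 2 * ∑ k ∈ Finset.range (K + 1), p k * A k
      ≤ p K * S + 2 / δ * ∑ k ∈ Finset.range (K + 1), p k * B k := by linarith
  have h5 := mul_le_mul_of_nonneg_left h4 (show (0 : ℝ) ≤ 2 / δ by positivity)
  have e1 : 2 / δ * (δ / 2 * ∑ k ∈ Finset.range (K + 1), p k * A k)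
      = ∑ k ∈ Finset.range (K + 1), p k * A k := by field_simp
  have e2 : 2 / δ * (p K * S + 2 / δ * ∑ k ∈ Finset.range (K + 1), p k * B k)
      = 2 / δ * (p K * S) + 4 / δ ^ 2 * ∑ k ∈ Finset.range (K + 1), p k * B k := by
    field_simp; ring
  linarith

/-- Plain sums along a contractive recursion with perturbations. -/
lemma sum_contraction_le {A B : ℕ → ℝ} {δ : ℝ} (hδ : 0 < δ) (hA : ∀ k, 0 ≤ A k)
    (hrec : ∀ k, A (k + 1) ≤ (1 - δ / 2) * A k + 2 / δ * B k) (K : ℕ) :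
    ∑ k ∈ Finset.range K, A k ≤ 2 / δ * A 0 + 4 / δ ^ 2 * ∑ k ∈ Finset.range K, B k := by
  have h : ∑ k ∈ Finset.range K, A k + 2 / δ * A K
      ≤ 2 / δ * A 0 + 4 / δ ^ 2 * ∑ k ∈ Finset.range K, B k := by
    induction K with
    | zero => simp
    | succ K ih =>
      rw [Finset.sum_range_succ, Finset.sum_range_succ]
      have h1 := mul_le_mul_of_nonneg_left (hrec K) (show (0 : ℝ) ≤ 2 / δ by positivity)
      have e1 : 2 / δ * ((1 - δ / 2) * A K + 2 / δ * B K)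
          = 2 / δ * A K - A K + 4 / δ ^ 2 * B K := by field_simp; ring
      rw [e1] at h1
      linarith
  have := hA K
  have : 0 ≤ 2 / δ * A K := by positivity
  linarith

/-! ### The objective, its maximizer in the dual variable and the primal function -/

namespace Problem

section Objective

variable {n p d : ℕ} {Ξ : Type*} [MeasurableSpace Ξ] {Q : Problem n p d Ξ} {L μ C : ℝ}

/-- The partial gradient `∇ₓ f = (1/n) ∑ ∇ₓ fᵢ` of the global objective. -/
noncomputable def avgX (Q : Problem n p d Ξ) (x : Vec p) (y : Vec d) : Vec p :=
  mean fun i => gradX (Q.local_f i) x y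

/-- The partial gradient `∇_y f = (1/n) ∑ ∇_y fᵢ` of the global objective. -/
noncomputable def avgY (Q : Problem n p d Ξ) (x : Vec p) (y : Vec d) : Vec d :=
  mean fun i => gradY (Q.local_f i) x y

lemma hasFDerivAt_f_left (hjs : Q.JointlySmooth L) (x : Vec p) {y : Vec d} (hy : y ∈ Q.Y) :
    HasFDerivAt (fun x' => Q.f x' y) (innerSL ℝ (Q.avgX x y)) x := by
  have h : ∀ i, HasFDerivAt (fun x' => Q.local_f i x' y)
      (innerSL ℝ (gradX (Q.local_f i) x y)) x := by
    intro i
    have h1 : DifferentiableAt ℝ (fun x' => Q.local_f i x' y) x :=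
      (hjs.differentiable i x y hy).comp (f := fun x' : Vec p => (x', y)) x
        (differentiableAt_id.prodMk (differentiableAt_const y))
    have h2 := h1.hasGradientAt.hasFDerivAt
    exact h2
  have h3 := (HasFDerivAt.fun_sum (u := Finset.univ) fun i _ => h i).const_mul (1 / (n : ℝ))
  refine h3.congr_fderiv ?_
  simp [avgX, mean]

lemma norm_mean_gradX_sub_sq_le (hn : 0 < n) (hjs : Q.JointlySmooth L) {xs : Fin n → Vec p}
    {ys : Fin n → Vec d} (hys : ∀ i, ys i ∈ Q.Y) (x : Vec p) {y : Vec d} (hy : y ∈ Q.Y) :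
    ‖mean (fun i => gradX (Q.local_f i) (xs i) (ys i)) - Q.avgX x y‖ ^ 2
      ≤ L ^ 2 * (msq (fun i => xs i - x) + msq fun i => ys i - y) := by
  rw [avgX, ← mean_sub]
  refine (norm_mean_sq_le hn _).trans ?_
  have e : L ^ 2 * (msq (fun i => xs i - x) + msq fun i => ys i - y)
      = (1 / (n : ℝ)) * ∑ i, L ^ 2 * (‖xs i - x‖ ^ 2 + ‖ys i - y‖ ^ 2) := by
    rw [msq, msq, ← mul_add, ← Finset.sum_add_distrib, ← Finset.mul_sum]; ring
  rw [e]
  unfold msq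
  gcongr with i
  exact hjs.lipschitz_gradX i _ _ _ (hys i) _ hy

lemma norm_mean_gradY_sub_sq_le (hn : 0 < n) (hjs : Q.JointlySmooth L) {xs : Fin n → Vec p}
    {ys : Fin n → Vec d} (hys : ∀ i, ys i ∈ Q.Y) (x : Vec p) {y : Vec d} (hy : y ∈ Q.Y) :
    ‖mean (fun i => gradY (Q.local_f i) (xs i) (ys i)) - Q.avgY x y‖ ^ 2
      ≤ L ^ 2 * (msq (fun i => xs i - x) + msq fun i => ys i - y) := by
  rw [avgY, ← mean_sub]
  refine (norm_mean_sq_le hn _).trans ?_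
  have e : L ^ 2 * (msq (fun i => xs i - x) + msq fun i => ys i - y)
      = (1 / (n : ℝ)) * ∑ i, L ^ 2 * (‖xs i - x‖ ^ 2 + ‖ys i - y‖ ^ 2) := by
    rw [msq, msq, ← mul_add, ← Finset.sum_add_distrib, ← Finset.mul_sum]; ring
  rw [e]
  unfold msq
  gcongr with i
  exact hjs.lipschitz_gradY i _ _ _ (hys i) _ hy

lemma norm_avgX_sub_sq_le (hn : 0 < n) (hjs : Q.JointlySmooth L) (x x' : Vec p) {y y' : Vec d}
    (hy : y ∈ Q.Y) (hy' : y' ∈ Q.Y) :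
    ‖Q.avgX x y - Q.avgX x' y'‖ ^ 2 ≤ L ^ 2 * (‖x - x'‖ ^ 2 + ‖y - y'‖ ^ 2) := by
  have h := norm_mean_gradX_sub_sq_le hn hjs (xs := fun _ => x) (ys := fun _ => y)
    (fun _ => hy) x' hy'
  simp only [msq, inv_card_mul_sum_const hn] at h
  exact h

lemma norm_avgX_sub_le_left (hn : 0 < n) (hL : 0 < L) (hjs : Q.JointlySmooth L) (x x' : Vec p)
    {y : Vec d} (hy : y ∈ Q.Y) : ‖Q.avgX x y - Q.avgX x' y‖ ≤ L * ‖x - x'‖ := by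
  have h := norm_avgX_sub_sq_le hn hjs x x' hy hy
  refine abs_le_of_sq_le_sq' (a := ‖_‖) ?_ (by positivity) |>.2
  simpa [mul_pow] using h

lemma norm_avgX_sub_le_right (hn : 0 < n) (hL : 0 < L) (hjs : Q.JointlySmooth L) (x : Vec p)
    {y y' : Vec d} (hy : y ∈ Q.Y) (hy' : y' ∈ Q.Y) :
    ‖Q.avgX x y - Q.avgX x y'‖ ≤ L * ‖y - y'‖ := by
  have h := norm_avgX_sub_sq_le hn hjs x x hy hy'
  refine abs_le_of_sq_le_sq' (a := ‖_‖) ?_ (by positivity) |>.2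
  simpa [mul_pow] using h

lemma norm_gradX_le (hwp : Q.WellPosed) (hbu : Q.BoundedUnbiased C) (i : Fin n) (x : Vec p)
    {y : Vec d} (hy : y ∈ Q.Y) : ‖gradX (Q.local_f i) x y‖ ≤ C := by
  have := hwp.prob i
  rw [← hbu.unbiased_X i x y hy]
  simpa using norm_integral_le_of_norm_le_const (hbu.bounded_X i x y hy)

lemma norm_gradY_le (hwp : Q.WellPosed) (hbu : Q.BoundedUnbiased C) (i : Fin n) (x : Vec p)
    {y : Vec d} (hy : y ∈ Q.Y) : ‖gradY (Q.local_f i) x y‖ ≤ C := by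
  have := hwp.prob i
  rw [← hbu.unbiased_Y i x y hy]
  simpa using norm_integral_le_of_norm_le_const (hbu.bounded_Y i x y hy)

lemma norm_mean_le (hn : 0 < n) {E : Type*} [NormedAddCommGroup E] [InnerProductSpace ℝ E]
    {a : Fin n → E} (hC : 0 < C) (h : ∀ i, ‖a i‖ ≤ C) : ‖mean a‖ ≤ C := by
  have h1 := (norm_mean_sq_le hn a).trans
    (msq_le_of_forall hn fun i => pow_le_pow_left₀ (norm_nonneg _) (h i) 2)
  exact abs_le_of_sq_le_sq' h1 hC.le |>.2

lemma inner_avgY_le (hn : 0 < n) (hsc : Q.StronglyConcave μ) (x : Vec p) {y y' : Vec d}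
    (hy : y ∈ Q.Y) (hy' : y' ∈ Q.Y) :
    inner ℝ (Q.avgY x y) (y - y') + μ / 2 * ‖y - y'‖ ^ 2 ≤ Q.f x y - Q.f x y' := by
  have e1 : Q.f x y - Q.f x y' = (1 / (n : ℝ)) * ∑ i, (Q.local_f i x y - Q.local_f i x y') := by
    rw [f, f, Finset.sum_sub_distrib, mul_sub]
  have e2 : inner ℝ (Q.avgY x y) (y - y') + μ / 2 * ‖y - y'‖ ^ 2 = (1 / (n : ℝ)) *
      ∑ i, (inner ℝ (gradY (Q.local_f i) x y) (y - y') + μ / 2 * ‖y - y'‖ ^ 2) := by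
    rw [avgY, real_inner_comm, inner_mean, Finset.sum_add_distrib, mul_add,
      inv_card_mul_sum_const hn]
    simp_rw [real_inner_comm (y - y')]
  rw [e1, e2]
  gcongr with i
  exact hsc i x y hy y' hy'

/-- Bounded gradients and strong concavity force the feasible set to be bounded. -/
lemma norm_sub_le_of_mem (hn : 0 < n) (hμ : 0 < μ) (hC : 0 < C) (hwp : Q.WellPosed)
    (hsc : Q.StronglyConcave μ) (hbu : Q.BoundedUnbiased C) {y y' : Vec d}
    (hy : y ∈ Q.Y) (hy' : y' ∈ Q.Y) : ‖y - y'‖ ≤ 2 * C / μ := by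
  have h1 := inner_avgY_le hn hsc 0 hy hy'
  have h2 := inner_avgY_le hn hsc 0 hy' hy
  have b1 : ‖Q.avgY 0 y‖ ≤ C := norm_mean_le hn hC fun i => norm_gradY_le hwp hbu i 0 hy
  have b2 : ‖Q.avgY 0 y'‖ ≤ C := norm_mean_le hn hC fun i => norm_gradY_le hwp hbu i 0 hy'
  have c1 := (abs_le.1 (abs_real_inner_le_norm (Q.avgY 0 y) (y - y'))).1
  have c2 := (abs_le.1 (abs_real_inner_le_norm (Q.avgY 0 y') (y' - y))).1
  rw [norm_sub_rev y' y] at c2 h2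
  have d1 := mul_le_mul_of_nonneg_right b1 (norm_nonneg (y - y'))
  have d2 := mul_le_mul_of_nonneg_right b2 (norm_nonneg (y - y'))
  have e : μ * ‖y - y'‖ * ‖y - y'‖ ≤ 2 * C * ‖y - y'‖ := by nlinarith
  rw [le_div_iff₀ hμ]
  rcases (norm_nonneg (y - y')).eq_or_lt with h0 | h0
  · rw [← h0]; nlinarith
  · have := le_of_mul_le_mul_right e h0; linarith

/-- If the feasible set has two points, the condition number is at least one. -/
lemma mu_le_of_ne (hn : 0 < n) (hL : 0 < L) (hsc : Q.StronglyConcave μ)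
    (hjs : Q.JointlySmooth L) {y y' : Vec d} (hy : y ∈ Q.Y) (hy' : y' ∈ Q.Y) (hne : y ≠ y') :
    μ ≤ L := by
  have h1 := inner_avgY_le hn hsc 0 hy hy'
  have h2 := inner_avgY_le hn hsc 0 hy' hy
  have h3 := norm_mean_gradY_sub_sq_le hn hjs (xs := fun _ => 0) (ys := fun _ => y)
    (fun _ => hy) 0 hy'
  simp only [msq, inv_card_mul_sum_const hn, sub_self, norm_zero] at h3
  have h4 : ‖Q.avgY 0 y - Q.avgY 0 y'‖ ≤ L * ‖y - y'‖ := by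
    refine abs_le_of_sq_le_sq' (a := ‖_‖) ?_ (by positivity) |>.2
    simpa [mul_pow, avgY] using h3
  have h5 := (abs_le.1 (abs_real_inner_le_norm (Q.avgY 0 y - Q.avgY 0 y') (y - y'))).1
  have e : inner ℝ (Q.avgY 0 y') (y' - y) = - inner ℝ (Q.avgY 0 y') (y - y') := by
    rw [← inner_neg_right, neg_sub]
  rw [e, norm_sub_rev y' y] at h2
  rw [inner_sub_left] at h5
  have h6 := mul_le_mul_of_nonneg_right h4 (norm_nonneg (y - y'))
  have hpos : 0 < ‖y - y'‖ := norm_pos_iff.2 (sub_ne_zero.2 hne)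
  have : μ * ‖y - y'‖ ^ 2 ≤ L * ‖y - y'‖ ^ 2 := by nlinarith
  exact le_of_mul_le_mul_right this (by positivity)

lemma continuousOn_f (hjs : Q.JointlySmooth L) (x : Vec p) :
    ContinuousOn (fun y => Q.f x y) Q.Y := by
  intro y hy
  refine ContinuousAt.continuousWithinAt ?_
  have h : ∀ i, ContinuousAt (fun y' => Q.local_f i x y') y := fun i =>
    (hjs.differentiable i x y hy).continuousAt.comp (f := fun y' : Vec d => (x, y'))
      (continuousAt_const.prodMk continuousAt_id)
  unfold f
  exact continuousAt_const.mul (tendsto_finsetSum _ fun i _ => h i)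

lemma isArgmax_yStar (hn : 0 < n) (hμ : 0 < μ) (hC : 0 < C) (hwp : Q.WellPosed)
    (hsc : Q.StronglyConcave μ) (hjs : Q.JointlySmooth L) (hbu : Q.BoundedUnbiased C)
    (hne : Q.Y.Nonempty) (x : Vec p) : Q.IsArgmax x (Q.yStar x) := by
  refine Classical.epsilon_spec (p := Q.IsArgmax x) ?_
  have hb : Bornology.IsBounded Q.Y := by
    rw [Metric.isBounded_iff]
    exact ⟨2 * C / μ, fun y hy y' hy' => by
      rw [dist_eq_norm]; exact norm_sub_le_of_mem hn hμ hC hwp hsc hbu hy hy'⟩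
  have hcpt : IsCompact Q.Y := Metric.isCompact_of_isClosed_isBounded hwp.isClosed hb
  obtain ⟨y, hy, hmax⟩ := hcpt.exists_isMaxOn hne (continuousOn_f hjs x)
  exact ⟨y, hy, fun y' hy' => hmax hy'⟩

/-- Quadratic growth away from a maximizer, by comparison with the midpoint. -/
lemma IsArgmax.growth (hn : 0 < n) (hwp : Q.WellPosed) (hsc : Q.StronglyConcave μ) {x : Vec p}
    {y y' : Vec d} (hmax : Q.IsArgmax x y) (hy' : y' ∈ Q.Y) :
    μ / 4 * ‖y - y'‖ ^ 2 ≤ Q.f x y - Q.f x y' := by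
  set m : Vec d := (1 / 2 : ℝ) • y + (1 / 2 : ℝ) • y' with hm
  have hmY : m ∈ Q.Y := hwp.convex hmax.1 hy' (by norm_num) (by norm_num) (by norm_num)
  have e1 : m - y = (1 / 2 : ℝ) • (y' - y) := by rw [hm]; module
  have e2 : m - y' = -((1 / 2 : ℝ) • (y' - y)) := by rw [hm]; module
  have h1 := inner_avgY_le hn hsc x hmY hmax.1
  have h2 := inner_avgY_le hn hsc x hmY hy'
  have h3 := hmax.2 m hmY
  rw [e1] at h1
  rw [e2, inner_neg_right, norm_neg] at h2
  have e3 : ‖(1 / 2 : ℝ) • (y' - y)‖ ^ 2 = 1 / 4 * ‖y - y'‖ ^ 2 := by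
    rw [norm_smul, mul_pow, norm_sub_rev]; norm_num
  rw [e3] at h1 h2
  linarith

/-- The mixed second difference of the objective. -/
lemma abs_f_second_difference_le (hn : 0 < n) (hL : 0 < L) (hjs : Q.JointlySmooth L)
    (x x' : Vec p) {y y' : Vec d} (hy : y ∈ Q.Y) (hy' : y' ∈ Q.Y) :
    |(Q.f x y - Q.f x y') - (Q.f x' y - Q.f x' y')| ≤ L * ‖y - y'‖ * ‖x - x'‖ := by
  have h := convex_univ.norm_image_sub_le_of_norm_hasFDerivWithin_le (𝕜 := ℝ)
    (f := fun x => Q.f x y - Q.f x y')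
    (f' := fun x => innerSL ℝ (Q.avgX x y) - innerSL ℝ (Q.avgX x y')) (C := L * ‖y - y'‖)
    (fun z _ => ((hasFDerivAt_f_left hjs z hy).sub
      (hasFDerivAt_f_left hjs z hy')).hasFDerivWithinAt)
    (fun z _ => by
      rw [← map_sub, innerSL_apply_norm]
      exact norm_avgX_sub_le_right hn hL hjs z hy hy') (Set.mem_univ x') (Set.mem_univ x)
  exact h

/-- The maximizer is Lipschitz: quadratic growth at both maximizers is compared with the mixed
second difference. -/
lemma norm_yStar_sub_le (hn : 0 < n) (hL : 0 < L) (hμ : 0 < μ) (hwp : Q.WellPosed)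
    (hsc : Q.StronglyConcave μ) (hjs : Q.JointlySmooth L)
    (hys : ∀ x, Q.IsArgmax x (Q.yStar x)) (x x' : Vec p) :
    ‖Q.yStar x - Q.yStar x'‖ ≤ 2 * (L / μ) * ‖x - x'‖ := by
  have h1 := (hys x).growth hn hwp hsc (hys x').1
  have h2 := (hys x').growth hn hwp hsc (hys x).1
  have h3 := (abs_le.1 (abs_f_second_difference_le hn hL hjs x x' (hys x).1 (hys x').1)).2
  rw [norm_sub_rev (Q.yStar x')] at h2
  have e : μ * ‖Q.yStar x - Q.yStar x'‖ * ‖Q.yStar x - Q.yStar x'‖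
      ≤ 2 * L * ‖x - x'‖ * ‖Q.yStar x - Q.yStar x'‖ := by nlinarith
  have e2 : 2 * (L / μ) * ‖x - x'‖ = 2 * L * ‖x - x'‖ / μ := by ring
  rw [e2, le_div_iff₀ hμ]
  rcases (norm_nonneg (Q.yStar x - Q.yStar x')).eq_or_lt with h0 | h0
  · rw [← h0]; simp; positivity
  · have := le_of_mul_le_mul_right e h0; linarith

lemma abs_f_sub_sub_inner_le (hn : 0 < n) (hL : 0 < L) (hjs : Q.JointlySmooth L)
    (x x' : Vec p) {y : Vec d} (hy : y ∈ Q.Y) :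
    |Q.f x' y - Q.f x y - inner ℝ (Q.avgX x y) (x' - x)| ≤ L * ‖x' - x‖ ^ 2 := by
  have h := (convex_segment (𝕜 := ℝ) x x').norm_image_sub_le_of_norm_hasFDerivWithin_le'
    (𝕜 := ℝ) (f := fun z => Q.f z y) (f' := fun z => innerSL ℝ (Q.avgX z y))
    (φ := innerSL ℝ (Q.avgX x y)) (C := L * ‖x' - x‖)
    (fun z _ => (hasFDerivAt_f_left hjs z hy).hasFDerivWithinAt)
    (fun z hz => by
      rw [← map_sub, innerSL_apply_norm]
      refine (norm_avgX_sub_le_left hn hL hjs z x hy).trans ?_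
      gcongr
      obtain ⟨a, b, ha, hb, hab, rfl⟩ := hz
      have : a • x + b • x' - x = b • (x' - x) := by
        rw [← eq_sub_iff_add_eq] at hab; rw [hab]; module
      rw [this, norm_smul, Real.norm_of_nonneg hb]
      have : b ≤ 1 := by linarith
      nlinarith [norm_nonneg (x' - x)])
    (left_mem_segment ℝ x x') (right_mem_segment ℝ x x')
  rw [sq, ← mul_assoc]
  exact h

/-- First-order expansion of the primal function with a quadratic remainder (Danskin). -/
lemma abs_Phi_sub_sub_inner_le (hn : 0 < n) (hL : 0 < L) (hμ : 0 < μ) (hwp : Q.WellPosed)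
    (hsc : Q.StronglyConcave μ) (hjs : Q.JointlySmooth L)
    (hys : ∀ x, Q.IsArgmax x (Q.yStar x)) (x x' : Vec p) :
    |Q.Phi x' - Q.Phi x - inner ℝ (Q.avgX x (Q.yStar x)) (x' - x)|
      ≤ L * (1 + 2 * (L / μ)) * ‖x' - x‖ ^ 2 := by
  have h1 := abs_le.1 (abs_f_sub_sub_inner_le hn hL hjs x x' (hys x).1)
  have h2 := abs_le.1 (abs_f_sub_sub_inner_le hn hL hjs x x' (hys x').1)
  have h3 := (hys x').2 _ (hys x).1
  have h4 := (hys x).2 _ (hys x').1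
  have h5 := norm_avgX_sub_le_right hn hL hjs x (hys x').1 (hys x).1
  have h6 := norm_yStar_sub_le hn hL hμ hwp hsc hjs hys x' x
  have h7 : inner ℝ (Q.avgX x (Q.yStar x')) (x' - x) - inner ℝ (Q.avgX x (Q.yStar x)) (x' - x)
      ≤ L * (2 * (L / μ)) * ‖x' - x‖ ^ 2 := by
    rw [← inner_sub_left]
    calc _ ≤ ‖Q.avgX x (Q.yStar x') - Q.avgX x (Q.yStar x)‖ * ‖x' - x‖ := real_inner_le_norm _ _
      _ ≤ (L * (2 * (L / μ) * ‖x' - x‖)) * ‖x' - x‖ := by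
          gcongr; exact h5.trans (by gcongr)
      _ = _ := by ring
  have h8 : 0 ≤ L * (2 * (L / μ)) * ‖x' - x‖ ^ 2 := by positivity
  unfold Phi
  rw [abs_le]
  constructor <;> nlinarith

lemma hasGradientAt_Phi (hn : 0 < n) (hL : 0 < L) (hμ : 0 < μ) (hwp : Q.WellPosed)
    (hsc : Q.StronglyConcave μ) (hjs : Q.JointlySmooth L)
    (hys : ∀ x, Q.IsArgmax x (Q.yStar x)) (x : Vec p) :
    HasGradientAt Q.Phi (Q.avgX x (Q.yStar x)) x := by
  rw [hasGradientAt_iff_isLittleO]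
  refine Asymptotics.IsBigO.trans_isLittleO (g := fun x' => ‖x' - x‖ ^ 2) ?_ ?_
  · refine Asymptotics.IsBigO.of_bound (L * (1 + 2 * (L / μ))) (Filter.Eventually.of_forall ?_)
    intro x'
    have h := abs_Phi_sub_sub_inner_le hn hL hμ hwp hsc hjs hys x x'
    simpa using h
  · have h := Asymptotics.isLittleO_pow_sub_sub x (m := 2) (by norm_num)
    simpa using h

lemma gradient_Phi (hn : 0 < n) (hL : 0 < L) (hμ : 0 < μ) (hwp : Q.WellPosed)
    (hsc : Q.StronglyConcave μ) (hjs : Q.JointlySmooth L)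
    (hys : ∀ x, Q.IsArgmax x (Q.yStar x)) (x : Vec p) :
    gradient Q.Phi x = Q.avgX x (Q.yStar x) :=
  (hasGradientAt_Phi hn hL hμ hwp hsc hjs hys x).gradient

lemma norm_gradient_Phi_le (hn : 0 < n) (hL : 0 < L) (hμ : 0 < μ) (hC : 0 < C)
    (hwp : Q.WellPosed) (hsc : Q.StronglyConcave μ) (hjs : Q.JointlySmooth L)
    (hbu : Q.BoundedUnbiased C) (hys : ∀ x, Q.IsArgmax x (Q.yStar x)) (x : Vec p) :
    ‖gradient Q.Phi x‖ ≤ C := by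
  rw [gradient_Phi hn hL hμ hwp hsc hjs hys]
  exact norm_mean_le hn hC fun i => norm_gradX_le hwp hbu i x (hys x).1

lemma continuous_yStar (hn : 0 < n) (hL : 0 < L) (hμ : 0 < μ) (hwp : Q.WellPosed)
    (hsc : Q.StronglyConcave μ) (hjs : Q.JointlySmooth L)
    (hys : ∀ x, Q.IsArgmax x (Q.yStar x)) : Continuous Q.yStar := by
  refine (LipschitzWith.of_dist_le_mul (K := ⟨2 * (L / μ), by positivity⟩)
    fun x x' => ?_).continuous
  rw [dist_eq_norm, dist_eq_norm]
  exact norm_yStar_sub_le hn hL hμ hwp hsc hjs hys x x'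

lemma continuous_gradient_Phi (hn : 0 < n) (hL : 0 < L) (hμ : 0 < μ) (hwp : Q.WellPosed)
    (hsc : Q.StronglyConcave μ) (hjs : Q.JointlySmooth L)
    (hys : ∀ x, Q.IsArgmax x (Q.yStar x)) : Continuous (gradient Q.Phi) := by
  refine (LipschitzWith.of_dist_le_mul (K := ⟨L * (1 + 2 * (L / μ)), by positivity⟩)
    fun x x' => ?_).continuous
  rw [dist_eq_norm, dist_eq_norm, gradient_Phi hn hL hμ hwp hsc hjs hys,
    gradient_Phi hn hL hμ hwp hsc hjs hys]
  have h1 := norm_avgX_sub_le_left hn hL hjs x x' (hys x).1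
  have h2 := norm_avgX_sub_le_right hn hL hjs x' (hys x).1 (hys x').1
  have h3 := mul_le_mul_of_nonneg_left (norm_yStar_sub_le hn hL hμ hwp hsc hjs hys x x') hL.le
  have h4 := norm_sub_le_norm_sub_add_norm_sub (Q.avgX x (Q.yStar x)) (Q.avgX x' (Q.yStar x))
    (Q.avgX x' (Q.yStar x'))
  calc _ ≤ L * ‖x - x'‖ + L * (2 * (L / μ) * ‖x - x'‖) := by linarith
    _ = L * (1 + 2 * (L / μ)) * ‖x - x'‖ := by ring

/-- The ascent direction at a feasible point, compared with the maximizer for another value of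
the primal variable. The error is quadratic in the distance of the two primal variables although
the gradient at a constrained maximizer need not vanish. -/
lemma inner_avgY_sub_yStar_le (hn : 0 < n) (hL : 0 < L) (hμ : 0 < μ) (hwp : Q.WellPosed)
    (hsc : Q.StronglyConcave μ) (hjs : Q.JointlySmooth L)
    (hys : ∀ x, Q.IsArgmax x (Q.yStar x)) (x x' : Vec p) {y : Vec d} (hy : y ∈ Q.Y) :
    inner ℝ (Q.avgY x y) (y - Q.yStar x')
      ≤ L * (2 * (L / μ)) * ‖x - x'‖ ^ 2 - μ / 2 * ‖y - Q.yStar x'‖ ^ 2 := by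
  have h1 := inner_avgY_le hn hsc x hy (hys x').1
  have h2 := (hys x).2 y hy
  have h3 := (abs_le.1 (abs_f_second_difference_le hn hL hjs x x' (hys x).1 (hys x').1)).2
  have h4 := (hys x').2 _ (hys x).1
  have h5 := norm_yStar_sub_le hn hL hμ hwp hsc hjs hys x x'
  have h6 : L * ‖Q.yStar x - Q.yStar x'‖ * ‖x - x'‖ ≤ L * (2 * (L / μ)) * ‖x - x'‖ ^ 2 := by
    calc _ ≤ L * (2 * (L / μ) * ‖x - x'‖) * ‖x - x'‖ := by gcongr
      _ = _ := by ring
  linarith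

end Objective

end Problem

/-! ### Trajectories of the algorithm -/

/-- A trajectory of D-TiAda with stochastic gradients `gx`, `gy`: the recursion of the algorithm
together with the bounds that hold along almost every sample path. The numbers `ζv`, `ζu` bound the
relative deviation of the local stepsizes from the network averages, and `R` bounds the initial
dispersion of the primal variables. -/
structure Trajectory {n p d : ℕ} {Ξ : Type*} [MeasurableSpace Ξ] (Q : Problem n p d Ξ)
    (W : Matrix (Fin n) (Fin n) ℝ) (θ : Params) (C ζv ζu R : ℝ) (S : ℕ → State n p d)
    (gx : ℕ → Fin n → Vec p) (gy : ℕ → Fin n → Vec d) : Prop where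
  n_pos : 0 < n
  adm : θ.Admissible
  C_pos : 0 < C
  mix : W ∈ doublyStochastic ℝ (Fin n)
  rho_lt : rho W < 1
  y_mem : ∀ k i, (S k).y i ∈ Q.Y
  x_succ : ∀ k i, (S (k + 1)).x i
    = ∑ j, W i j • ((S k).x j - (θ.γx * (S (k + 1)).v j ^ (-θ.α)) • gx k j)
  y_succ : ∀ k i, (S (k + 1)).y i
    = proj Q.Y (∑ j, W i j • ((S k).y j + (θ.γy * (S (k + 1)).u j ^ (-θ.β)) • gy k j))
  mx_zero : ∀ i, (S 0).mx i = θ.c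
  my_zero : ∀ i, (S 0).my i = θ.c
  mx_succ : ∀ k i, (S (k + 1)).mx i = (S k).mx i + ‖gx k i‖ ^ 2
  my_succ : ∀ k i, (S (k + 1)).my i = (S k).my i + ‖gy k i‖ ^ 2
  norm_gx_le : ∀ k i, ‖gx k i‖ ≤ C
  norm_gy_le : ∀ k i, ‖gy k i‖ ≤ C
  zv_nonneg : 0 ≤ ζv
  zv_le_one : ζv ≤ 1
  zv : ∀ k i, |(S (k + 1)).v i ^ (-θ.α) - (S (k + 1)).vbar ^ (-θ.α)|
    ≤ ζv * (S (k + 1)).vbar ^ (-θ.α)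
  zu_nonneg : 0 ≤ ζu
  zu : ∀ k i, |(S (k + 1)).u i ^ (-θ.β) - (S (k + 1)).ubar ^ (-θ.β)|
    ≤ ζu * (S (k + 1)).ubar ^ (-θ.β)
  dispersion : msq (fun i => (S 0).x i - mean (S 0).x) ≤ R

/-- Average over the nodes of the accumulators of the primal gradients. -/
noncomputable def State.mxbar {n p d : ℕ} (s : State n p d) : ℝ := (1 / (n : ℝ)) * ∑ i, s.mx i

namespace Trajectory

variable {n p d : ℕ} {Ξ : Type*} [MeasurableSpace Ξ] {Q : Problem n p d Ξ}
  {W : Matrix (Fin n) (Fin n) ℝ} {θ : Params} {C ζv ζu R : ℝ} {S : ℕ → State n p d}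
  {gx : ℕ → Fin n → Vec p} {gy : ℕ → Fin n → Vec d}

/-! ### Accumulators -/

lemma msq_gx_le (h : Trajectory Q W θ C ζv ζu R S gx gy) (k : ℕ) : msq (gx k) ≤ C ^ 2 :=
  msq_le_of_forall h.n_pos fun i => pow_le_pow_left₀ (norm_nonneg _) (h.norm_gx_le k i) 2

lemma ubar_zero (h : Trajectory Q W θ C ζv ζu R S gx gy) : (S 0).ubar = θ.c := by
  simp only [State.ubar, State.u, h.my_zero]
  exact inv_card_mul_sum_const h.n_pos _

lemma mxbar_zero (h : Trajectory Q W θ C ζv ζu R S gx gy) : (S 0).mxbar = θ.c := by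
  simp only [State.mxbar, h.mx_zero]
  exact inv_card_mul_sum_const h.n_pos _

lemma vbar_zero (h : Trajectory Q W θ C ζv ζu R S gx gy) : (S 0).vbar = θ.c := by
  simp only [State.vbar, State.v, h.mx_zero, h.my_zero, max_self]
  exact inv_card_mul_sum_const h.n_pos _

lemma ubar_succ (h : Trajectory Q W θ C ζv ζu R S gx gy) (k : ℕ) :
    (S (k + 1)).ubar = (S k).ubar + msq (gy k) := by
  simp only [State.ubar, State.u, h.my_succ, Finset.sum_add_distrib, mul_add, msq]

lemma mxbar_succ (h : Trajectory Q W θ C ζv ζu R S gx gy) (k : ℕ) :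
    (S (k + 1)).mxbar = (S k).mxbar + msq (gx k) := by
  simp only [State.mxbar, h.mx_succ, Finset.sum_add_distrib, mul_add, msq]

lemma mxbar_le_vbar (s : State n p d) : s.mxbar ≤ s.vbar := by
  unfold State.mxbar State.vbar State.v
  gcongr
  exact le_max_left _ _

lemma ubar_le_vbar (s : State n p d) : s.ubar ≤ s.vbar := by
  unfold State.ubar State.vbar State.v State.u
  gcongr
  exact le_max_right _ _

lemma mono_vbar (h : Trajectory Q W θ C ζv ζu R S gx gy) : Monotone fun k => (S k).vbar := by
  refine monotone_nat_of_le_succ fun k => ?_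
  unfold State.vbar State.v
  gcongr with i
  · rw [h.mx_succ]; nlinarith [sq_nonneg ‖gx k i‖]
  · rw [h.my_succ]; nlinarith [sq_nonneg ‖gy k i‖]

lemma mono_ubar (h : Trajectory Q W θ C ζv ζu R S gx gy) : Monotone fun k => (S k).ubar :=
  monotone_nat_of_le_succ fun k => by
    simp only [h.ubar_succ]; linarith [msq_nonneg (gy k)]

lemma mono_mxbar (h : Trajectory Q W θ C ζv ζu R S gx gy) : Monotone fun k => (S k).mxbar :=
  monotone_nat_of_le_succ fun k => by
    simp only [h.mxbar_succ]; linarith [msq_nonneg (gx k)]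

lemma c_le_ubar (h : Trajectory Q W θ C ζv ζu R S gx gy) (k : ℕ) : θ.c ≤ (S k).ubar :=
  h.ubar_zero ▸ h.mono_ubar (Nat.zero_le k)

lemma c_le_mxbar (h : Trajectory Q W θ C ζv ζu R S gx gy) (k : ℕ) : θ.c ≤ (S k).mxbar :=
  h.mxbar_zero ▸ h.mono_mxbar (Nat.zero_le k)

lemma c_le_vbar (h : Trajectory Q W θ C ζv ζu R S gx gy) (k : ℕ) : θ.c ≤ (S k).vbar :=
  h.vbar_zero ▸ h.mono_vbar (Nat.zero_le k)

lemma ubar_pos (h : Trajectory Q W θ C ζv ζu R S gx gy) (k : ℕ) : 0 < (S k).ubar :=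
  h.adm.c_pos.trans_le (h.c_le_ubar k)

lemma mxbar_pos (h : Trajectory Q W θ C ζv ζu R S gx gy) (k : ℕ) : 0 < (S k).mxbar :=
  h.adm.c_pos.trans_le (h.c_le_mxbar k)

lemma vbar_pos (h : Trajectory Q W θ C ζv ζu R S gx gy) (k : ℕ) : 0 < (S k).vbar :=
  h.adm.c_pos.trans_le (h.c_le_vbar k)

lemma vbar_succ_le (h : Trajectory Q W θ C ζv ζu R S gx gy) (k : ℕ) :
    (S (k + 1)).vbar ≤ (S k).vbar + C ^ 2 := by
  have e : (S k).vbar + C ^ 2 = (1 / (n : ℝ)) * ∑ i, ((S k).v i + C ^ 2) := by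
    rw [Finset.sum_add_distrib, mul_add, inv_card_mul_sum_const h.n_pos]; rfl
  rw [e]
  unfold State.vbar State.v
  gcongr with i
  have h1 := pow_le_pow_left₀ (norm_nonneg _) (h.norm_gx_le k i) 2
  have h2 := pow_le_pow_left₀ (norm_nonneg _) (h.norm_gy_le k i) 2
  rw [h.mx_succ, h.my_succ, ← max_add_add_right]
  exact max_le_max (by linarith) (by linarith)

lemma vbar_le (h : Trajectory Q W θ C ζv ζu R S gx gy) {K : ℕ} (hK : 1 ≤ K) :
    (S K).vbar ≤ (θ.c + C ^ 2) * K := by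
  have h1 : ∀ K : ℕ, (S K).vbar ≤ θ.c + C ^ 2 * K := by
    intro K
    induction K with
    | zero => simp [h.vbar_zero]
    | succ K ih =>
      have := h.vbar_succ_le K
      push_cast
      linarith
  have h2 : (1 : ℝ) ≤ K := by exact_mod_cast hK
  have h3 := h1 K
  nlinarith [h.adm.c_pos]

/-- The accumulators grow at most by a constant factor per iteration, so that stepsizes at
consecutive times are comparable. -/
lemma vbar_succ_le_mul (h : Trajectory Q W θ C ζv ζu R S gx gy) (k : ℕ) :
    (S (k + 1)).vbar ≤ ((θ.c + C ^ 2) / θ.c) * (S k).vbar := by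
  have h1 := h.vbar_succ_le k
  have h2 := h.c_le_vbar k
  have hc := h.adm.c_pos
  have h3 : C ^ 2 ≤ C ^ 2 / θ.c * (S k).vbar := by
    rw [div_mul_eq_mul_div, le_div_iff₀ hc]; gcongr
  rw [add_div, div_self hc.ne', add_mul, one_mul]
  linarith

lemma vbar_rpow_le (h : Trajectory Q W θ C ζv ζu R S gx gy) {K : ℕ} (hK : 1 ≤ K) {s : ℝ}
    (hs : 0 ≤ s) : (S K).vbar ^ s ≤ (θ.c + C ^ 2) ^ s * (K : ℝ) ^ s := by
  rw [← Real.mul_rpow (by nlinarith [h.adm.c_pos]) (by positivity)]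
  exact Real.rpow_le_rpow (h.vbar_pos K).le (h.vbar_le hK) hs

lemma ubar_rpow_le (h : Trajectory Q W θ C ζv ζu R S gx gy) {K : ℕ} (hK : 1 ≤ K) {s : ℝ}
    (hs : 0 ≤ s) : (S K).ubar ^ s ≤ (θ.c + C ^ 2) ^ s * (K : ℝ) ^ s :=
  (Real.rpow_le_rpow (h.ubar_pos K).le (ubar_le_vbar _) hs).trans (h.vbar_rpow_le hK hs)

/-- The constant in the sums of squared gradients weighted with powers of the accumulators. -/
noncomputable def adaConst (c a s : ℝ) : ℝ := (c ^ (1 - s) + a ^ (1 - s)) * (1 + Real.log (a / c))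

lemma sum_ubar_rpow_le (h : Trajectory Q W θ C ζv ζu R S gx gy) {K : ℕ} (hK : 1 ≤ K) (s : ℝ) :
    ∑ k ∈ Finset.range K, (S (k + 1)).ubar ^ (-s) * msq (gy k)
      ≤ adaConst θ.c (θ.c + C ^ 2) s * ((1 + (K : ℝ) ^ (1 - s)) * (1 + Real.log K)) :=
  sum_rpow_mul_le (m := fun k => (S k).ubar) h.adm.c_pos h.ubar_zero
    (fun k => msq_nonneg (gy k)) h.ubar_succ hK ((ubar_le_vbar _).trans (h.vbar_le hK))
    (by nlinarith [sq_nonneg C])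

lemma sum_vbar_rpow_le (h : Trajectory Q W θ C ζv ζu R S gx gy) {K : ℕ} (hK : 1 ≤ K) {s : ℝ}
    (hs : 0 ≤ s) :
    ∑ k ∈ Finset.range K, (S (k + 1)).vbar ^ (-s) * msq (gx k)
      ≤ adaConst θ.c (θ.c + C ^ 2) s * ((1 + (K : ℝ) ^ (1 - s)) * (1 + Real.log K)) := by
  refine le_trans (Finset.sum_le_sum fun k _ => ?_)
    (sum_rpow_mul_le (m := fun k => (S k).mxbar) (s := s) h.adm.c_pos h.mxbar_zero
    (fun k => msq_nonneg (gx k)) h.mxbar_succ hK ((mxbar_le_vbar _).trans (h.vbar_le hK))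
    (by nlinarith [sq_nonneg C]))
  refine mul_le_mul_of_nonneg_right ?_ (msq_nonneg _)
  exact Real.rpow_le_rpow_of_nonpos (h.mxbar_pos _) (mxbar_le_vbar _) (by linarith)

/-! ### The averaged primal step -/

/-- The direction of the averaged primal step: the average of the local stochastic gradients, each
weighted with the ratio of the local to the average stepsize. -/
noncomputable def dir (θ : Params) (S : ℕ → State n p d) (gx : ℕ → Fin n → Vec p) (k : ℕ) :
    Vec p :=
  mean fun i => ((S (k + 1)).v i ^ (-θ.α) / (S (k + 1)).vbar ^ (-θ.α)) • gx k i

/-- Mixing preserves the average, so the averaged primal iterate makes a step along `dir`. -/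
lemma xbar_succ (h : Trajectory Q W θ C ζv ζu R S gx gy) (k : ℕ) :
    (S (k + 1)).xbar
      = (S k).xbar - (θ.γx * (S (k + 1)).vbar ^ (-θ.α)) • dir θ S gx k := by
  have h1 : (S (k + 1)).xbar = mean (S (k + 1)).x := rfl
  have h2 : (S k).xbar = mean (S k).x := rfl
  have h3 : (S (k + 1)).vbar ^ (-θ.α) ≠ 0 := (Real.rpow_pos_of_pos (h.vbar_pos _) _).ne'
  rw [h1, h2, funext (h.x_succ k), mean_mix h.mix, mean_sub, dir, ← mean_smul]
  congr 2
  funext i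
  rw [smul_smul]
  congr 1
  field_simp

lemma abs_ratio_sub_one_le (h : Trajectory Q W θ C ζv ζu R S gx gy) (k : ℕ) (i : Fin n) :
    |(S (k + 1)).v i ^ (-θ.α) / (S (k + 1)).vbar ^ (-θ.α) - 1| ≤ ζv := by
  have h3 : 0 < (S (k + 1)).vbar ^ (-θ.α) := Real.rpow_pos_of_pos (h.vbar_pos _) _
  rw [div_sub_one h3.ne', abs_div, abs_of_pos h3, div_le_iff₀ h3]
  exact h.zv k i

lemma norm_dir_sub_le (h : Trajectory Q W θ C ζv ζu R S gx gy) (k : ℕ) :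
    ‖dir θ S gx k - mean (gx k)‖ ≤ ζv * C := by
  have e : dir θ S gx k - mean (gx k) = mean fun i =>
      ((S (k + 1)).v i ^ (-θ.α) / (S (k + 1)).vbar ^ (-θ.α) - 1) • gx k i := by
    rw [dir, ← mean_sub]; simp_rw [sub_smul, one_smul]
  have h0 : 0 ≤ ζv * C := mul_nonneg h.zv_nonneg h.C_pos.le
  rw [e]
  refine abs_le_of_sq_le_sq' (a := ‖_‖) ((norm_mean_sq_le h.n_pos _).trans
    (msq_le_of_forall h.n_pos fun i => ?_)) h0 |>.2
  rw [norm_smul, Real.norm_eq_abs]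
  have := mul_le_mul (h.abs_ratio_sub_one_le k i) (h.norm_gx_le k i) (norm_nonneg _) h.zv_nonneg
  gcongr

lemma abs_ratio_le_two (h : Trajectory Q W θ C ζv ζu R S gx gy) (k : ℕ) (i : Fin n) :
    |(S (k + 1)).v i ^ (-θ.α) / (S (k + 1)).vbar ^ (-θ.α)| ≤ 2 := by
  have h1 := abs_le.1 (h.abs_ratio_sub_one_le k i)
  have h2 := h.zv_le_one
  rw [abs_le]
  constructor <;> linarith

lemma norm_dir_sq_le (h : Trajectory Q W θ C ζv ζu R S gx gy) (k : ℕ) :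
    ‖dir θ S gx k‖ ^ 2 ≤ 4 * msq (gx k) := by
  refine (norm_mean_sq_le h.n_pos _).trans (msq_mono fun i => ?_)
  rw [norm_smul, mul_pow, Real.norm_eq_abs]
  have h1 := pow_le_pow_left₀ (abs_nonneg _) (h.abs_ratio_le_two k i) 2
  nlinarith [sq_nonneg ‖gx k i‖]

lemma norm_dir_le (h : Trajectory Q W θ C ζv ζu R S gx gy) (k : ℕ) :
    ‖dir θ S gx k‖ ≤ 2 * C := by
  have h1 := h.norm_dir_sq_le k
  have h2 := h.msq_gx_le k
  refine abs_le_of_sq_le_sq' (a := ‖_‖) ?_ (by linarith [h.C_pos]) |>.2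
  nlinarith

lemma v_rpow_le (h : Trajectory Q W θ C ζv ζu R S gx gy) (k : ℕ) (i : Fin n) :
    |(S (k + 1)).v i ^ (-θ.α)| ≤ 2 * (S (k + 1)).vbar ^ (-θ.α) := by
  have h3 : 0 < (S (k + 1)).vbar ^ (-θ.α) := Real.rpow_pos_of_pos (h.vbar_pos _) _
  have h1 := h.abs_ratio_le_two k i
  rwa [abs_div, abs_of_pos h3, div_le_iff₀ h3] at h1

lemma u_rpow_le (h : Trajectory Q W θ C ζv ζu R S gx gy) (hζ : ζu ≤ 1) (k : ℕ) (i : Fin n) :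
    |(S (k + 1)).u i ^ (-θ.β)| ≤ 2 * (S (k + 1)).ubar ^ (-θ.β) := by
  have h3 : 0 < (S (k + 1)).ubar ^ (-θ.β) := Real.rpow_pos_of_pos (h.ubar_pos _) _
  have h1 := abs_le.1 (h.zu k i)
  have h2 : ζu * (S (k + 1)).ubar ^ (-θ.β) ≤ (S (k + 1)).ubar ^ (-θ.β) := by nlinarith
  rw [abs_le]
  constructor <;> linarith

/-! ### Consensus -/

/-- The dispersion of the primal variables over the nodes. -/
noncomputable def dispX (S : ℕ → State n p d) (k : ℕ) : ℝ :=
  msq fun i => (S k).x i - mean (S k).x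

/-- The dispersion of the dual variables over the nodes. -/
noncomputable def dispY (S : ℕ → State n p d) (k : ℕ) : ℝ :=
  msq fun i => (S k).y i - mean (S k).y

lemma dispX_succ_le (h : Trajectory Q W θ C ζv ζu R S gx gy) (k : ℕ) :
    dispX S (k + 1) ≤ (1 - (1 - rho W) / 2) * dispX S k
      + 2 / (1 - rho W) * (4 * θ.γx ^ 2 * ((S (k + 1)).vbar ^ (-(2 * θ.α)) * msq (gx k))) := by
  have h1 := msq_mix_add_le h.n_pos h.mix h.rho_lt (S k).x
    (fun j => -((θ.γx * (S (k + 1)).v j ^ (-θ.α)) • gx k j))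
  have h2 : dispX S (k + 1) = msq (fun i => ∑ j, W i j • ((S k).x j
      + -((θ.γx * (S (k + 1)).v j ^ (-θ.α)) • gx k j))
      - mean (fun j => (S k).x j + -((θ.γx * (S (k + 1)).v j ^ (-θ.α)) • gx k j))) := by
    simp_rw [← sub_eq_add_neg]
    rw [dispX, funext (h.x_succ k), mean_mix h.mix]
  rw [h2]
  refine h1.trans ?_
  have hd : 0 < 1 - rho W := by linarith [h.rho_lt]
  refine add_le_add le_rfl (mul_le_mul_of_nonneg_left ?_ (by positivity))
  rw [← mul_assoc]
  refine msq_mono fun i => ?_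
  rw [norm_neg, norm_smul, Real.norm_eq_abs, abs_mul, abs_of_pos h.adm.γx_pos, mul_pow, mul_pow]
  have h3 := pow_le_pow_left₀ (abs_nonneg _) (h.v_rpow_le k i) 2
  have h4 : ((S (k + 1)).vbar ^ (-θ.α)) ^ 2 = (S (k + 1)).vbar ^ (-(2 * θ.α)) := by
    rw [← Real.rpow_natCast, ← Real.rpow_mul (h.vbar_pos _).le]; congr 1; push_cast; ring
  rw [mul_pow, h4] at h3
  refine mul_le_mul_of_nonneg_right ?_ (sq_nonneg _)
  nlinarith [sq_nonneg θ.γx]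

lemma dispY_succ_le (h : Trajectory Q W θ C ζv ζu R S gx gy) (hwp : Q.WellPosed) (hζ : ζu ≤ 1)
    (k : ℕ) : dispY S (k + 1) ≤ (1 - (1 - rho W) / 2) * dispY S k
      + 2 / (1 - rho W) * (4 * θ.γy ^ 2 * ((S (k + 1)).ubar ^ (-(2 * θ.β)) * msq (gy k))) := by
  set b : Fin n → Vec d := fun j => (θ.γy * (S (k + 1)).u j ^ (-θ.β)) • gy k j with hb
  have hne : Q.Y.Nonempty := ⟨_, h.y_mem k ⟨0, h.n_pos⟩⟩
  have h1 := msq_mix_add_le h.n_pos h.mix h.rho_lt (S k).y b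
  have h2 : dispY S (k + 1) ≤ msq (fun i => ∑ j, W i j • ((S k).y j + b j)
      - mean (fun j => (S k).y j + b j)) := by
    refine (msq_sub_mean_le h.n_pos _
      (proj Q.Y (mean (fun j => (S k).y j + b j)))).trans ?_
    rw [← one_mul (msq fun i => _ - mean _)]
    refine msq_mono fun i => ?_
    rw [one_mul, h.y_succ]
    exact pow_le_pow_left₀ (norm_nonneg _)
      (norm_proj_sub_le hwp.isClosed hwp.convex hne _ _) 2
  refine h2.trans (h1.trans ?_)
  have hd : 0 < 1 - rho W := by linarith [h.rho_lt]
  refine add_le_add le_rfl (mul_le_mul_of_nonneg_left ?_ (by positivity))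
  rw [← mul_assoc]
  refine msq_mono fun i => ?_
  rw [hb, norm_smul, Real.norm_eq_abs, abs_mul, abs_of_pos h.adm.γy_pos, mul_pow, mul_pow]
  have h3 := pow_le_pow_left₀ (abs_nonneg _) (h.u_rpow_le hζ k i) 2
  have h4 : ((S (k + 1)).ubar ^ (-θ.β)) ^ 2 = (S (k + 1)).ubar ^ (-(2 * θ.β)) := by
    rw [← Real.rpow_natCast, ← Real.rpow_mul (h.ubar_pos _).le]; congr 1; push_cast; ring
  rw [mul_pow, h4] at h3
  refine mul_le_mul_of_nonneg_right ?_ (sq_nonneg _)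
  nlinarith [sq_nonneg θ.γy]

end Trajectory

/-! ### The rate -/

/-- The target rate, multiplied by the number `K` of iterations, for a network with spectral
gap `δ`. -/
noncomputable def rate (θ : Params) (δ : ℝ) (K : ℕ) : ℝ :=
  (1 + Real.log K) * ((K : ℝ) ^ θ.α + (K : ℝ) ^ (1 - θ.α) + (K : ℝ) ^ θ.β
    + (K : ℝ) ^ (1 - θ.β) / δ)

section Rate

variable {θ : Params} {δ : ℝ} {K : ℕ}

lemma one_le_one_add_log (K : ℕ) : 1 ≤ 1 + Real.log K := by
  have : 0 ≤ Real.log K := Real.log_natCast_nonneg K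
  linarith

lemma pow_alpha_le_rate (hδ : 0 < δ) (hK : 1 ≤ K) : (K : ℝ) ^ θ.α ≤ rate θ δ K := by
  have h1 := one_le_one_add_log K
  unfold rate
  refine le_trans ?_ (le_mul_of_one_le_left (by positivity) h1)
  have : 0 ≤ (K : ℝ) ^ (1 - θ.α) + (K : ℝ) ^ θ.β + (K : ℝ) ^ (1 - θ.β) / δ := by positivity
  linarith

lemma log_mul_pow_beta_le_rate (hδ : 0 < δ) (hK : 1 ≤ K) :
    (K : ℝ) ^ θ.β * (1 + Real.log K) ≤ rate θ δ K := by
  have h1 := one_le_one_add_log K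
  unfold rate
  rw [mul_comm]
  refine mul_le_mul_of_nonneg_left ?_ (by linarith)
  have : 0 ≤ (K : ℝ) ^ (1 - θ.α) + (K : ℝ) ^ θ.α + (K : ℝ) ^ (1 - θ.β) / δ := by positivity
  linarith

lemma pow_beta_le_rate (hδ : 0 < δ) (hK : 1 ≤ K) : (K : ℝ) ^ θ.β ≤ rate θ δ K :=
  (le_mul_of_one_le_right (by positivity) (one_le_one_add_log K)).trans
    (log_mul_pow_beta_le_rate hδ hK)

lemma one_le_rate (hβ : 0 < θ.β) (hδ : 0 < δ) (hK : 1 ≤ K) : 1 ≤ rate θ δ K :=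
  (Real.one_le_rpow (by exact_mod_cast hK) hβ.le).trans (pow_beta_le_rate hδ hK)

lemma log_mul_pow_one_sub_alpha_le_rate (hδ : 0 < δ) (hK : 1 ≤ K) :
    (K : ℝ) ^ (1 - θ.α) * (1 + Real.log K) ≤ rate θ δ K := by
  have h1 := one_le_one_add_log K
  unfold rate
  rw [mul_comm]
  refine mul_le_mul_of_nonneg_left ?_ (by linarith)
  have : 0 ≤ (K : ℝ) ^ θ.β + (K : ℝ) ^ θ.α + (K : ℝ) ^ (1 - θ.β) / δ := by positivity
  linarith

lemma log_mul_pow_one_sub_beta_div_le_rate (δ : ℝ) (K : ℕ) :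
    (K : ℝ) ^ (1 - θ.β) * (1 + Real.log K) / δ ≤ rate θ δ K := by
  have h1 := one_le_one_add_log K
  unfold rate
  rw [mul_comm, mul_div_assoc]
  refine mul_le_mul_of_nonneg_left ?_ (by linarith)
  have : 0 ≤ (K : ℝ) ^ θ.β + (K : ℝ) ^ θ.α + (K : ℝ) ^ (1 - θ.α) := by positivity
  linarith

lemma log_mul_pow_one_sub_beta_le_rate (hδ : 0 < δ) (hδ1 : δ ≤ 1) (hK : 1 ≤ K) :
    (K : ℝ) ^ (1 - θ.β) * (1 + Real.log K) ≤ rate θ δ K := by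
  refine le_trans ?_ (log_mul_pow_one_sub_beta_div_le_rate δ K)
  have h1 := one_le_one_add_log K
  rw [le_div_iff₀ hδ]
  exact mul_le_of_le_one_right (by positivity) hδ1

lemma one_div_le_rate (hβ : θ.β < 1) (hδ : 0 < δ) (hK : 1 ≤ K) : 1 / δ ≤ rate θ δ K := by
  refine le_trans ?_ (log_mul_pow_one_sub_beta_div_le_rate δ K)
  have h1 := one_le_one_add_log K
  have h2 : (1 : ℝ) ≤ (K : ℝ) ^ (1 - θ.β) :=
    Real.one_le_rpow (by exact_mod_cast hK) (by linarith)
  gcongr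
  nlinarith

/-- The quadratic consensus error is of the order of the rate once `K ^ β` dominates the inverse
square of the spectral gap. -/
lemma pow_beta_mul_le_rate (hδ : 0 < δ) (hδ1 : δ ≤ 1) (hK : 1 ≤ K) {s : ℝ}
    (hs : θ.β ≤ s) :
    (K : ℝ) ^ θ.β * ((1 + (K : ℝ) ^ (1 - 2 * s)) * (1 + Real.log K)) ≤ 2 * rate θ δ K := by
  have h1 := one_le_one_add_log K
  have hK' : (1 : ℝ) ≤ K := by exact_mod_cast hK
  have h2 : (K : ℝ) ^ θ.β * (K : ℝ) ^ (1 - 2 * s) ≤ (K : ℝ) ^ (1 - θ.β) := by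
    rw [← Real.rpow_add (by linarith)]
    exact Real.rpow_le_rpow_of_exponent_le hK' (by linarith)
  have h3 := log_mul_pow_beta_le_rate (θ := θ) hδ hK
  have h4 := log_mul_pow_one_sub_beta_le_rate (θ := θ) hδ hδ1 hK
  have h5 := mul_le_mul_of_nonneg_right h2 (by linarith : 0 ≤ 1 + Real.log K)
  linarith

lemma pow_one_sub_mul_le {s : ℝ} (hs : s ≤ 1) (hK : 1 ≤ K) :
    (1 + (K : ℝ) ^ (1 - s)) * (1 + Real.log K) ≤ 2 * ((K : ℝ) ^ (1 - s) * (1 + Real.log K)) := by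
  have h1 := one_le_one_add_log K
  have h2 : (1 : ℝ) ≤ (K : ℝ) ^ (1 - s) :=
    Real.one_le_rpow (by exact_mod_cast hK) (by linarith)
  nlinarith

/-- Arithmetic common to the primal and the dual consensus errors: `P` stands for `K ^ β`, `E` for
the growth of the weighted gradient sums and `r` for the rate. -/
lemma consensus_bound {T X₀ X g a B E r P δ c₁ : ℝ} (hδ : 0 < δ) (hc₁ : 0 ≤ c₁)
    (hX : 0 ≤ X) (hg : 0 ≤ g) (ha : 0 ≤ a) (hE : 0 ≤ E)
    (hT : T ≤ 2 / δ * X₀ + 4 / δ ^ 2 * (4 * g * B)) (hX₀ : X₀ ≤ X) (hB : B ≤ a * E)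
    (hr : 1 / δ ≤ r) (hthr : 1 / δ ^ 2 ≤ c₁ * P) (hP : P * E ≤ 2 * r) :
    T ≤ (2 * X + 32 * g * c₁ * a) * r := by
  have h1 : 2 / δ * X₀ ≤ 2 * X * r := by
    calc 2 / δ * X₀ ≤ 2 / δ * X := by gcongr
      _ = 2 * X * (1 / δ) := by ring
      _ ≤ _ := by gcongr
  have h2 : 4 / δ ^ 2 * (4 * g * B) ≤ 32 * g * c₁ * a * r := by
    calc _ ≤ 4 / δ ^ 2 * (4 * g * (a * E)) := by gcongr
      _ = 16 * g * a * E * (1 / δ ^ 2) := by ring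
      _ ≤ 16 * g * a * E * (c₁ * P) := by gcongr
      _ = 16 * g * c₁ * a * (P * E) := by ring
      _ ≤ 16 * g * c₁ * a * (2 * r) := by gcongr
      _ = _ := by ring
  linarith

end Rate

/-- The problem is regular with constants `L`, `μ`, `C`: the standing assumptions on the
objective, together with the existence of the maximizers, which follows from them. -/
structure Problem.Regular {n p d : ℕ} {Ξ : Type*} [MeasurableSpace Ξ] (Q : Problem n p d Ξ)
    (L μ C : ℝ) : Prop where
  L_pos : 0 < L
  μ_pos : 0 < μ
  C_pos : 0 < C
  wp : Q.WellPosed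
  sc : Q.StronglyConcave μ
  js : Q.JointlySmooth L
  bu : Q.BoundedUnbiased C
  argmax : ∀ x, Q.IsArgmax x (Q.yStar x)

namespace Trajectory

variable {n p d : ℕ} {Ξ : Type*} [MeasurableSpace Ξ] {Q : Problem n p d Ξ}
  {W : Matrix (Fin n) (Fin n) ℝ} {θ : Params} {C ζv ζu R L μ : ℝ} {S : ℕ → State n p d}
  {gx : ℕ → Fin n → Vec p} {gy : ℕ → Fin n → Vec d}

lemma gap_pos (h : Trajectory Q W θ C ζv ζu R S gx gy) : 0 < 1 - rho W := by
  linarith [h.rho_lt]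

lemma gap_le_one : 1 - rho W ≤ 1 := by linarith [rho_nonneg W]

lemma adaConst_nonneg (h : Trajectory Q W θ C ζv ζu R S gx gy) (s : ℝ) :
    0 ≤ adaConst θ.c (θ.c + C ^ 2) s := by
  have hc := h.adm.c_pos
  have : 0 ≤ Real.log ((θ.c + C ^ 2) / θ.c) := by
    refine Real.log_nonneg ?_
    rw [one_le_div hc]; nlinarith
  unfold adaConst
  positivity

/-! ### Sums of the consensus errors -/

/-- The initial dispersion `R` and the gradients both contribute at the order of the rate. -/
lemma sum_dispX_le (h : Trajectory Q W θ C ζv ζu R S gx gy) {K : ℕ} (hK : 1 ≤ K) {c₁ : ℝ}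
    (hc₁ : 0 ≤ c₁) (hthr : 1 / (1 - rho W) ^ 2 ≤ c₁ * (K : ℝ) ^ θ.β) :
    ∑ k ∈ Finset.range K, dispX S k
      ≤ (2 * |R| + 32 * θ.γx ^ 2 * c₁ * adaConst θ.c (θ.c + C ^ 2) (2 * θ.α))
        * rate θ (1 - rho W) K := by
  have hδ := h.gap_pos
  have hθ := h.adm
  have h1 := sum_contraction_le (A := dispX S) hδ (fun k => msq_nonneg _) h.dispX_succ_le K
  have h2 := h.sum_vbar_rpow_le hK (s := 2 * θ.α) (by linarith [hθ.β_pos, hθ.β_lt_α])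
  rw [← Finset.mul_sum] at h1
  exact consensus_bound hδ hc₁ (abs_nonneg R) (sq_nonneg θ.γx) (h.adaConst_nonneg (2 * θ.α))
    (mul_nonneg (by positivity) (by linarith [one_le_one_add_log K])) h1
    (h.dispersion.trans (le_abs_self R)) h2
    (one_div_le_rate (by linarith [hθ.β_lt_α, hθ.α_lt_one]) hδ hK) hthr
    (pow_beta_mul_le_rate hδ gap_le_one hK hθ.β_lt_α.le)

lemma norm_sub_yset_le (h : Trajectory Q W θ C ζv ζu R S gx gy) (hQ : Q.Regular L μ C)
    {y y' : Vec d} (hy : y ∈ Q.Y) (hy' : y' ∈ Q.Y) : ‖y - y'‖ ^ 2 ≤ (2 * C / μ) ^ 2 :=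
  pow_le_pow_left₀ (norm_nonneg _)
    (Problem.norm_sub_le_of_mem h.n_pos hQ.μ_pos hQ.C_pos hQ.wp hQ.sc hQ.bu hy hy') 2

lemma dispY_le (h : Trajectory Q W θ C ζv ζu R S gx gy) (hQ : Q.Regular L μ C) (k : ℕ) :
    dispY S k ≤ (2 * C / μ) ^ 2 :=
  (msq_sub_mean_le h.n_pos _ ((S k).y ⟨0, h.n_pos⟩)).trans (msq_le_of_forall h.n_pos fun i =>
    h.norm_sub_yset_le hQ (h.y_mem k i) (h.y_mem k _))

lemma sum_dispY_le (h : Trajectory Q W θ C ζv ζu R S gx gy) (hQ : Q.Regular L μ C) (hζ : ζu ≤ 1)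
    {K : ℕ} (hK : 1 ≤ K) {c₁ : ℝ}
    (hc₁ : 0 ≤ c₁) (hthr : 1 / (1 - rho W) ^ 2 ≤ c₁ * (K : ℝ) ^ θ.β) :
    ∑ k ∈ Finset.range K, dispY S k
      ≤ (2 * (2 * C / μ) ^ 2 + 32 * θ.γy ^ 2 * c₁ * adaConst θ.c (θ.c + C ^ 2) (2 * θ.β))
        * rate θ (1 - rho W) K := by
  have hδ := h.gap_pos
  have hθ := h.adm
  have h1 := sum_contraction_le (A := dispY S) hδ (fun k => msq_nonneg _)
    (h.dispY_succ_le hQ.wp hζ) K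
  have h2 := h.sum_ubar_rpow_le hK (2 * θ.β)
  rw [← Finset.mul_sum] at h1
  exact consensus_bound hδ hc₁ (sq_nonneg _) (sq_nonneg θ.γy) (h.adaConst_nonneg (2 * θ.β))
    (mul_nonneg (by positivity) (by linarith [one_le_one_add_log K])) h1
    (h.dispY_le hQ 0) h2
    (one_div_le_rate (by linarith [hθ.β_lt_α, hθ.α_lt_one]) hδ hK) hthr
    (pow_beta_mul_le_rate hδ gap_le_one hK le_rfl)

/-- The first-order effect of the dual consensus error. A gradient step at time `k` has size
`ū ^ (-β)` times the gradient, so Young's inequality is used with the weight `ū ^ (-β) / δ`: it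
turns both contributions into sums of `ū ^ (-β) ‖g‖²`, whatever the size of the gradients. -/
lemma sum_inner_dispY_le (h : Trajectory Q W θ C ζv ζu R S gx gy) (hQ : Q.Regular L μ C)
    (hζ : ζu ≤ 1) {K : ℕ} (hK : 1 ≤ K) :
    ∑ k ∈ Finset.range K,
        2 * ((1 / (n : ℝ)) * ∑ i, inner ℝ (gy k i) ((S k).y i - mean (S k).y))
      ≤ (2 * (1 + 16 * θ.γy ^ 2) * adaConst θ.c (θ.c + C ^ 2) θ.β
          + 2 * (θ.c + C ^ 2) ^ θ.β * (2 * C / μ) ^ 2) * rate θ (1 - rho W) K := by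
  obtain ⟨N, rfl⟩ : ∃ N, K = N + 1 := ⟨K - 1, by omega⟩
  have hδ := h.gap_pos
  have hθ := h.adm
  set δ := 1 - rho W with hδdef
  set w : ℕ → ℝ := fun k => (S (k + 1)).ubar ^ (-θ.β) with hw
  set q : ℕ → ℝ := fun k => (S (k + 1)).ubar ^ θ.β with hq
  have hwpos : ∀ k, 0 < w k := fun k => Real.rpow_pos_of_pos (h.ubar_pos _) _
  have hqw : ∀ k, q k = 1 / w k := fun k => by
    simp only [hq, hw]; rw [Real.rpow_neg (h.ubar_pos _).le]; simp
  have hqmono : Monotone q := fun a b hab =>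
    Real.rpow_le_rpow (h.ubar_pos _).le (h.mono_ubar (by omega)) hθ.β_pos.le
  have h1 := sum_weighted_contraction_le (A := dispY S) (p := q) hδ
    (Real.rpow_nonneg (h.ubar_pos _).le _) hqmono (fun k => msq_nonneg _) (h.dispY_le hQ)
    (h.dispY_succ_le hQ.wp hζ) N
  have h2 : ∑ k ∈ Finset.range (N + 1),
      q k * (4 * θ.γy ^ 2 * ((S (k + 1)).ubar ^ (-(2 * θ.β)) * msq (gy k)))
      = 4 * θ.γy ^ 2 * ∑ k ∈ Finset.range (N + 1), w k * msq (gy k) := by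
    rw [Finset.mul_sum]
    refine Finset.sum_congr rfl fun k _ => ?_
    have : q k * (S (k + 1)).ubar ^ (-(2 * θ.β)) = w k := by
      simp only [hq, hw]; rw [← Real.rpow_add (h.ubar_pos _)]; congr 1; ring
    rw [← this]; ring
  rw [h2] at h1
  have h3 : ∑ k ∈ Finset.range (N + 1), w k * msq (gy k) ≤ _ := h.sum_ubar_rpow_le hK θ.β
  have h4 : ∑ k ∈ Finset.range (N + 1),
        2 * ((1 / (n : ℝ)) * ∑ i, inner ℝ (gy k i) ((S k).y i - mean (S k).y))
      ≤ 1 / δ * ∑ k ∈ Finset.range (N + 1), w k * msq (gy k)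
        + δ * ∑ k ∈ Finset.range (N + 1), q k * dispY S k := by
    rw [Finset.mul_sum, Finset.mul_sum, ← Finset.sum_add_distrib]
    refine Finset.sum_le_sum fun k _ => ?_
    have := two_mul_mean_inner_le (t := w k / δ) (div_pos (hwpos k) hδ) (gy k)
      (fun i => (S k).y i - mean (S k).y)
    refine this.trans (le_of_eq ?_)
    rw [hqw, dispY]
    field_simp
  have h5 := mul_le_mul_of_nonneg_left h1 hδ.le
  have h6 : q N ≤ (θ.c + C ^ 2) ^ θ.β * ((N + 1 : ℕ) : ℝ) ^ θ.β :=
    h.ubar_rpow_le hK hθ.β_pos.le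
  have h7 := pow_beta_le_rate (θ := θ) hδ hK
  have h8 := log_mul_pow_one_sub_beta_div_le_rate (θ := θ) δ (N + 1)
  have h9 := pow_one_sub_mul_le (s := θ.β) (by linarith [hθ.β_lt_α, hθ.α_lt_one]) hK
  have h0 := h.adaConst_nonneg θ.β
  have hc := hθ.c_pos
  set A := adaConst θ.c (θ.c + C ^ 2) θ.β
  set r := rate θ δ (N + 1)
  set T := ∑ k ∈ Finset.range (N + 1), w k * msq (gy k)
  have e5 : δ * (2 / δ * (q N * (2 * C / μ) ^ 2) + 4 / δ ^ 2 * (4 * θ.γy ^ 2 * T))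
      = 2 * (q N * (2 * C / μ) ^ 2) + 16 * θ.γy ^ 2 * (1 / δ * T) := by
    field_simp; ring
  rw [e5] at h5
  have h10 : 1 / δ * T ≤ 2 * A * r := by
    calc 1 / δ * T ≤ 1 / δ * (A * (2 * (((N + 1 : ℕ) : ℝ) ^ (1 - θ.β)
            * (1 + Real.log ((N + 1 : ℕ) : ℝ))))) := by
          gcongr
          exact h3.trans (by gcongr)
      _ = 2 * A * (((N + 1 : ℕ) : ℝ) ^ (1 - θ.β) * (1 + Real.log ((N + 1 : ℕ) : ℝ)) / δ) := by
          ring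
      _ ≤ 2 * A * r := by gcongr
  have h11 : q N * (2 * C / μ) ^ 2 ≤ (θ.c + C ^ 2) ^ θ.β * r * (2 * C / μ) ^ 2 := by
    gcongr
    exact h6.trans (by gcongr)
  have h12 := mul_le_mul_of_nonneg_left h10 (by positivity : 0 ≤ 1 + 16 * θ.γy ^ 2)
  linarith

/-! ### Descent of the primal function -/

/-- The average of the exact local gradients in `x` at the local iterates. -/
noncomputable def meanGradX (Q : Problem n p d Ξ) (s : State n p d) : Vec p :=
  mean fun i => gradX (Q.local_f i) (s.x i) (s.y i)

/-- The average of the exact local gradients in `y` at the local iterates. -/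
noncomputable def meanGradY (Q : Problem n p d Ξ) (s : State n p d) : Vec d :=
  mean fun i => gradY (Q.local_f i) (s.x i) (s.y i)

lemma sum_vbar_alpha_le (h : Trajectory Q W θ C ζv ζu R S gx gy) {K : ℕ} (hK : 1 ≤ K) :
    ∑ k ∈ Finset.range K, (S (k + 1)).vbar ^ (-θ.α) * msq (gx k)
      ≤ 2 * adaConst θ.c (θ.c + C ^ 2) θ.α * rate θ (1 - rho W) K := by
  have hθ := h.adm
  have h1 := h.sum_vbar_rpow_le hK (s := θ.α) (by linarith [hθ.β_pos, hθ.β_lt_α])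
  have h2 := pow_one_sub_mul_le (s := θ.α) hθ.α_lt_one.le hK
  have h3 := log_mul_pow_one_sub_alpha_le_rate (θ := θ) h.gap_pos hK
  have h4 := mul_le_mul_of_nonneg_left (h2.trans (mul_le_mul_of_nonneg_left h3 zero_le_two))
    (h.adaConst_nonneg θ.α)
  linarith

/-- The descent inequality of `Φ`, divided by the stepsize. -/
lemma inner_gradient_dir_le (h : Trajectory Q W θ C ζv ζu R S gx gy) (hQ : Q.Regular L μ C)
    (k : ℕ) :
    inner ℝ (gradient Q.Phi (S k).xbar) (dir θ S gx k)
      ≤ (S (k + 1)).vbar ^ θ.α / θ.γx * (Q.Phi (S k).xbar - Q.Phi (S (k + 1)).xbar)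
        + 4 * (L * (1 + 2 * (L / μ))) * θ.γx * ((S (k + 1)).vbar ^ (-θ.α) * msq (gx k)) := by
  have hγ := h.adm.γx_pos
  have hL := hQ.L_pos
  have hμ := hQ.μ_pos
  have hv := h.vbar_pos (k + 1)
  have h1 := (abs_le.1 (Problem.abs_Phi_sub_sub_inner_le h.n_pos hL hμ hQ.wp
    hQ.sc hQ.js hQ.argmax (S k).xbar (S (k + 1)).xbar)).2
  rw [← Problem.gradient_Phi h.n_pos hL hμ hQ.wp hQ.sc hQ.js hQ.argmax] at h1
  have e : (S (k + 1)).xbar - (S k).xbar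
      = -((θ.γx * (S (k + 1)).vbar ^ (-θ.α)) • dir θ S gx k) := by
    rw [h.xbar_succ k]; abel
  have hη : 0 < θ.γx * (S (k + 1)).vbar ^ (-θ.α) := by positivity
  have hinv : (S (k + 1)).vbar ^ θ.α / θ.γx * (θ.γx * (S (k + 1)).vbar ^ (-θ.α)) = 1 := by
    rw [Real.rpow_neg hv.le]; field_simp
  rw [e, inner_neg_right, inner_smul_right, norm_neg, norm_smul, Real.norm_of_nonneg hη.le] at h1
  have hd := h.norm_dir_sq_le k
  set η := θ.γx * (S (k + 1)).vbar ^ (-θ.α) with hηdef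
  set b := (S (k + 1)).vbar ^ θ.α / θ.γx
  set I := inner ℝ (gradient Q.Phi (S k).xbar) (dir θ S gx k)
  have hb : 0 ≤ b := by positivity
  have hc : 0 ≤ L * (1 + 2 * (L / μ)) := by positivity
  have h2 := mul_le_mul_of_nonneg_left h1 hb
  have e1 : b * (Q.Phi (S (k + 1)).xbar - Q.Phi (S k).xbar - -(η * I))
      = I - b * (Q.Phi (S k).xbar - Q.Phi (S (k + 1)).xbar) := by
    linear_combination I * hinv
  have e2 : b * (L * (1 + 2 * (L / μ)) * (η * ‖dir θ S gx k‖) ^ 2)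
      = L * (1 + 2 * (L / μ)) * η * ‖dir θ S gx k‖ ^ 2 := by
    linear_combination L * (1 + 2 * (L / μ)) * η * ‖dir θ S gx k‖ ^ 2 * hinv
  rw [e1, e2] at h2
  have h3 := mul_le_mul_of_nonneg_left hd (mul_nonneg hc hη.le)
  have e3 : L * (1 + 2 * (L / μ)) * η * (4 * msq (gx k)) = 4 * (L * (1 + 2 * (L / μ))) * θ.γx
      * ((S (k + 1)).vbar ^ (-θ.α) * msq (gx k)) := by rw [hηdef]; ring
  linarith

/-- Summed descent inequality of the primal function. Dividing each step by its stepsize removes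
the correlation between stepsize and noise; the increments of `Φ` are then summed by parts. -/
lemma sum_gradient_le (h : Trajectory Q W θ C ζv ζu R S gx gy) (hQ : Q.Regular L μ C) {Δ : ℝ}
    (hΔ : ∀ x x' : Vec p, Q.Phi x - Q.Phi x' ≤ Δ) {K : ℕ} (hK : 1 ≤ K) :
    1 / 2 * ∑ k ∈ Finset.range K, ‖gradient Q.Phi (S k).xbar‖ ^ 2
      ≤ ((θ.c + C ^ 2) ^ θ.α / θ.γx * |Δ| + 8 * (L * (1 + 2 * (L / μ))) * θ.γx
            * adaConst θ.c (θ.c + C ^ 2) θ.α) * rate θ (1 - rho W) K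
        + ∑ k ∈ Finset.range K, ‖meanGradX Q (S k) - gradient Q.Phi (S k).xbar‖ ^ 2
        + K * (ζv ^ 2 * C ^ 2)
        - ∑ k ∈ Finset.range K,
            inner ℝ (gradient Q.Phi (S k).xbar) (mean (gx k) - meanGradX Q (S k)) := by
  obtain ⟨N, rfl⟩ : ∃ N, K = N + 1 := ⟨K - 1, by omega⟩
  have hγ := h.adm.γx_pos
  have hα : 0 ≤ θ.α := by linarith [h.adm.β_pos, h.adm.β_lt_α]
  have hL := hQ.L_pos
  have hμ := hQ.μ_pos
  set b : ℕ → ℝ := fun k => (S (k + 1)).vbar ^ θ.α / θ.γx with hb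
  have hb0 : ∀ k, 0 ≤ b k := fun k =>
    div_nonneg (Real.rpow_nonneg (h.vbar_pos _).le _) hγ.le
  have hbm : Monotone b := fun i j hij => by
    simp only [hb]
    have := h.mono_vbar (show i + 1 ≤ j + 1 by omega)
    have := h.vbar_pos (i + 1)
    gcongr
  have h1 := sum_mul_sub_le (hb0 0) hbm (a := fun k => Q.Phi (S k).xbar)
    (S := Q.Phi (S (N + 1)).xbar + Δ) N (fun k _ => by
      have := hΔ (S k).xbar (S (N + 1)).xbar; linarith)
  rw [add_sub_cancel_left] at h1
  have h2 : b N * Δ ≤ (θ.c + C ^ 2) ^ θ.α / θ.γx * |Δ| * rate θ (1 - rho W) (N + 1) := by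
    have h3 := h.vbar_rpow_le hK hα
    have h4 := pow_alpha_le_rate (θ := θ) h.gap_pos hK
    have hc := h.adm.c_pos
    calc b N * Δ ≤ b N * |Δ| := mul_le_mul_of_nonneg_left (le_abs_self _) (hb0 N)
      _ ≤ ((θ.c + C ^ 2) ^ θ.α * rate θ (1 - rho W) (N + 1)) / θ.γx * |Δ| := by
          simp only [hb]
          gcongr
          exact h3.trans (by gcongr)
      _ = _ := by ring
  have h5 := mul_le_mul_of_nonneg_left (h.sum_vbar_alpha_le hK)
    (show 0 ≤ 4 * (L * (1 + 2 * (L / μ))) * θ.γx by positivity)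
  have h6 : ∑ k ∈ Finset.range (N + 1), (1 / 2 * ‖gradient Q.Phi (S k).xbar‖ ^ 2
        - ‖meanGradX Q (S k) - gradient Q.Phi (S k).xbar‖ ^ 2 - ζv ^ 2 * C ^ 2
        + inner ℝ (gradient Q.Phi (S k).xbar) (mean (gx k) - meanGradX Q (S k)))
      ≤ ∑ k ∈ Finset.range (N + 1), (b k * (Q.Phi (S k).xbar - Q.Phi (S (k + 1)).xbar)
        + 4 * (L * (1 + 2 * (L / μ))) * θ.γx * ((S (k + 1)).vbar ^ (-θ.α) * msq (gx k))) := by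
    refine Finset.sum_le_sum fun k _ => le_trans ?_ (h.inner_gradient_dir_le hQ k)
    set G := gradient Q.Phi (S k).xbar
    have e : dir θ S gx k = G + (meanGradX Q (S k) - G) + (mean (gx k) - meanGradX Q (S k))
        + (dir θ S gx k - mean (gx k)) := by abel
    rw [e, inner_add_right, inner_add_right, inner_add_right, real_inner_self_eq_norm_sq]
    have i1 := (abs_le.1 (abs_real_inner_le_norm G (meanGradX Q (S k) - G))).1
    have i2 := (abs_le.1 (abs_real_inner_le_norm G (dir θ S gx k - mean (gx k)))).1
    have i3 := pow_le_pow_left₀ (norm_nonneg _) (h.norm_dir_sub_le k) 2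
    rw [mul_pow] at i3
    nlinarith [sq_nonneg (‖G‖ / 2 - ‖meanGradX Q (S k) - G‖),
      sq_nonneg (‖G‖ / 2 - ‖dir θ S gx k - mean (gx k)‖)]
  simp only [Finset.sum_sub_distrib, Finset.sum_add_distrib, ← Finset.mul_sum, Finset.sum_const,
    Finset.card_range, nsmul_eq_mul] at h6
  linarith

/-! ### A smoothed primal sequence -/

/-- The rate `(c / v̄ₖ) ^ β` of the smoothed primal sequence, of the order of the dual stepsize. -/
noncomputable def emaRate (θ : Params) (s : State n p d) : ℝ := (θ.c / s.vbar) ^ θ.β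

/-- An exponential moving average of the averaged primal iterates. The maximizer `y*` need not be
differentiable, since it may lie on the boundary of the feasible set; tracking it along this
smoother sequence replaces the smoothness of `y*`. -/
noncomputable def ema (θ : Params) (S : ℕ → State n p d) : ℕ → Vec p
  | 0 => (S 0).xbar
  | k + 1 => ema θ S k + emaRate θ (S k) • ((S k).xbar - ema θ S k)

/-- The difference between the averaged primal iterate and its moving average. -/
noncomputable def lag (θ : Params) (S : ℕ → State n p d) (k : ℕ) : Vec p :=
  (S k).xbar - ema θ S k

lemma emaRate_pos (h : Trajectory Q W θ C ζv ζu R S gx gy) (k : ℕ) : 0 < emaRate θ (S k) :=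
  Real.rpow_pos_of_pos (div_pos h.adm.c_pos (h.vbar_pos k)) _

lemma emaRate_le_one (h : Trajectory Q W θ C ζv ζu R S gx gy) (k : ℕ) : emaRate θ (S k) ≤ 1 :=
  Real.rpow_le_one (div_nonneg h.adm.c_pos.le (h.vbar_pos k).le)
    ((div_le_one (h.vbar_pos k)).2 (h.c_le_vbar k)) h.adm.β_pos.le

lemma inv_emaRate (h : Trajectory Q W θ C ζv ζu R S gx gy) (k : ℕ) :
    (emaRate θ (S k))⁻¹ = θ.c ^ (-θ.β) * (S k).vbar ^ θ.β := by
  rw [emaRate, Real.div_rpow h.adm.c_pos.le (h.vbar_pos k).le, inv_div, div_eq_mul_inv,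
    Real.rpow_neg h.adm.c_pos.le, mul_comm]

lemma lag_succ (h : Trajectory Q W θ C ζv ζu R S gx gy) (k : ℕ) :
    lag θ S (k + 1) = (1 - emaRate θ (S k)) • lag θ S k
      - (θ.γx * (S (k + 1)).vbar ^ (-θ.α)) • dir θ S gx k := by
  rw [lag, h.xbar_succ, ema, lag, sub_smul, one_smul]
  abel

/-- The primal stepsize is at most a multiple of the rate of the moving average. -/
lemma stepX_le (h : Trajectory Q W θ C ζv ζu R S gx gy) (k : ℕ) :
    θ.γx * (S k).vbar ^ (-θ.α) ≤ θ.γx * θ.c ^ (-θ.α) * emaRate θ (S k) := by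
  have hc := h.adm.c_pos
  have hv := h.vbar_pos k
  have hγ := h.adm.γx_pos
  have e : emaRate θ (S k) = θ.c ^ θ.β * (S k).vbar ^ (-θ.β) := by
    rw [emaRate, Real.div_rpow hc.le hv.le, Real.rpow_neg hv.le, div_eq_mul_inv]
  have e2 : (S k).vbar ^ (-θ.α) = (S k).vbar ^ (-θ.α + θ.β) * (S k).vbar ^ (-θ.β) := by
    rw [← Real.rpow_add hv]; congr 1; ring
  have e3 : θ.c ^ (-θ.α) * θ.c ^ θ.β = θ.c ^ (-θ.α + θ.β) := by rw [← Real.rpow_add hc]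
  have h1 : (S k).vbar ^ (-θ.α + θ.β) ≤ θ.c ^ (-θ.α + θ.β) :=
    Real.rpow_le_rpow_of_nonpos hc (h.c_le_vbar k) (by linarith [h.adm.β_lt_α])
  rw [e, mul_assoc, ← mul_assoc (θ.c ^ (-θ.α)), e3, e2]
  gcongr

lemma stepX_succ_le (h : Trajectory Q W θ C ζv ζu R S gx gy) (k : ℕ) :
    (S (k + 1)).vbar ^ (-θ.α) ≤ (S k).vbar ^ (-θ.α) :=
  Real.rpow_le_rpow_of_nonpos (h.vbar_pos k) (h.mono_vbar (Nat.le_succ k))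
    (by linarith [h.adm.β_lt_α, h.adm.β_pos])

lemma norm_lag_le (h : Trajectory Q W θ C ζv ζu R S gx gy) (k : ℕ) :
    ‖lag θ S k‖ ≤ 2 * C * (θ.γx * θ.c ^ (-θ.α)) := by
  have hc := h.adm.c_pos
  have hγ := h.adm.γx_pos
  have hC := h.C_pos
  induction k with
  | zero => simp only [lag, ema, sub_self, norm_zero]; positivity
  | succ k ih =>
    rw [h.lag_succ]
    have h1 := h.stepX_le k
    have h2 := h.stepX_succ_le k
    have h3 := h.norm_dir_le k
    have h4 := h.emaRate_le_one k
    have hv := h.vbar_pos (k + 1)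
    have h5 : θ.γx * (S (k + 1)).vbar ^ (-θ.α) ≤ θ.γx * θ.c ^ (-θ.α) * emaRate θ (S k) :=
      le_trans (by gcongr) h1
    refine (norm_sub_le _ _).trans ?_
    rw [norm_smul, norm_smul, Real.norm_of_nonneg (by linarith),
      Real.norm_of_nonneg (by positivity)]
    have h6 := mul_le_mul_of_nonneg_left ih (by linarith : 0 ≤ 1 - emaRate θ (S k))
    have h7 := mul_le_mul h5 h3 (norm_nonneg _) ((by positivity : (0:ℝ) ≤ _).trans h5)
    linarith

/-- The ratio between the primal stepsize and the rate of the moving average. -/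
noncomputable def stepRatio (θ : Params) (s : State n p d) : ℝ :=
  θ.γx * θ.c ^ (-θ.β) * s.vbar ^ (θ.β - θ.α)

lemma stepRatio_eq (h : Trajectory Q W θ C ζv ζu R S gx gy) (k : ℕ) :
    stepRatio θ (S k) = (emaRate θ (S k))⁻¹ * (θ.γx * (S k).vbar ^ (-θ.α)) := by
  rw [h.inv_emaRate, stepRatio, sub_eq_add_neg, Real.rpow_add (h.vbar_pos k)]
  ring

lemma stepRatio_nonneg (h : Trajectory Q W θ C ζv ζu R S gx gy) (k : ℕ) :
    0 ≤ stepRatio θ (S k) := by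
  have := h.adm.γx_pos
  have := h.adm.c_pos
  have := h.vbar_pos k
  unfold stepRatio
  positivity

lemma stepRatio_le (h : Trajectory Q W θ C ζv ζu R S gx gy) (k : ℕ) :
    stepRatio θ (S k) ≤ θ.γx * θ.c ^ (-θ.α) := by
  have h1 := h.emaRate_pos k
  rw [h.stepRatio_eq, inv_mul_le_iff₀ h1, mul_comm (emaRate θ (S k))]
  exact h.stepX_le k

/-- The predictable weight with which the gradient noise enters the lag; it is switched off while
the accumulators are below the level `V`. -/
noncomputable def lagWeight (θ : Params) (V : ℝ) (S : ℕ → State n p d) (k : ℕ) : Vec p :=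
  if V ≤ (S k).vbar then
    (2 * (1 - emaRate θ (S k)) * stepRatio θ (S k)) • lag θ S k
  else 0

/-- The gradients seen while the accumulators are below `V` have bounded total size. -/
lemma sum_small_le (h : Trajectory Q W θ C ζv ζu R S gx gy) (V : ℝ) (K : ℕ) :
    ∑ k ∈ Finset.range K, (if V ≤ (S k).vbar then 0 else msq (gx k)) ≤ |V| + C ^ 2 := by
  have key : ∑ k ∈ Finset.range K, (if V ≤ (S k).vbar then 0 else msq (gx k)) ≤ (S K).mxbar
      ∧ ∑ k ∈ Finset.range K, (if V ≤ (S k).vbar then 0 else msq (gx k)) ≤ |V| + C ^ 2 := by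
    induction K with
    | zero =>
      simp only [Finset.range_zero, Finset.sum_empty]
      exact ⟨(h.mxbar_pos 0).le, by positivity⟩
    | succ K ih =>
      rw [Finset.sum_range_succ, h.mxbar_succ]
      have h1 := msq_nonneg (gx K)
      have h2 := h.msq_gx_le K
      have h3 := mxbar_le_vbar (S K)
      have h4 := le_abs_self V
      split_ifs with hv
      · exact ⟨by linarith [ih.1], by linarith [ih.2]⟩
      · exact ⟨by linarith [ih.1], by linarith [ih.1, not_le.1 hv]⟩
  exact key.2

/-- One step of the recursion of the lag, divided by the rate of the moving average. The stepsize
that multiplies the inner product is the predictable one, with `v̄ₖ` instead of `v̄ₖ₊₁`. -/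
lemma lag_step (h : Trajectory Q W θ C ζv ζu R S gx gy) (k : ℕ) :
    ‖lag θ S k‖ ^ 2 ≤ (emaRate θ (S k))⁻¹ * (‖lag θ S k‖ ^ 2 - ‖lag θ S (k + 1)‖ ^ 2)
      - 2 * (1 - emaRate θ (S k)) * stepRatio θ (S k) * inner ℝ (lag θ S k) (dir θ S gx k)
      + 8 * C ^ 2 * (θ.γx * θ.c ^ (-θ.α)) * θ.γx
        * ((emaRate θ (S k))⁻¹ * ((S k).vbar ^ (-θ.α) - (S (k + 1)).vbar ^ (-θ.α)))
      + 4 * (θ.γx * θ.c ^ (-θ.α)) * θ.γx * ((S (k + 1)).vbar ^ (-θ.α) * msq (gx k)) := by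
  have hγ := h.adm.γx_pos
  have hC := h.C_pos
  have hc := h.adm.c_pos
  have ht0 := h.emaRate_pos k
  have ht1 := h.emaRate_le_one k
  have hB := h.norm_lag_le k
  have hd := h.norm_dir_le k
  have hd2 := h.norm_dir_sq_le k
  have hstep := h.stepX_succ_le k
  have hr := h.stepRatio_le k
  have hv' : 0 < (S (k + 1)).vbar ^ (-θ.α) := Real.rpow_pos_of_pos (h.vbar_pos _) _
  have hexp : ‖lag θ S (k + 1)‖ ^ 2 = (1 - emaRate θ (S k)) ^ 2 * ‖lag θ S k‖ ^ 2
      - 2 * ((1 - emaRate θ (S k)) * (θ.γx * (S (k + 1)).vbar ^ (-θ.α)))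
        * inner ℝ (lag θ S k) (dir θ S gx k)
      + (θ.γx * (S (k + 1)).vbar ^ (-θ.α)) ^ 2 * ‖dir θ S gx k‖ ^ 2 := by
    rw [h.lag_succ, norm_sub_sq_real, norm_smul, norm_smul, inner_smul_left, inner_smul_right,
      mul_pow, mul_pow, Real.norm_eq_abs, Real.norm_eq_abs, sq_abs, sq_abs]
    simp only [conj_trivial]
    ring
  have hin : |inner ℝ (lag θ S k) (dir θ S gx k)| ≤ 2 * C * (θ.γx * θ.c ^ (-θ.α)) * (2 * C) :=
    (abs_real_inner_le_norm _ _).trans (mul_le_mul hB hd (norm_nonneg _) (by positivity))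
  rw [h.stepRatio_eq] at hr ⊢
  rw [hexp]
  set t := emaRate θ (S k)
  set z := ‖lag θ S k‖ ^ 2
  set I := inner ℝ (lag θ S k) (dir θ S gx k)
  set a := (S k).vbar ^ (-θ.α)
  set a' := (S (k + 1)).vbar ^ (-θ.α)
  set ρ := θ.γx * θ.c ^ (-θ.α)
  set D := ‖dir θ S gx k‖ ^ 2
  have hz : 0 ≤ z := sq_nonneg _
  have hD : 0 ≤ D := sq_nonneg _
  have hti : t⁻¹ * t = 1 := inv_mul_cancel₀ ht0.ne'
  have hti0 : 0 ≤ t⁻¹ := by positivity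
  -- the predictable stepsize replaces the actual one at the cost of a telescoping term
  have k1 : 2 * (1 - t) * (t⁻¹ * (θ.γx * (a - a'))) * I
      ≤ 8 * C ^ 2 * ρ * θ.γx * (t⁻¹ * (a - a')) := by
    have w1 : 0 ≤ t⁻¹ * (θ.γx * (a - a')) := by
      have : 0 ≤ a - a' := by linarith
      positivity
    have w2 : (1 - t) * I ≤ 2 * C * ρ * (2 * C) := by
      have := (abs_le.1 hin).1
      have := (abs_le.1 hin).2
      have hpos : 0 ≤ 2 * C * ρ * (2 * C) := (abs_nonneg _).trans hin
      nlinarith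
    have := mul_le_mul_of_nonneg_left w2 w1
    linarith
  have k2 : t⁻¹ * ((θ.γx * a') ^ 2 * D) ≤ 4 * ρ * θ.γx * (a' * msq (gx k)) := by
    have w1 : t⁻¹ * (θ.γx * a') ≤ ρ :=
      (mul_le_mul_of_nonneg_left (mul_le_mul_of_nonneg_left hstep hγ.le) hti0).trans hr
    have w2 : (θ.γx * a') * D ≤ (θ.γx * a') * (4 * msq (gx k)) := by gcongr
    have w3 : 0 ≤ (θ.γx * a') * D := by positivity
    calc t⁻¹ * ((θ.γx * a') ^ 2 * D) = (t⁻¹ * (θ.γx * a')) * ((θ.γx * a') * D) := by ring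
      _ ≤ ρ * ((θ.γx * a') * (4 * msq (gx k))) :=
          mul_le_mul w1 w2 w3 (by positivity)
      _ = _ := by ring
  have e : t⁻¹ * (z - ((1 - t) ^ 2 * z - 2 * ((1 - t) * (θ.γx * a')) * I + (θ.γx * a') ^ 2 * D))
      = 2 * z - t * z + 2 * (1 - t) * (t⁻¹ * (θ.γx * a')) * I - t⁻¹ * ((θ.γx * a') ^ 2 * D) := by
    linear_combination (2 * z - t * z) * hti
  have e2 : 2 * (1 - t) * (t⁻¹ * (θ.γx * (a - a'))) * I
      = 2 * (1 - t) * (t⁻¹ * (θ.γx * a)) * I - 2 * (1 - t) * (t⁻¹ * (θ.γx * a')) * I := by ring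
  nlinarith

/-- Above the level `V` the inner product of the lag with the step is split into noise, gradient and
stepsize inconsistency; below it the whole step is bounded by Young's inequality. -/
lemma neg_inner_lag_dir_le (h : Trajectory Q W θ C ζv ζu R S gx gy) {V ε : ℝ}
    (hV : ∀ k, V ≤ (S k).vbar → stepRatio θ (S k) ≤ ε) (k : ℕ) :
    -(2 * (1 - emaRate θ (S k)) * stepRatio θ (S k) * inner ℝ (lag θ S k) (dir θ S gx k))
      ≤ 1 / 2 * ‖lag θ S k‖ ^ 2
        + 16 * (θ.γx * θ.c ^ (-θ.α)) ^ 2 * (if V ≤ (S k).vbar then 0 else msq (gx k))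
        + 8 * ε ^ 2 * (‖meanGradX Q (S k)‖ ^ 2 + ζv ^ 2 * C ^ 2)
        - inner ℝ (lagWeight θ V S k) (mean (gx k) - meanGradX Q (S k)) := by
  have ht0 := h.emaRate_pos k
  have ht1 := h.emaRate_le_one k
  have hr0 := h.stepRatio_nonneg k
  have hr := h.stepRatio_le k
  have hC := h.C_pos
  by_cases hv : V ≤ (S k).vbar
  · have hε' := hV k hv
    rw [lagWeight, if_pos hv, if_pos hv, inner_smul_left, conj_trivial]
    have e : dir θ S gx k = (mean (gx k) - meanGradX Q (S k)) + meanGradX Q (S k)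
        + (dir θ S gx k - mean (gx k)) := by abel
    rw [e, inner_add_right, inner_add_right]
    have i1 := (abs_le.1 (abs_real_inner_le_norm (lag θ S k) (meanGradX Q (S k)))).1
    have i2 := (abs_le.1 (abs_real_inner_le_norm (lag θ S k) (dir θ S gx k - mean (gx k)))).1
    have i3 := mul_le_mul_of_nonneg_left (h.norm_dir_sub_le k) (norm_nonneg (lag θ S k))
    set t := emaRate θ (S k)
    set r := stepRatio θ (S k)
    set z := ‖lag θ S k‖ with hz
    set m := ‖meanGradX Q (S k)‖
    have hz0 : 0 ≤ z := norm_nonneg _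
    have hm0 : 0 ≤ m := norm_nonneg _
    have hζ := h.zv_nonneg
    have w0 : 0 ≤ 2 * (1 - t) * r := by
      have : 0 ≤ 1 - t := by linarith
      positivity
    have w1 : 2 * (1 - t) * r ≤ 2 * ε := by nlinarith
    have j1 : -(2 * (1 - t) * r * inner ℝ (lag θ S k) (meanGradX Q (S k))) ≤ 2 * ε * (z * m) := by
      have := mul_le_mul_of_nonneg_left i1 w0
      have := mul_le_mul_of_nonneg_right w1 (mul_nonneg hz0 hm0)
      linarith
    have j2 : -(2 * (1 - t) * r * inner ℝ (lag θ S k) (dir θ S gx k - mean (gx k)))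
        ≤ 2 * ε * (z * (ζv * C)) := by
      have := mul_le_mul_of_nonneg_left (show -(z * (ζv * C))
        ≤ inner ℝ (lag θ S k) (dir θ S gx k - mean (gx k)) by linarith) w0
      have := mul_le_mul_of_nonneg_right w1 (mul_nonneg hz0 (mul_nonneg hζ hC.le))
      linarith
    have s1 := sq_nonneg (z / 2 - 2 * ε * m)
    have s2 := sq_nonneg (z / 2 - 2 * ε * (ζv * C))
    have s3 := sq_nonneg (ε * m)
    have s4 := sq_nonneg (ε * (ζv * C))
    ring_nf at s1 s2 s3 s4 j1 j2 ⊢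
    linarith
  · rw [lagWeight, if_neg hv, if_neg hv, inner_zero_left]
    have i1 := (abs_le.1 (abs_real_inner_le_norm (lag θ S k) (dir θ S gx k))).1
    have hd2 := h.norm_dir_sq_le k
    set t := emaRate θ (S k)
    set r := stepRatio θ (S k)
    set z := ‖lag θ S k‖ with hz
    set D := ‖dir θ S gx k‖
    have hz0 : 0 ≤ z := norm_nonneg _
    have hD0 : 0 ≤ D := norm_nonneg _
    have w0 : 0 ≤ 2 * (1 - t) * r := by
      have : 0 ≤ 1 - t := by linarith
      positivity
    have w1 : 2 * (1 - t) * r ≤ 2 * (θ.γx * θ.c ^ (-θ.α)) := by nlinarith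
    have j1 : -(2 * (1 - t) * r * inner ℝ (lag θ S k) (dir θ S gx k))
        ≤ 2 * (θ.γx * θ.c ^ (-θ.α)) * (z * D) := by
      have := mul_le_mul_of_nonneg_left i1 w0
      have := mul_le_mul_of_nonneg_right w1 (mul_nonneg hz0 hD0)
      linarith
    have j2 : 0 ≤ 8 * ε ^ 2 * (‖meanGradX Q (S k)‖ ^ 2 + ζv ^ 2 * C ^ 2) := by positivity
    have j3 := mul_le_mul_of_nonneg_left hd2
      (show 0 ≤ 4 * (θ.γx * θ.c ^ (-θ.α)) ^ 2 by positivity)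
    nlinarith [sq_nonneg (z / 2 - 2 * (θ.γx * θ.c ^ (-θ.α)) * D)]

/-- The constant of the rate in the bound of the lag. -/
noncomputable def lagConst (θ : Params) (C V : ℝ) : ℝ :=
  θ.c ^ (-θ.β) * (θ.c + C ^ 2) ^ θ.β * ((2 * C * (θ.γx * θ.c ^ (-θ.α))) ^ 2
      + 8 * C ^ 2 * (θ.γx * θ.c ^ (-θ.α)) * θ.γx * θ.c ^ (-θ.α))
    + 8 * (θ.γx * θ.c ^ (-θ.α)) * θ.γx * adaConst θ.c (θ.c + C ^ 2) θ.α
    + 16 * (θ.γx * θ.c ^ (-θ.α)) ^ 2 * (|V| + C ^ 2)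

/-- Up to the rate and to noise, the lag is a small multiple `ε` of the gradients: the primal
iterate moves on a slower time scale than its moving average once the accumulators exceed `V`. -/
lemma sum_lag_le (h : Trajectory Q W θ C ζv ζu R S gx gy) {V ε : ℝ}
    (hV : ∀ k, V ≤ (S k).vbar → stepRatio θ (S k) ≤ ε) {K : ℕ} (hK : 1 ≤ K) :
    1 / 2 * ∑ k ∈ Finset.range K, ‖lag θ S k‖ ^ 2
      ≤ lagConst θ C V * rate θ (1 - rho W) K
        + 8 * ε ^ 2 * (∑ k ∈ Finset.range K, ‖meanGradX Q (S k)‖ ^ 2 + K * (ζv ^ 2 * C ^ 2))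
        - ∑ k ∈ Finset.range K,
            inner ℝ (lagWeight θ V S k) (mean (gx k) - meanGradX Q (S k)) := by
  obtain ⟨N, rfl⟩ : ∃ N, K = N + 1 := ⟨K - 1, by omega⟩
  have hγ := h.adm.γx_pos
  have hc := h.adm.c_pos
  have hC := h.C_pos
  have hβ := h.adm.β_pos
  set b : ℕ → ℝ := fun k => (emaRate θ (S k))⁻¹ with hb
  have hb0 : ∀ k, 0 ≤ b k := fun k => inv_nonneg.2 (h.emaRate_pos k).le
  have hbm : Monotone b := fun i j hij => by
    simp only [hb, h.inv_emaRate]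
    have := h.mono_vbar hij
    have := h.vbar_pos i
    gcongr
  have hbN : b N ≤ θ.c ^ (-θ.β) * (θ.c + C ^ 2) ^ θ.β * rate θ (1 - rho W) (N + 1) := by
    simp only [hb, h.inv_emaRate]
    have h1 : (S N).vbar ^ θ.β ≤ (S (N + 1)).vbar ^ θ.β :=
      Real.rpow_le_rpow (h.vbar_pos N).le (h.mono_vbar (Nat.le_succ N)) hβ.le
    have h2 := h.vbar_rpow_le hK hβ.le
    have h3 := pow_beta_le_rate (θ := θ) h.gap_pos hK
    rw [mul_assoc]
    gcongr
    exact (h1.trans h2).trans (by gcongr)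
  have h1 := sum_mul_sub_le (hb0 0) hbm (a := fun k => ‖lag θ S k‖ ^ 2)
    (S := (2 * C * (θ.γx * θ.c ^ (-θ.α))) ^ 2) N
    (fun k _ => pow_le_pow_left₀ (norm_nonneg _) (h.norm_lag_le k) 2)
  have h2 := sum_mul_sub_le (hb0 0) hbm (a := fun k => (S k).vbar ^ (-θ.α))
    (S := θ.c ^ (-θ.α)) N (fun k _ => Real.rpow_le_rpow_of_nonpos hc (h.c_le_vbar k)
      (by linarith [h.adm.β_lt_α]))
  have h3 := h.sum_vbar_alpha_le hK
  have h4 := h.sum_small_le V (N + 1)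
  have h5 : ∑ k ∈ Finset.range (N + 1), ‖lag θ S k‖ ^ 2
      ≤ ∑ k ∈ Finset.range (N + 1), (b k * (‖lag θ S k‖ ^ 2 - ‖lag θ S (k + 1)‖ ^ 2)
        + 8 * C ^ 2 * (θ.γx * θ.c ^ (-θ.α)) * θ.γx
          * (b k * ((S k).vbar ^ (-θ.α) - (S (k + 1)).vbar ^ (-θ.α)))
        + 4 * (θ.γx * θ.c ^ (-θ.α)) * θ.γx * ((S (k + 1)).vbar ^ (-θ.α) * msq (gx k))
        + 1 / 2 * ‖lag θ S k‖ ^ 2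
        + 16 * (θ.γx * θ.c ^ (-θ.α)) ^ 2 * (if V ≤ (S k).vbar then 0 else msq (gx k))
        + 8 * ε ^ 2 * (‖meanGradX Q (S k)‖ ^ 2 + ζv ^ 2 * C ^ 2)
        - inner ℝ (lagWeight θ V S k) (mean (gx k) - meanGradX Q (S k))) := by
    refine Finset.sum_le_sum fun k _ => ?_
    have i1 := h.lag_step k
    have i2 := h.neg_inner_lag_dir_le hV k
    simp only [hb]
    linarith
  simp only [Finset.sum_sub_distrib, Finset.sum_add_distrib, ← Finset.mul_sum, Finset.sum_const,
    Finset.card_range, nsmul_eq_mul] at h5 h1 h2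
  have hr := one_le_rate hβ h.gap_pos hK
  set r := rate θ (1 - rho W) (N + 1)
  set ρ := θ.γx * θ.c ^ (-θ.α) with hρ
  have hρ0 : 0 ≤ ρ := by positivity
  set A := adaConst θ.c (θ.c + C ^ 2) θ.α
  have j1 : b N * ((2 * C * ρ) ^ 2 - ‖lag θ S (N + 1)‖ ^ 2)
      ≤ θ.c ^ (-θ.β) * (θ.c + C ^ 2) ^ θ.β * r * (2 * C * ρ) ^ 2 :=
    mul_le_mul hbN (by linarith [sq_nonneg ‖lag θ S (N + 1)‖])
      (by linarith [pow_le_pow_left₀ (norm_nonneg _) (h.norm_lag_le (N + 1)) 2])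
      ((hb0 N).trans hbN)
  have hα : -θ.α ≤ 0 := by linarith [h.adm.β_lt_α]
  have i1 := Real.rpow_nonneg (h.vbar_pos (N + 1)).le (-θ.α)
  have i2 := Real.rpow_le_rpow_of_nonpos hc (h.c_le_vbar (N + 1)) hα
  have j2 : b N * (θ.c ^ (-θ.α) - (S (N + 1)).vbar ^ (-θ.α))
      ≤ θ.c ^ (-θ.β) * (θ.c + C ^ 2) ^ θ.β * r * θ.c ^ (-θ.α) :=
    mul_le_mul hbN (by linarith) (by linarith) ((hb0 N).trans hbN)
  have j3 := mul_le_mul_of_nonneg_left (h2.trans j2)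
    (show 0 ≤ 8 * C ^ 2 * ρ * θ.γx by positivity)
  have j4 := mul_le_mul_of_nonneg_left h3 (show 0 ≤ 4 * ρ * θ.γx by positivity)
  have j5 := mul_le_mul_of_nonneg_left
    (h4.trans (le_mul_of_one_le_right (by positivity : 0 ≤ |V| + C ^ 2) hr))
    (show 0 ≤ 16 * ρ ^ 2 by positivity)
  have e : lagConst θ C V * r = θ.c ^ (-θ.β) * (θ.c + C ^ 2) ^ θ.β * r * (2 * C * ρ) ^ 2
      + 8 * C ^ 2 * ρ * θ.γx * (θ.c ^ (-θ.β) * (θ.c + C ^ 2) ^ θ.β * r * θ.c ^ (-θ.α))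
      + 4 * ρ * θ.γx * (2 * A * r) + 16 * ρ ^ 2 * ((|V| + C ^ 2) * r) := by
    rw [lagConst, ← hρ]; ring
  linarith

/-! ### Tracking of the dual maximizer -/

/-- The mean square distance of the dual variables to the maximizer `y*(x)`. -/
noncomputable def distY (Q : Problem n p d Ξ) (s : State n p d) (x : Vec p) : ℝ :=
  msq fun i => s.y i - Q.yStar x

lemma mean_y_mem (h : Trajectory Q W θ C ζv ζu R S gx gy) (hwp : Q.WellPosed) (k : ℕ) :
    mean (S k).y ∈ Q.Y := by
  rw [mean, Finset.smul_sum]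
  exact hwp.convex.sum_mem (fun _ _ => by positivity)
    (by simpa [mul_comm] using inv_card_mul_sum_const h.n_pos 1)
    fun i _ => h.y_mem k i

/-- One projected ascent step towards a fixed maximizer. -/
lemma distY_succ_le (h : Trajectory Q W θ C ζv ζu R S gx gy) (hQ : Q.Regular L μ C)
    (hζ : ζu ≤ 1) (k : ℕ) (x : Vec p) :
    distY Q (S (k + 1)) x ≤ distY Q (S k) x
      + (θ.γy * (S (k + 1)).ubar ^ (-θ.β))
        * (2 * ((1 / (n : ℝ)) * ∑ i, inner ℝ (gy k i) ((S k).y i - Q.yStar x))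
          + 8 * (ζu ^ 2 * C ^ 2) / μ + μ / 8 * distY Q (S k) x
          + 4 * θ.γy * ((S (k + 1)).ubar ^ (-θ.β) * msq (gy k))) := by
  have hμ := hQ.μ_pos
  have hγ := h.adm.γy_pos
  have hn := h.n_pos
  have hu : 0 < (S (k + 1)).ubar ^ (-θ.β) := Real.rpow_pos_of_pos (h.ubar_pos _) _
  have hY := (hQ.argmax x).1
  set b : Fin n → Vec d := fun j => (θ.γy * (S (k + 1)).u j ^ (-θ.β)) • gy k j with hb
  set c := Q.yStar x
  set l := θ.γy * (S (k + 1)).ubar ^ (-θ.β) with hl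
  have hl0 : 0 < l := by positivity
  have h1 : distY Q (S (k + 1)) x ≤ msq (fun i => (S k).y i + b i - c) := by
    refine le_trans ?_ (msq_mix_sub_le h.mix (fun i => (S k).y i + b i) c)
    rw [← one_mul (msq fun i => ∑ j, W i j • ((S k).y j + b j) - c)]
    refine msq_mono fun i => ?_
    rw [one_mul, h.y_succ]
    have := norm_proj_sub_le hQ.wp.isClosed hQ.wp.convex ⟨_, hY⟩
      (∑ j, W i j • ((S k).y j + b j)) c
    rw [proj_eq_self hQ.wp.isClosed hY] at this
    exact pow_le_pow_left₀ (norm_nonneg _) this 2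
  have h2 : msq (fun i => (S k).y i + b i - c) = distY Q (S k) x
      + 2 * ((1 / (n : ℝ)) * ∑ i, inner ℝ (b i) ((S k).y i - c)) + msq b := by
    have : ∀ i, ‖(S k).y i + b i - c‖ ^ 2
        = ‖(S k).y i - c‖ ^ 2 + 2 * inner ℝ (b i) ((S k).y i - c) + ‖b i‖ ^ 2 := fun i => by
      rw [add_sub_right_comm, norm_add_sq_real, real_inner_comm]
    simp only [distY, msq, this, Finset.sum_add_distrib, ← Finset.mul_sum]
    ring
  have h3 : msq b ≤ 4 * l ^ 2 * msq (gy k) := by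
    refine msq_mono fun i => ?_
    rw [hb, norm_smul, Real.norm_eq_abs, abs_mul, abs_of_pos hγ, mul_pow, mul_pow]
    have h3 := pow_le_pow_left₀ (abs_nonneg _) (h.u_rpow_le hζ k i) 2
    refine mul_le_mul_of_nonneg_right ?_ (sq_nonneg _)
    rw [hl]
    nlinarith [sq_nonneg θ.γy]
  have h4 : (1 / (n : ℝ)) * ∑ i, inner ℝ (b i) ((S k).y i - c)
      = l * ((1 / (n : ℝ)) * ∑ i, inner ℝ (gy k i) ((S k).y i - c))
        + (1 / (n : ℝ)) * ∑ i, inner ℝ (b i - l • gy k i) ((S k).y i - c) := by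
    simp only [inner_sub_left, inner_smul_left, conj_trivial, Finset.sum_sub_distrib,
      ← Finset.mul_sum]
    ring
  have h5 := two_mul_mean_inner_le (t := 8 / (l * μ)) (by positivity)
    (fun i => b i - l • gy k i) (fun i => (S k).y i - c)
  have h6 : msq (fun i => b i - l • gy k i) ≤ l ^ 2 * (ζu ^ 2 * C ^ 2) := by
    refine msq_le_of_forall hn fun i => ?_
    rw [hb, ← sub_smul, norm_smul, hl, ← mul_sub, Real.norm_eq_abs, abs_mul, abs_of_pos hγ]
    have := mul_le_mul (h.zu k i) (h.norm_gy_le k i) (norm_nonneg _)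
      (mul_nonneg h.zu_nonneg hu.le)
    calc _ = θ.γy ^ 2 * (|(S (k + 1)).u i ^ (-θ.β) - (S (k + 1)).ubar ^ (-θ.β)|
            * ‖gy k i‖) ^ 2 := by ring
      _ ≤ θ.γy ^ 2 * (ζu * (S (k + 1)).ubar ^ (-θ.β) * C) ^ 2 := by gcongr
      _ = _ := by ring
  have h7 : 8 / (l * μ) * msq (fun i => b i - l • gy k i) ≤ l * (8 * (ζu ^ 2 * C ^ 2) / μ) := by
    calc _ ≤ 8 / (l * μ) * (l ^ 2 * (ζu ^ 2 * C ^ 2)) := by gcongr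
      _ = _ := by field_simp
  have h8 : 1 / (8 / (l * μ)) * msq (fun i => (S k).y i - c) = l * (μ / 8 * distY Q (S k) x) := by
    rw [one_div_div, distY]; ring
  rw [h8] at h5
  have h9 : 4 * l ^ 2 * msq (gy k)
      = l * (4 * θ.γy * ((S (k + 1)).ubar ^ (-θ.β) * msq (gy k))) := by rw [hl]; ring
  rw [h9] at h3
  linarith

/-- Strong concavity at the averaged iterates, with the consensus errors and the distance between
the averaged primal iterate and the primal variable of the target as perturbations. -/
lemma mean_inner_target_le (h : Trajectory Q W θ C ζv ζu R S gx gy) (hQ : Q.Regular L μ C)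
    (k : ℕ) (x : Vec p) :
    2 * ((1 / (n : ℝ)) * ∑ i, inner ℝ (gy k i) ((S k).y i - Q.yStar x))
      ≤ 2 * ((1 / (n : ℝ)) * ∑ i, inner ℝ (gy k i) ((S k).y i - mean (S k).y))
        + 2 * inner ℝ (mean (S k).y - Q.yStar x) (mean (gy k) - meanGradY Q (S k))
        + 2 * L ^ 2 / μ * dispX S k + (2 * L ^ 2 / μ + μ / 2) * dispY S k
        + 4 * L * (L / μ) * ‖(S k).xbar - x‖ ^ 2 - μ / 2 * distY Q (S k) x := by
  have hμ := hQ.μ_pos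
  have hL := hQ.L_pos
  have hY := h.mean_y_mem hQ.wp k
  have h1 : (1 / (n : ℝ)) * ∑ i, inner ℝ (gy k i) ((S k).y i - Q.yStar x)
      = (1 / (n : ℝ)) * ∑ i, inner ℝ (gy k i) ((S k).y i - mean (S k).y)
        + inner ℝ (mean (S k).y - Q.yStar x) (mean (gy k)) := by
    rw [inner_mean, ← mul_add, ← Finset.sum_add_distrib]
    congr 1
    refine Finset.sum_congr rfl fun i _ => ?_
    rw [real_inner_comm (gy k i) (mean (S k).y - Q.yStar x), ← inner_add_right,
      sub_add_sub_cancel]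
  have h2 := Problem.inner_avgY_sub_yStar_le h.n_pos hL hμ hQ.wp hQ.sc hQ.js hQ.argmax
    (S k).xbar x hY
  have h3 := two_mul_inner_le (t := 2 / μ) (by positivity)
    (meanGradY Q (S k) - Q.avgY (S k).xbar (mean (S k).y)) (mean (S k).y - Q.yStar x)
  have h4 := Problem.norm_mean_gradY_sub_sq_le h.n_pos hQ.js (xs := (S k).x) (h.y_mem k)
    (S k).xbar hY
  have h5 : distY Q (S k) x = dispY S k + ‖mean (S k).y - Q.yStar x‖ ^ 2 :=
    msq_sub_eq h.n_pos _ _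
  have h6 : 2 / μ * ‖meanGradY Q (S k) - Q.avgY (S k).xbar (mean (S k).y)‖ ^ 2
      ≤ 2 / μ * (L ^ 2 * (dispX S k + dispY S k)) := by
    refine mul_le_mul_of_nonneg_left ?_ (by positivity)
    exact h4
  rw [one_div_div, inner_sub_left] at h3
  rw [h1, h5, inner_sub_right]
  rw [real_inner_comm (mean (S k).y - Q.yStar x) (meanGradY Q (S k))] at *
  have e : 2 / μ * (L ^ 2 * (dispX S k + dispY S k))
      = 2 * L ^ 2 / μ * dispX S k + 2 * L ^ 2 / μ * dispY S k := by ring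
  linarith

lemma emaRate_le_stepY (h : Trajectory Q W θ C ζv ζu R S gx gy) (k : ℕ) :
    emaRate θ (S k) ≤ (θ.c + C ^ 2) ^ θ.β * (S (k + 1)).ubar ^ (-θ.β) := by
  have hc := h.adm.c_pos
  have hv := h.vbar_pos k
  have hu := h.ubar_pos (k + 1)
  have h1 : (S (k + 1)).ubar ≤ (θ.c + C ^ 2) * ((S k).vbar / θ.c) := by
    have := (ubar_le_vbar (S (k + 1))).trans (h.vbar_succ_le_mul k)
    calc _ ≤ _ := this
      _ = _ := by ring
  have h2 := Real.rpow_le_rpow hu.le h1 h.adm.β_pos.le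
  rw [Real.mul_rpow (by positivity) (by positivity)] at h2
  have e : emaRate θ (S k) = (((S k).vbar / θ.c) ^ θ.β)⁻¹ := by
    rw [emaRate, ← Real.inv_rpow (by positivity), inv_div]
  rw [e, Real.rpow_neg hu.le, ← div_eq_mul_inv, le_div_iff₀ (by positivity),
    inv_mul_le_iff₀ (by positivity)]
  linarith

/-- The cost of moving the target from `y*(x̃ₖ)` to `y*(x̃ₖ₊₁)`: the rate of the moving average is
of the order of the dual stepsize. -/
lemma distY_ema_succ_le (h : Trajectory Q W θ C ζv ζu R S gx gy) (hQ : Q.Regular L μ C)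
    (k : ℕ) :
    distY Q (S k) (ema θ S (k + 1)) ≤ distY Q (S k) (ema θ S k)
      + (θ.γy * (S (k + 1)).ubar ^ (-θ.β))
        * (μ / 8 * distY Q (S k) (ema θ S (k + 1))
          + 32 * (L / μ) ^ 2 * ((θ.c + C ^ 2) ^ θ.β / θ.γy) ^ 2 / μ * ‖lag θ S k‖ ^ 2) := by
  have hμ := hQ.μ_pos
  have hL := hQ.L_pos
  have hγ := h.adm.γy_pos
  have hu : 0 < (S (k + 1)).ubar ^ (-θ.β) := Real.rpow_pos_of_pos (h.ubar_pos _) _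
  have hr0 := h.emaRate_pos k
  have hr := h.emaRate_le_stepY k
  have e1 : distY Q (S k) (ema θ S (k + 1))
    = dispY S k + ‖mean (S k).y - Q.yStar (ema θ S (k + 1))‖ ^ 2 := msq_sub_eq h.n_pos _ _
  have e2 : distY Q (S k) (ema θ S k)
    = dispY S k + ‖mean (S k).y - Q.yStar (ema θ S k)‖ ^ 2 := msq_sub_eq h.n_pos _ _
  have hC0 : 0 ≤ dispY S k := msq_nonneg _
  have hδ := Problem.norm_yStar_sub_le h.n_pos hL hμ hQ.wp hQ.sc hQ.js hQ.argmax
    (ema θ S (k + 1)) (ema θ S k)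
  have e3 : ema θ S (k + 1) - ema θ S k = emaRate θ (S k) • lag θ S k := by
    rw [ema, lag]; abel
  rw [e3, norm_smul, Real.norm_of_nonneg hr0.le] at hδ
  set a := mean (S k).y - Q.yStar (ema θ S (k + 1)) with ha
  set δ := Q.yStar (ema θ S (k + 1)) - Q.yStar (ema θ S k) with hδdef
  have e4 : mean (S k).y - Q.yStar (ema θ S k) = a + δ := by rw [ha, hδdef]; abel
  rw [e4, norm_add_sq_real] at e2
  set l := θ.γy * (S (k + 1)).ubar ^ (-θ.β) with hl
  have hl0 : 0 < l := by positivity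
  have h1 := two_mul_inner_le (t := l * μ / 8) (by positivity) a (-δ)
  rw [inner_neg_right, norm_neg, one_div_div] at h1
  have h2 : ‖δ‖ ≤ 2 * (L / μ) * ((θ.c + C ^ 2) ^ θ.β / θ.γy * l * ‖lag θ S k‖) := by
    refine hδ.trans ?_
    have : emaRate θ (S k) ≤ (θ.c + C ^ 2) ^ θ.β / θ.γy * l := by
      refine hr.trans (le_of_eq ?_)
      rw [hl]; field_simp
    gcongr
  have h3 := pow_le_pow_left₀ (norm_nonneg _) h2 2
  have h4 : 8 / (l * μ) * ‖δ‖ ^ 2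
      ≤ l * (32 * (L / μ) ^ 2 * ((θ.c + C ^ 2) ^ θ.β / θ.γy) ^ 2 / μ * ‖lag θ S k‖ ^ 2) := by
    calc _ ≤ 8 / (l * μ)
          * (2 * (L / μ) * ((θ.c + C ^ 2) ^ θ.β / θ.γy * l * ‖lag θ S k‖)) ^ 2 := by gcongr
      _ = _ := by field_simp; ring
  have h5 : l * μ / 8 * ‖a‖ ^ 2 ≤ l * (μ / 8 * distY Q (S k) (ema θ S (k + 1))) := by
    rw [e1]
    have : 0 ≤ l * μ / 8 * dispY S k := by positivity
    linarith
  have h6 : 0 ≤ ‖δ‖ ^ 2 := sq_nonneg _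
  linarith

/-- The constant of the lag in the bound of the tracking error. -/
noncomputable def trackLag (θ : Params) (L μ C : ℝ) : ℝ :=
  4 * L * (L / μ) + 32 * (L / μ) ^ 2 * ((θ.c + C ^ 2) ^ θ.β / θ.γy) ^ 2 / μ

/-- The constant of the rate in the bound of the tracking error. -/
noncomputable def trackConst (θ : Params) (L μ C R c₁ : ℝ) : ℝ :=
  (θ.c + C ^ 2) ^ θ.β / θ.γy * (2 * C / μ) ^ 2
    + 2 * L ^ 2 / μ * (2 * |R| + 32 * θ.γx ^ 2 * c₁ * adaConst θ.c (θ.c + C ^ 2) (2 * θ.α))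
    + (2 * L ^ 2 / μ + μ / 2) * (2 * (2 * C / μ) ^ 2
      + 32 * θ.γy ^ 2 * c₁ * adaConst θ.c (θ.c + C ^ 2) (2 * θ.β))
    + (2 * (1 + 16 * θ.γy ^ 2) * adaConst θ.c (θ.c + C ^ 2) θ.β
      + 2 * (θ.c + C ^ 2) ^ θ.β * (2 * C / μ) ^ 2)
    + 8 * θ.γy * adaConst θ.c (θ.c + C ^ 2) θ.β

lemma trackConst_nonneg (h : Trajectory Q W θ C ζv ζu R S gx gy) (hQ : Q.Regular L μ C) {c₁ : ℝ}
    (hc₁ : 0 ≤ c₁) : 0 ≤ trackConst θ L μ C R c₁ := by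
  have := h.adm.γy_pos
  have := h.adm.c_pos
  have := hQ.μ_pos
  have := h.adaConst_nonneg θ.β
  have := h.adaConst_nonneg (2 * θ.β)
  have := h.adaConst_nonneg (2 * θ.α)
  unfold trackConst
  positivity

lemma lag_sub_ema_succ (h : Trajectory Q W θ C ζv ζu R S gx gy) (k : ℕ) :
    ‖(S k).xbar - ema θ S (k + 1)‖ ^ 2 ≤ ‖lag θ S k‖ ^ 2 := by
  have e : (S k).xbar - ema θ S (k + 1) = (1 - emaRate θ (S k)) • lag θ S k := by
    rw [ema, lag, sub_smul, one_smul]; abel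
  have h0 := h.emaRate_pos k
  have h1 := h.emaRate_le_one k
  rw [e, norm_smul, Real.norm_of_nonneg (by linarith)]
  refine pow_le_pow_left₀ (mul_nonneg (by linarith) (norm_nonneg _)) ?_ 2
  nlinarith [norm_nonneg (lag θ S k)]

/-- Tracking of the maximizer along the moving average of the primal iterates. The target at time
`k` is `y*(x̃ₖ₊₁)`, which is determined before the gradients at time `k` are sampled. -/
lemma sum_distY_le (h : Trajectory Q W θ C ζv ζu R S gx gy) (hQ : Q.Regular L μ C)
    (hζ : ζu ≤ 1 ∨ Q.Y.Subsingleton) {K : ℕ} (hK : 1 ≤ K) {c₁ : ℝ} (hc₁ : 0 ≤ c₁)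
    (hthr : 1 / (1 - rho W) ^ 2 ≤ c₁ * (K : ℝ) ^ θ.β) :
    μ / 4 * ∑ k ∈ Finset.range K, distY Q (S k) (ema θ S (k + 1))
      ≤ trackConst θ L μ C R c₁ * rate θ (1 - rho W) K
        + trackLag θ L μ C * ∑ k ∈ Finset.range K, ‖lag θ S k‖ ^ 2
        + K * (8 * (ζu ^ 2 * C ^ 2) / μ)
        + 2 * ∑ k ∈ Finset.range K, inner ℝ (mean (S k).y - Q.yStar (ema θ S (k + 1)))
            (mean (gy k) - meanGradY Q (S k)) := by
  have hμ := hQ.μ_pos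
  have hL := hQ.L_pos
  have hγ := h.adm.γy_pos
  have hc := h.adm.c_pos
  have hβ := h.adm.β_pos
  have hr := one_le_rate hβ h.gap_pos hK
  have hT := h.trackConst_nonneg hQ hc₁
  rcases hζ with hζ | hsub
  swap
  · have h1 : ∀ k, distY Q (S k) (ema θ S (k + 1)) = 0 := fun k => by
      have : ∀ i, (S k).y i - Q.yStar (ema θ S (k + 1)) = 0 := fun i =>
        sub_eq_zero.2 (hsub (h.y_mem k i) (hQ.argmax _).1)
      simp [distY, msq, this]
    have h2 : ∀ k, mean (S k).y - Q.yStar (ema θ S (k + 1)) = 0 := fun k =>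
      sub_eq_zero.2 (hsub (h.mean_y_mem hQ.wp k) (hQ.argmax _).1)
    simp only [h1, h2, inner_zero_left, Finset.sum_const_zero, mul_zero, add_zero]
    have : 0 ≤ trackLag θ L μ C := by unfold trackLag; positivity
    positivity
  obtain ⟨N, rfl⟩ : ∃ N, K = N + 1 := ⟨K - 1, by omega⟩
  set b : ℕ → ℝ := fun k => (S (k + 1)).ubar ^ θ.β / θ.γy with hb
  have hb0 : ∀ k, 0 ≤ b k := fun k => div_nonneg (Real.rpow_nonneg (h.ubar_pos _).le _) hγ.le
  have hbm : Monotone b := fun i j hij => by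
    simp only [hb]
    have := h.mono_ubar (show i + 1 ≤ j + 1 by omega)
    have := h.ubar_pos (i + 1)
    gcongr
  have hTle : ∀ k, distY Q (S k) (ema θ S k) ≤ (2 * C / μ) ^ 2 := fun k =>
    msq_le_of_forall h.n_pos fun i => h.norm_sub_yset_le hQ (h.y_mem k i) (hQ.argmax _).1
  have h1 := sum_mul_sub_le (hb0 0) hbm (a := fun k => distY Q (S k) (ema θ S k))
    (S := (2 * C / μ) ^ 2) N (fun k _ => hTle k)
  have hbN : b N ≤ (θ.c + C ^ 2) ^ θ.β / θ.γy * rate θ (1 - rho W) (N + 1) := by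
    simp only [hb]
    have h2 := h.ubar_rpow_le hK hβ.le
    have h3 := pow_beta_le_rate (θ := θ) h.gap_pos hK
    rw [div_mul_eq_mul_div]
    gcongr
    exact h2.trans (by gcongr)
  have h2 : b N * ((2 * C / μ) ^ 2 - distY Q (S (N + 1)) (ema θ S (N + 1)))
      ≤ (θ.c + C ^ 2) ^ θ.β / θ.γy * rate θ (1 - rho W) (N + 1) * (2 * C / μ) ^ 2 :=
    mul_le_mul hbN (by linarith [show 0 ≤ distY Q (S (N + 1)) (ema θ S (N + 1)) from msq_nonneg _])
      (by linarith [hTle (N + 1)]) ((hb0 N).trans hbN)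
  have hstep : ∀ k, μ / 4 * distY Q (S k) (ema θ S (k + 1))
      ≤ b k * (distY Q (S k) (ema θ S k) - distY Q (S (k + 1)) (ema θ S (k + 1)))
        + trackLag θ L μ C * ‖lag θ S k‖ ^ 2
        + 2 * L ^ 2 / μ * dispX S k + (2 * L ^ 2 / μ + μ / 2) * dispY S k
        + 2 * ((1 / (n : ℝ)) * ∑ i, inner ℝ (gy k i) ((S k).y i - mean (S k).y))
        + 4 * θ.γy * ((S (k + 1)).ubar ^ (-θ.β) * msq (gy k))
        + 8 * (ζu ^ 2 * C ^ 2) / μ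
        + 2 * inner ℝ (mean (S k).y - Q.yStar (ema θ S (k + 1)))
            (mean (gy k) - meanGradY Q (S k)) := by
    intro k
    have i1 := h.distY_succ_le hQ hζ k (ema θ S (k + 1))
    have i2 := h.mean_inner_target_le hQ k (ema θ S (k + 1))
    have i3 := h.distY_ema_succ_le hQ k
    have i4 := mul_le_mul_of_nonneg_left (h.lag_sub_ema_succ k)
      (show 0 ≤ 4 * L * (L / μ) by positivity)
    have hu := h.ubar_pos (k + 1)
    have hbl : b k * (θ.γy * (S (k + 1)).ubar ^ (-θ.β)) = 1 := by
      simp only [hb]; rw [Real.rpow_neg hu.le]; field_simp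
    have i5 := mul_le_mul_of_nonneg_left (add_le_add i1 i3) (hb0 k)
    rw [trackLag]
    set l := θ.γy * (S (k + 1)).ubar ^ (-θ.β)
    set N' := distY Q (S k) (ema θ S (k + 1))
    set T := distY Q (S k) (ema θ S k)
    set T' := distY Q (S (k + 1)) (ema θ S (k + 1))
    set P := 2 * ((1 / (n : ℝ)) * ∑ i, inner ℝ (gy k i) ((S k).y i - Q.yStar (ema θ S (k + 1))))
          + 8 * (ζu ^ 2 * C ^ 2) / μ + μ / 8 * N'
          + 4 * θ.γy * ((S (k + 1)).ubar ^ (-θ.β) * msq (gy k)) with hP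
    set P' := μ / 8 * N'
          + 32 * (L / μ) ^ 2 * ((θ.c + C ^ 2) ^ θ.β / θ.γy) ^ 2 / μ * ‖lag θ S k‖ ^ 2 with hP'
    have e : b k * (N' + l * P + (T + l * P')) = b k * N' + b k * T + P + P' := by
      linear_combination (P + P') * hbl
    rw [e] at i5
    rw [hP, hP'] at i5
    linarith
  have hsum := Finset.sum_le_sum fun k (_ : k ∈ Finset.range (N + 1)) => hstep k
  have j1 := h.sum_dispX_le hK hc₁ hthr
  have j2 := h.sum_dispY_le hQ hζ hK hc₁ hthr
  have j3 := h.sum_inner_dispY_le hQ hζ hK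
  have j4 := h.sum_ubar_rpow_le hK θ.β
  have j5 := (pow_one_sub_mul_le (s := θ.β) (by linarith [h.adm.β_lt_α, h.adm.α_lt_one]) hK).trans
    (mul_le_mul_of_nonneg_left (log_mul_pow_one_sub_beta_le_rate h.gap_pos gap_le_one hK)
      zero_le_two)
  have j6 := j4.trans (mul_le_mul_of_nonneg_left j5 (h.adaConst_nonneg θ.β))
  have k1 := mul_le_mul_of_nonneg_left j1 (show 0 ≤ 2 * L ^ 2 / μ by positivity)
  have k2 := mul_le_mul_of_nonneg_left j2 (show 0 ≤ 2 * L ^ 2 / μ + μ / 2 by positivity)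
  have k3 := mul_le_mul_of_nonneg_left j6 (show 0 ≤ 4 * θ.γy by positivity)
  simp only [Finset.sum_add_distrib, ← Finset.mul_sum, Finset.sum_const,
    Finset.card_range, nsmul_eq_mul] at hsum j3
  rw [trackConst]
  linarith

/-! ### The bound along a trajectory -/

/-- The bias of the averaged gradient as an estimate of `∇Φ` at the averaged iterate. -/
lemma norm_meanGradX_sub_sq_le (h : Trajectory Q W θ C ζv ζu R S gx gy) (hQ : Q.Regular L μ C)
    (k : ℕ) :
    ‖meanGradX Q (S k) - gradient Q.Phi (S k).xbar‖ ^ 2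
      ≤ L ^ 2 * dispX S k + 2 * L ^ 2 * distY Q (S k) (ema θ S (k + 1))
        + 8 * L ^ 2 * (L / μ) ^ 2 * ‖lag θ S k‖ ^ 2 := by
  have hμ := hQ.μ_pos
  have hL := hQ.L_pos
  rw [Problem.gradient_Phi h.n_pos hL hμ hQ.wp hQ.sc hQ.js hQ.argmax]
  have h1 := Problem.norm_mean_gradX_sub_sq_le h.n_pos hQ.js (xs := (S k).x) (h.y_mem k)
    (S k).xbar (hQ.argmax (S k).xbar).1
  have h2 := msq_add_le zero_lt_one (fun i => (S k).y i - Q.yStar (ema θ S (k + 1)))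
    (fun _ => Q.yStar (ema θ S (k + 1)) - Q.yStar (S k).xbar)
  have h3 := Problem.norm_yStar_sub_le h.n_pos hL hμ hQ.wp hQ.sc hQ.js hQ.argmax
    (ema θ S (k + 1)) (S k).xbar
  have h4 := pow_le_pow_left₀ (norm_nonneg _) h3 2
  have h5 := h.lag_sub_ema_succ k
  have h6 : msq (fun _ : Fin n => Q.yStar (ema θ S (k + 1)) - Q.yStar (S k).xbar)
      ≤ 4 * (L / μ) ^ 2 * ‖lag θ S k‖ ^ 2 := by
    refine msq_le_of_forall h.n_pos fun _ => h4.trans ?_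
    rw [norm_sub_rev, mul_pow, mul_pow]
    have := mul_le_mul_of_nonneg_left h5 (show 0 ≤ 4 * (L / μ) ^ 2 by positivity)
    linarith
  simp only [sub_add_sub_cancel] at h2
  have h7 : msq (fun i => (S k).y i - Q.yStar (S k).xbar)
      ≤ 2 * distY Q (S k) (ema θ S (k + 1)) + 8 * (L / μ) ^ 2 * ‖lag θ S k‖ ^ 2 := by
    rw [distY]; linarith
  have h8 := mul_le_mul_of_nonneg_left h7 (sq_nonneg L)
  have h9 : ‖meanGradX Q (S k) - Q.avgX (S k).xbar (Q.yStar (S k).xbar)‖ ^ 2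
      ≤ L ^ 2 * (dispX S k + msq fun i => (S k).y i - Q.yStar (S k).xbar) := h1
  linarith

/-- The predictable vectors paired with the primal gradient noise. -/
noncomputable def noiseX (Q : Problem n p d Ξ) (θ : Params) (b V : ℝ) (S : ℕ → State n p d)
    (k : ℕ) : Vec p :=
  -((6 : ℝ) • gradient Q.Phi (S k).xbar + (16 * b) • lagWeight θ V S k)

/-- The predictable vectors paired with the dual gradient noise. -/
noncomputable def noiseY (Q : Problem n p d Ξ) (θ : Params) (a : ℝ) (S : ℕ → State n p d)
    (k : ℕ) : Vec d :=
  a • (mean (S k).y - Q.yStar (ema θ S (k + 1)))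

/-- Elimination of the tracking error and of the lag from the coupled inequalities. -/
lemma combine_bounds {G E Z N X M r k₁ kx k₂ k₃ a₁ b L s κ ε ζ ζ' M₁ M₂ M₃ : ℝ}
    (hb : b = 8 * s * a₁ + 8 * L ^ 2 * κ ^ 2) (hb0 : 0 ≤ b)
    (hε : 128 * (ε ^ 2 * b) ≤ 1) (hG0 : 0 ≤ G) (hE0 : 0 ≤ E) (hζ : 0 ≤ ζ)
    (hG : 1 / 2 * G ≤ k₁ * r + E + ζ - M₁)
    (hE : E ≤ L ^ 2 * X + 2 * L ^ 2 * N + 8 * L ^ 2 * κ ^ 2 * Z)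
    (hX : X ≤ kx * r)
    (hN : 2 * L ^ 2 * N ≤ 8 * s * (k₂ * r + a₁ * Z + 2 * M₃) + 64 * κ ^ 2 * ζ')
    (hM : M ≤ 2 * G + 2 * E)
    (hZ : 1 / 2 * Z ≤ k₃ * r + 8 * ε ^ 2 * (M + ζ) - M₂) :
    G ≤ (6 * k₁ + 8 * (L ^ 2 * kx + 8 * s * k₂ + 2 * b * k₃)) * r
      + (7 * ζ + 512 * κ ^ 2 * ζ') + (-(6 * M₁ + 16 * b * M₂) + 128 * s * M₃) := by
  have hX' := mul_le_mul_of_nonneg_left hX (sq_nonneg L)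
  have hE' : E ≤ (L ^ 2 * kx + 8 * s * k₂) * r + b * Z + 64 * κ ^ 2 * ζ' + 16 * s * M₃ := by
    rw [hb]
    linarith
  have hZ' : b * Z ≤ 2 * b * k₃ * r + 16 * (ε ^ 2 * b) * (M + ζ) - 2 * b * M₂ := by
    have := mul_le_mul_of_nonneg_left hZ (show 0 ≤ 2 * b by positivity)
    linarith
  have hε0 : 0 ≤ ε ^ 2 * b := by positivity
  have hM' : 16 * (ε ^ 2 * b) * (M + ζ) ≤ 1 / 4 * (G + E) + 1 / 8 * ζ := by
    have h1 := mul_le_mul_of_nonneg_left hM hε0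
    have h2 := mul_le_mul_of_nonneg_right hε (show 0 ≤ 2 * G + 2 * E + ζ by linarith)
    linarith
  -- `E ≤ G / 3 + …`, hence `G / 2 ≤ G / 3 + …`
  have hEG : 3 / 4 * E ≤ 1 / 4 * G + (L ^ 2 * kx + 8 * s * k₂ + 2 * b * k₃) * r
      + 1 / 8 * ζ + 64 * κ ^ 2 * ζ' + 16 * s * M₃ - 2 * b * M₂ := by linarith
  linarith

/-- The bound of the gradients along a trajectory. The hypothesis on `ε` is what is needed to absorb
the lag, which enters with the weight `b`, into the gradients; the last sum is gradient noise
against predictable vectors. -/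
theorem sum_gradient_bound (h : Trajectory Q W θ C ζv ζu R S gx gy) (hQ : Q.Regular L μ C)
    {Δ : ℝ} (hΔ : ∀ x x' : Vec p, Q.Phi x - Q.Phi x' ≤ Δ) (hζ : ζu ≤ 1 ∨ Q.Y.Subsingleton)
    {V ε b : ℝ} (hb : b = 8 * (L ^ 2 / μ) * trackLag θ L μ C + 8 * L ^ 2 * (L / μ) ^ 2)
    (hε : 128 * (ε ^ 2 * b) ≤ 1) (hV : ∀ k, V ≤ (S k).vbar → stepRatio θ (S k) ≤ ε)
    {K : ℕ} (hK : 1 ≤ K) {c₁ : ℝ} (hc₁ : 0 ≤ c₁)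
    (hthr : 1 / (1 - rho W) ^ 2 ≤ c₁ * (K : ℝ) ^ θ.β) :
    ∑ k ∈ Finset.range K, ‖gradient Q.Phi (S k).xbar‖ ^ 2
      ≤ (6 * ((θ.c + C ^ 2) ^ θ.α / θ.γx * |Δ| + 8 * (L * (1 + 2 * (L / μ))) * θ.γx
            * adaConst θ.c (θ.c + C ^ 2) θ.α)
          + 8 * (L ^ 2 * (2 * |R| + 32 * θ.γx ^ 2 * c₁ * adaConst θ.c (θ.c + C ^ 2) (2 * θ.α))
            + 8 * (L ^ 2 / μ) * trackConst θ L μ C R c₁ + 2 * b * lagConst θ C V))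
          * rate θ (1 - rho W) K
        + K * (512 * (ζv ^ 2 + (L / μ) ^ 2 * ζu ^ 2) * C ^ 2)
        + ∑ k ∈ Finset.range K,
            (inner ℝ (noiseX Q θ b V S k) (mean (gx k) - meanGradX Q (S k))
              + inner ℝ (noiseY Q θ (128 * (L ^ 2 / μ)) S k)
                (mean (gy k) - meanGradY Q (S k))) := by
  have hμ := hQ.μ_pos
  have hL := hQ.L_pos
  have hγ := h.adm.γy_pos
  have hc := h.adm.c_pos
  have hb0 : 0 ≤ b := by rw [hb, trackLag]; positivity
  have h1 := h.sum_gradient_le hQ hΔ hK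
  have h2 := Finset.sum_le_sum fun k (_ : k ∈ Finset.range K) => h.norm_meanGradX_sub_sq_le hQ k
  have h3 := h.sum_dispX_le hK hc₁ hthr
  have h4 := h.sum_distY_le hQ hζ hK hc₁ hthr
  have h5 : ∑ k ∈ Finset.range K, ‖meanGradX Q (S k)‖ ^ 2
      ≤ 2 * ∑ k ∈ Finset.range K, ‖gradient Q.Phi (S k).xbar‖ ^ 2
        + 2 * ∑ k ∈ Finset.range K, ‖meanGradX Q (S k) - gradient Q.Phi (S k).xbar‖ ^ 2 := by
    rw [Finset.mul_sum, Finset.mul_sum, ← Finset.sum_add_distrib]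
    refine Finset.sum_le_sum fun k _ => ?_
    have := norm_add_sq_le_young zero_lt_one (gradient Q.Phi (S k).xbar)
      (meanGradX Q (S k) - gradient Q.Phi (S k).xbar)
    rw [add_sub_cancel] at this
    linarith
  have h6 := h.sum_lag_le (Q := Q) hV hK
  simp only [Finset.sum_add_distrib, ← Finset.mul_sum] at h2
  have h7 : 2 * L ^ 2 * ∑ k ∈ Finset.range K, distY Q (S k) (ema θ S (k + 1))
      ≤ 8 * (L ^ 2 / μ) * (trackConst θ L μ C R c₁ * rate θ (1 - rho W) K
        + trackLag θ L μ C * ∑ k ∈ Finset.range K, ‖lag θ S k‖ ^ 2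
        + 2 * ∑ k ∈ Finset.range K, inner ℝ (mean (S k).y - Q.yStar (ema θ S (k + 1)))
            (mean (gy k) - meanGradY Q (S k)))
        + 64 * (L / μ) ^ 2 * (K * (ζu ^ 2 * C ^ 2)) := by
    have i1 := mul_le_mul_of_nonneg_left h4 (show 0 ≤ 8 * (L ^ 2 / μ) by positivity)
    have i2 : ∀ x : ℝ, 8 * (L ^ 2 / μ) * (μ / 4 * x) = 2 * L ^ 2 * x := fun x => by
      field_simp; ring
    have i3 : 8 * (L ^ 2 / μ) * (K * (8 * (ζu ^ 2 * C ^ 2) / μ))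
        = 64 * (L / μ) ^ 2 * (K * (ζu ^ 2 * C ^ 2)) := by ring
    rw [i2] at i1
    linarith
  have hkey := combine_bounds (ζ := K * (ζv ^ 2 * C ^ 2)) (ζ' := K * (ζu ^ 2 * C ^ 2)) hb hb0
    hε (Finset.sum_nonneg fun k _ => sq_nonneg _)
    (Finset.sum_nonneg fun k _ => sq_nonneg _) (by positivity) h1 h2 h3 h7 h5 h6
  refine hkey.trans ?_
  have e : ∑ k ∈ Finset.range K,
            (inner ℝ (noiseX Q θ b V S k) (mean (gx k) - meanGradX Q (S k))
              + inner ℝ (noiseY Q θ (128 * (L ^ 2 / μ)) S k) (mean (gy k) - meanGradY Q (S k)))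
      = -(6 * ∑ k ∈ Finset.range K,
            inner ℝ (gradient Q.Phi (S k).xbar) (mean (gx k) - meanGradX Q (S k))
          + 16 * b * ∑ k ∈ Finset.range K,
            inner ℝ (lagWeight θ V S k) (mean (gx k) - meanGradX Q (S k)))
        + 128 * (L ^ 2 / μ) * ∑ k ∈ Finset.range K,
            inner ℝ (mean (S k).y - Q.yStar (ema θ S (k + 1)))
              (mean (gy k) - meanGradY Q (S k)) := by
    simp only [noiseX, noiseY, inner_neg_left, inner_add_left, inner_smul_left, conj_trivial,
      Finset.sum_add_distrib, Finset.sum_neg_distrib, ← Finset.mul_sum]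
  rw [e]
  have : 0 ≤ K * (ζv ^ 2 * C ^ 2) := by positivity
  linarith

end Trajectory

open Trajectory

/-! ### Measurability of the iterates -/

section Measurability

variable {n p d : ℕ} {Ξ : Type*} [MeasurableSpace Ξ] {Q : Problem n p d Ξ}
  {W : Matrix (Fin n) (Fin n) ℝ} {θ : Params} {L μ C : ℝ} {Ω : Type*}

/-- A random state all of whose components are measurable with respect to `m`. -/
structure MeasurableState (m : MeasurableSpace Ω) (s : Ω → State n p d) : Prop where
  x : ∀ i, Measurable fun ω => (s ω).x i
  y : ∀ i, Measurable fun ω => (s ω).y i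
  mx : ∀ i, Measurable fun ω => (s ω).mx i
  my : ∀ i, Measurable fun ω => (s ω).my i

lemma MeasurableState.mono {m m' : MeasurableSpace Ω} (hm : m ≤ m') {s : Ω → State n p d}
    (h : MeasurableState m s) : MeasurableState m' s :=
  ⟨fun i => (h.x i).mono hm le_rfl, fun i => (h.y i).mono hm le_rfl,
    fun i => (h.mx i).mono hm le_rfl, fun i => (h.my i).mono hm le_rfl⟩

lemma MeasurableState.step [m : MeasurableSpace Ω] (hwp : Q.WellPosed) (hne : Q.Y.Nonempty)
    {s : Ω → State n p d} (h : MeasurableState m s) {sx sy : Fin n → Ω → Ξ}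
    (hx : ∀ i, Measurable (sx i)) (hy : ∀ i, Measurable (sy i)) :
    MeasurableState m fun ω => step Q W θ (fun i => sx i ω) (fun i => sy i ω) (s ω) := by
  have gx : ∀ i, Measurable fun ω => Q.sgradX i ((s ω).x i) ((s ω).y i) (sx i ω) := fun i =>
    (hwp.measurable_sgradX i).comp (((h.x i).prodMk (h.y i)).prodMk (hx i))
  have gy : ∀ i, Measurable fun ω => Q.sgradY i ((s ω).x i) ((s ω).y i) (sy i ω) := fun i =>
    (hwp.measurable_sgradY i).comp (((h.x i).prodMk (h.y i)).prodMk (hy i))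
  have mx : ∀ i, Measurable fun ω =>
      (s ω).mx i + ‖Q.sgradX i ((s ω).x i) ((s ω).y i) (sx i ω)‖ ^ 2 := fun i =>
    (h.mx i).add ((gx i).norm.pow_const 2)
  have my : ∀ i, Measurable fun ω =>
      (s ω).my i + ‖Q.sgradY i ((s ω).x i) ((s ω).y i) (sy i ω)‖ ^ 2 := fun i =>
    (h.my i).add ((gy i).norm.pow_const 2)
  refine ⟨fun i => ?_, fun i => ?_, mx, my⟩
  · have h1 : ∀ j, Measurable fun ω => (s ω).x j - (θ.γx *
        (max ((s ω).mx j + ‖Q.sgradX j ((s ω).x j) ((s ω).y j) (sx j ω)‖ ^ 2)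
          ((s ω).my j + ‖Q.sgradY j ((s ω).x j) ((s ω).y j) (sy j ω)‖ ^ 2)) ^ (-θ.α))
        • Q.sgradX j ((s ω).x j) ((s ω).y j) (sx j ω) := fun j =>
      (h.x j).sub (((((mx j).max (my j)).pow_const _).const_mul _).smul (gx j))
    exact Finset.measurable_fun_sum Finset.univ fun j _ => (h1 j).const_smul (W i j)
  · have h1 : ∀ j, Measurable fun ω => (s ω).y j + (θ.γy *
        ((s ω).my j + ‖Q.sgradY j ((s ω).x j) ((s ω).y j) (sy j ω)‖ ^ 2) ^ (-θ.β))
        • Q.sgradY j ((s ω).x j) ((s ω).y j) (sy j ω) := fun j =>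
      (h.y j).add ((((my j).pow_const _).const_mul _).smul (gy j))
    have h2 : Measurable fun ω => ∑ j, W i j • ((s ω).y j + (θ.γy *
        ((s ω).my j + ‖Q.sgradY j ((s ω).x j) ((s ω).y j) (sy j ω)‖ ^ 2) ^ (-θ.β))
        • Q.sgradY j ((s ω).x j) ((s ω).y j) (sy j ω)) :=
      Finset.measurable_fun_sum Finset.univ fun j _ => (h1 j).const_smul (W i j)
    exact (continuous_proj hwp.isClosed hwp.convex hne).measurable.comp h2

lemma MeasurableState.xbar [m : MeasurableSpace Ω] {s : Ω → State n p d}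
    (h : MeasurableState m s) : Measurable fun ω => (s ω).xbar := by
  have h1 : Measurable fun ω => ∑ i, (s ω).x i :=
    Finset.measurable_fun_sum Finset.univ fun i _ => h.x i
  exact h1.const_smul (1 / (n : ℝ))

lemma MeasurableState.ybar [m : MeasurableSpace Ω] {s : Ω → State n p d}
    (h : MeasurableState m s) : Measurable fun ω => mean (s ω).y := by
  have h1 : Measurable fun ω => ∑ i, (s ω).y i :=
    Finset.measurable_fun_sum Finset.univ fun i _ => h.y i
  exact h1.const_smul (1 / (n : ℝ))

lemma MeasurableState.vbar [m : MeasurableSpace Ω] {s : Ω → State n p d}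
    (h : MeasurableState m s) : Measurable fun ω => (s ω).vbar := by
  have h1 : Measurable fun ω => ∑ i, (s ω).v i :=
    Finset.measurable_fun_sum Finset.univ fun i _ => (h.mx i).max (h.my i)
  exact h1.const_mul (1 / (n : ℝ))

lemma MeasurableState.emaRate [m : MeasurableSpace Ω] {s : Ω → State n p d}
    (h : MeasurableState m s) : Measurable fun ω => emaRate θ (s ω) :=
  (h.vbar.const_div _).pow_const _

lemma measurable_ema [m : MeasurableSpace Ω] {S : ℕ → Ω → State n p d} {k : ℕ}
    (h : ∀ j ≤ k, MeasurableState m (S j)) :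
    ∀ j ≤ k + 1, Measurable fun ω => ema θ (fun t => S t ω) j := by
  intro j
  induction j with
  | zero => exact fun _ => (h 0 (Nat.zero_le k)).xbar
  | succ j ih =>
    intro hj
    have h1 := ih (by omega)
    have h2 := h j (by omega)
    exact h1.add (h2.emaRate.smul (h2.xbar.sub h1))

lemma measurable_noiseX [m : MeasurableSpace Ω] (hn : 0 < n) (hQ : Q.Regular L μ C)
    {S : ℕ → Ω → State n p d} {k : ℕ} (h : ∀ j ≤ k, MeasurableState m (S j)) (b V : ℝ) :
    Measurable fun ω => noiseX Q θ b V (fun t => S t ω) k := by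
  have hk := h k le_rfl
  have h1 : Measurable fun ω => lag θ (fun t => S t ω) k :=
    hk.xbar.sub (measurable_ema h k (Nat.le_succ k))
  have h2 : Measurable fun ω => lagWeight θ V (fun t => S t ω) k := by
    have h3 : Measurable fun ω => stepRatio θ (S k ω) := (hk.vbar.pow_const _).const_mul _
    have h4 : Measurable fun ω => 2 * (1 - emaRate θ (S k ω)) * stepRatio θ (S k ω) :=
      ((hk.emaRate.const_sub 1).const_mul 2).mul h3
    have h5 : Measurable fun ω => (2 * (1 - emaRate θ (S k ω)) * stepRatio θ (S k ω))
        • lag θ (fun t => S t ω) k := h4.smul h1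
    exact Measurable.ite (measurableSet_le measurable_const hk.vbar) h5 measurable_const
  have h3 : Measurable fun ω => gradient Q.Phi (S k ω).xbar :=
    (Problem.continuous_gradient_Phi hn hQ.L_pos hQ.μ_pos hQ.wp hQ.sc hQ.js
      hQ.argmax).measurable.comp hk.xbar
  have h4 : Measurable fun ω => (6 : ℝ) • gradient Q.Phi (S k ω).xbar := h3.const_smul (6 : ℝ)
  have h5 : Measurable fun ω => (16 * b) • lagWeight θ V (fun t => S t ω) k :=
    h2.const_smul (16 * b)
  exact (h4.add h5).neg

lemma measurable_noiseY [m : MeasurableSpace Ω] (hn : 0 < n) (hQ : Q.Regular L μ C)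
    {S : ℕ → Ω → State n p d} {k : ℕ} (h : ∀ j ≤ k, MeasurableState m (S j)) (a : ℝ) :
    Measurable fun ω => noiseY Q θ a (fun t => S t ω) k := by
  have h1 : Measurable fun ω => Q.yStar (ema θ (fun t => S t ω) (k + 1)) :=
    (Problem.continuous_yStar hn hQ.L_pos hQ.μ_pos hQ.wp hQ.sc hQ.js
      hQ.argmax).measurable.comp (measurable_ema h (k + 1) le_rfl)
  have h2 : Measurable fun ω => mean (S k ω).y - Q.yStar (ema θ (fun t => S t ω) (k + 1)) :=
    (h k le_rfl).ybar.sub h1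
  exact h2.const_smul a

end Measurability

/-! ### Integration against an independent sample -/

section Independent

variable {Ω α Ξ : Type*} [MeasurableSpace Ω] [MeasurableSpace α] [MeasurableSpace Ξ]
  {P : Measure Ω} [IsProbabilityMeasure P] {U : Ω → α} {ξ : Ω → Ξ}

/-- A property that holds for almost every sample at each frozen value of `U` holds almost surely at
a random value independent of the sample. -/
lemma ae_of_indepFun (hU : Measurable U) (hξ : Measurable ξ) (hind : IndepFun U ξ P)
    {q : α × Ξ → Prop} (hq : MeasurableSet {z | q z})
    (h : ∀ ω, ∀ᵐ s ∂(P.map ξ), q (U ω, s)) : ∀ᵐ ω ∂P, q (U ω, ξ ω) := by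
  have := Measure.isProbabilityMeasure_map (μ := P) hξ.aemeasurable
  have := Measure.isProbabilityMeasure_map (μ := P) hU.aemeasurable
  have hmap := (indepFun_iff_map_prod_eq_prod_map_map hU.aemeasurable hξ.aemeasurable).1 hind
  have h1 : ∀ᵐ z ∂(P.map fun ω => (U ω, ξ ω)), q z := by
    rw [hmap, Measure.ae_prod_iff_ae_ae hq]
    rw [ae_map_iff hU.aemeasurable]
    · exact Filter.Eventually.of_forall h
    · exact measurableSet_eq_fun (measurable_measure_prodMk_left hq.compl) measurable_const
  exact ae_of_ae_map (hU.prodMk hξ).aemeasurable h1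

/-- An integral against an independent sample vanishes if it does so at each frozen value of `U`. -/
lemma integral_eq_zero_of_indepFun (hU : Measurable U) (hξ : Measurable ξ)
    (hind : IndepFun U ξ P) {φ : α × Ξ → ℝ} (hφ : Measurable φ)
    (hint : Integrable (fun ω => φ (U ω, ξ ω)) P)
    (h : ∀ ω, ∫ s, φ (U ω, s) ∂(P.map ξ) = 0) : ∫ ω, φ (U ω, ξ ω) ∂P = 0 := by
  have := Measure.isProbabilityMeasure_map (μ := P) hξ.aemeasurable
  have := Measure.isProbabilityMeasure_map (μ := P) hU.aemeasurable
  have hmap := (indepFun_iff_map_prod_eq_prod_map_map hU.aemeasurable hξ.aemeasurable).1 hind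
  have hpair : AEMeasurable (fun ω => (U ω, ξ ω)) P := (hU.prodMk hξ).aemeasurable
  have h1 : ∫ ω, φ (U ω, ξ ω) ∂P = ∫ z, φ z ∂(P.map fun ω => (U ω, ξ ω)) :=
    (integral_map hpair hφ.aestronglyMeasurable).symm
  have hint' : Integrable φ ((P.map U).prod (P.map ξ)) := by
    rw [← hmap, integrable_map_measure hφ.aestronglyMeasurable hpair]; exact hint
  rw [h1, hmap, integral_prod _ hint', integral_map hU.aemeasurable]
  · simp [h]
  · exact hφ.stronglyMeasurable.integral_prod_right'.aestronglyMeasurable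

/-- A predictable vector is uncorrelated with the noise of a stochastic gradient: `G (u, s)` is the
stochastic gradient at `u` with sample `s`, and `g u` its mean. -/
lemma inner_noise_indep {E : Type*} [NormedAddCommGroup E] [InnerProductSpace ℝ E]
    [MeasurableSpace E] [BorelSpace E] [SecondCountableTopology E] [CompleteSpace E]
    {G : α × Ξ → E} (hG : Measurable G) {g : α → E} {Z : Ω → E} {B C : ℝ} (hU : Measurable U)
    (hZ : Measurable Z) (hξ : Measurable ξ)
    (hind : IndepFun (fun ω => (Z ω, U ω)) ξ P) (hB : ∀ᵐ ω ∂P, ‖Z ω‖ ≤ B)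
    (hbd : ∀ ω, ∀ᵐ s ∂(P.map ξ), ‖G (U ω, s)‖ ≤ C)
    (hmean : ∀ ω, ∫ s, G (U ω, s) ∂(P.map ξ) = g (U ω)) :
    Integrable (fun ω => inner ℝ (Z ω) (G (U ω, ξ ω) - g (U ω))) P
      ∧ ∫ ω, inner ℝ (Z ω) (G (U ω, ξ ω) - g (U ω)) ∂P = 0 := by
  have := Measure.isProbabilityMeasure_map (μ := P) hξ.aemeasurable
  have hindU : IndepFun U ξ P := hind.comp measurable_snd measurable_id
  have hGb : ∀ᵐ ω ∂P, ‖G (U ω, ξ ω)‖ ≤ C :=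
    ae_of_indepFun (q := fun z => ‖G z‖ ≤ C) hU hξ hindU
      (measurableSet_le hG.norm measurable_const) hbd
  have hgb : ∀ ω, ‖g (U ω)‖ ≤ C := fun ω => by
    rw [← hmean]; simpa using norm_integral_le_of_norm_le_const (hbd ω)
  set gm : α → E := fun u => ∫ s, G (u, s) ∂(P.map ξ) with hgm
  have hgmm : Measurable gm := (hG.stronglyMeasurable.integral_prod_right').measurable
  set φ : (E × α) × Ξ → ℝ := fun z => inner ℝ z.1.1 (G (z.1.2, z.2) - gm z.1.2) with hφdef
  have hφ : Measurable φ := by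
    refine Measurable.inner (measurable_fst.comp measurable_fst) (Measurable.sub ?_ ?_)
    · exact hG.comp ((measurable_snd.comp measurable_fst).prodMk measurable_snd)
    · exact hgmm.comp (measurable_snd.comp measurable_fst)
  have e : (fun ω => inner ℝ (Z ω) (G (U ω, ξ ω) - g (U ω))) = fun ω => φ ((Z ω, U ω), ξ ω) := by
    funext ω
    simp only [hφdef, hgm, hmean]
  have hint : Integrable (fun ω => φ ((Z ω, U ω), ξ ω)) P := by
    refine Integrable.of_bound (C := B * (C + C))
      (hφ.comp ((hZ.prodMk hU).prodMk hξ)).aestronglyMeasurable ?_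
    filter_upwards [hB, hGb] with ω h1 h2
    rw [← congrFun e ω, Real.norm_eq_abs]
    refine (abs_real_inner_le_norm _ _).trans ?_
    have h3 := (norm_sub_le (G (U ω, ξ ω)) (g (U ω))).trans (add_le_add h2 (hgb ω))
    exact mul_le_mul h1 h3 (norm_nonneg _) ((norm_nonneg _).trans h1)
  rw [e]
  refine ⟨hint, integral_eq_zero_of_indepFun (hZ.prodMk hU) hξ hind hφ hint fun ω => ?_⟩
  have hGi : Integrable (fun s => G (U ω, s)) (P.map ξ) :=
    Integrable.of_bound (C := C) (hG.comp measurable_prodMk_left).aestronglyMeasurable (hbd ω)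
  simp only [hφdef, hgm]
  rw [integral_inner (f := fun s => G (U ω, s) - ∫ s, G (U ω, s) ∂(P.map ξ))
    (hGi.sub (integrable_const _)), integral_sub hGi (integrable_const _)]
  simp

end Independent

/-! ### The information available before an iteration -/

section Past

variable {n p d : ℕ} {Ξ : Type*} [MeasurableSpace Ξ] {Q : Problem n p d Ξ}
  {W : Matrix (Fin n) (Fin n) ℝ} {θ : Params} {L μ C : ℝ} {Ω : Type*} [MeasurableSpace Ω]
  {P : Measure Ω} {ξx ξy : ℕ → Fin n → Ω → Ξ} {x0 : Fin n → Vec p} {y0 : Fin n → Vec d}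

/-- The σ-algebra generated by one sample; primal samples are indexed on the left, dual samples on
the right. -/
@[reducible] def sampleSigma (ξx ξy : ℕ → Fin n → Ω → Ξ) (a : (ℕ × Fin n) ⊕ (ℕ × Fin n)) :
    MeasurableSpace Ω :=
  MeasurableSpace.comap (fun ω =>
    Sum.elim (fun q : ℕ × Fin n => ξx q.1 q.2) (fun q : ℕ × Fin n => ξy q.1 q.2) a ω) inferInstance

/-- The indices of the samples drawn before iteration `k`. -/
def pastIndex (n k : ℕ) : Set ((ℕ × Fin n) ⊕ (ℕ × Fin n)) :=
  {a | Sum.elim Prod.fst Prod.fst a < k}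

/-- The σ-algebra generated by the samples drawn before iteration `k`. -/
@[reducible] def past (ξx ξy : ℕ → Fin n → Ω → Ξ) (k : ℕ) : MeasurableSpace Ω :=
  ⨆ a ∈ pastIndex n k, sampleSigma ξx ξy a

lemma sampleSigma_le (hs : Q.Sampling P ξx ξy) (a : (ℕ × Fin n) ⊕ (ℕ × Fin n)) :
    sampleSigma ξx ξy a ≤ (inferInstance : MeasurableSpace Ω) := by
  rcases a with a | a
  · exact (hs.measurable_x a.1 a.2).comap_le
  · exact (hs.measurable_y a.1 a.2).comap_le

lemma past_le (hs : Q.Sampling P ξx ξy) (k : ℕ) :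
    past ξx ξy k ≤ (inferInstance : MeasurableSpace Ω) :=
  iSup₂_le fun a _ => sampleSigma_le hs a

lemma past_mono : Monotone (past ξx ξy) := fun _ _ hij =>
  biSup_mono fun _ ha => lt_of_lt_of_le ha hij

lemma measurable_past_x {k t : ℕ} (h : t < k) (i : Fin n) :
    Measurable[past ξx ξy k] (ξx t i) :=
  Measurable.mono (comap_measurable (ξx t i))
    (le_iSup₂_of_le (f := fun a (_ : a ∈ pastIndex n k) => sampleSigma ξx ξy a)
      (Sum.inl (t, i)) h le_rfl) le_rfl

lemma measurable_past_y {k t : ℕ} (h : t < k) (i : Fin n) :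
    Measurable[past ξx ξy k] (ξy t i) :=
  Measurable.mono (comap_measurable (ξy t i))
    (le_iSup₂_of_le (f := fun a (_ : a ∈ pastIndex n k) => sampleSigma ξx ξy a)
      (Sum.inr (t, i)) h le_rfl) le_rfl

lemma measurableState_iter (hwp : Q.WellPosed) (hne : Q.Y.Nonempty) (k : ℕ) :
    MeasurableState (past ξx ξy k) (iter Q W θ x0 y0 ξx ξy k) := by
  induction k with
  | zero =>
    exact ⟨fun _ => measurable_const, fun _ => measurable_const, fun _ => measurable_const,
      fun _ => measurable_const⟩
  | succ k ih =>
    let _ := past ξx ξy (k + 1)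
    exact MeasurableState.step hwp hne (ih.mono (past_mono (Nat.le_succ k)))
      (fun i => measurable_past_x (Nat.lt_succ_self k) i)
      (fun i => measurable_past_y (Nat.lt_succ_self k) i)

lemma measurableState_iter_of_le (hwp : Q.WellPosed) (hne : Q.Y.Nonempty) {j k : ℕ}
    (hj : j ≤ k) : MeasurableState (past ξx ξy k) (iter Q W θ x0 y0 ξx ξy j) :=
  (measurableState_iter hwp hne j).mono (past_mono hj)

lemma indep_past (hs : Q.Sampling P ξx ξy) {k : ℕ} {a : (ℕ × Fin n) ⊕ (ℕ × Fin n)}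
    (ha : a ∉ pastIndex n k) : Indep (past ξx ξy k) (sampleSigma ξx ξy a) P := by
  have h := indep_iSup_of_disjoint (m := sampleSigma ξx ξy) (sampleSigma_le hs) hs.indep
    (Set.disjoint_singleton_right.2 ha)
  simpa [past] using h

lemma indepFun_past_x (hs : Q.Sampling P ξx ξy) (k : ℕ) (i : Fin n) {β : Type*}
    [MeasurableSpace β] {U : Ω → β} (hU : Measurable[past ξx ξy k] U) :
    IndepFun U (ξx k i) P := by
  have h := indep_past hs (k := k) (a := Sum.inl (k, i)) (by simp [pastIndex])
  exact indep_of_indep_of_le_left h hU.comap_le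

lemma indepFun_past_y (hs : Q.Sampling P ξx ξy) (k : ℕ) (i : Fin n) {β : Type*}
    [MeasurableSpace β] {U : Ω → β} (hU : Measurable[past ξx ξy k] U) :
    IndepFun U (ξy k i) P := by
  have h := indep_past hs (k := k) (a := Sum.inr (k, i)) (by simp [pastIndex])
  exact indep_of_indep_of_le_left h hU.comap_le

end Past

/-! ### Random trajectories -/

section Random

variable {n p d : ℕ} {Ξ : Type*} [MeasurableSpace Ξ] {Q : Problem n p d Ξ}
  {W : Matrix (Fin n) (Fin n) ℝ} {θ : Params} {L μ C ζv ζu R : ℝ} {Ω : Type*} [MeasurableSpace Ω]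
  {P : Measure Ω} [IsProbabilityMeasure P] {ξx ξy : ℕ → Fin n → Ω → Ξ} {x0 : Fin n → Vec p}
  {y0 : Fin n → Vec d}

/-- The stochastic gradients in `x` at the states `S` with samples `ξx`. -/
noncomputable def sampleGradX (Q : Problem n p d Ξ) (S : ℕ → Ω → State n p d)
    (ξx : ℕ → Fin n → Ω → Ξ) (ω : Ω) (k : ℕ) (i : Fin n) : Vec p :=
  Q.sgradX i ((S k ω).x i) ((S k ω).y i) (ξx k i ω)

/-- The stochastic gradients in `y` at the states `S` with samples `ξy`. -/
noncomputable def sampleGradY (Q : Problem n p d Ξ) (S : ℕ → Ω → State n p d)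
    (ξy : ℕ → Fin n → Ω → Ξ) (ω : Ω) (k : ℕ) (i : Fin n) : Vec d :=
  Q.sgradY i ((S k ω).x i) ((S k ω).y i) (ξy k i ω)

lemma iter_y_mem (hwp : Q.WellPosed) (hy0 : ∀ i, y0 i ∈ Q.Y) (ω : Ω) (k : ℕ) (i : Fin n) :
    (iter Q W θ x0 y0 ξx ξy k ω).y i ∈ Q.Y := by
  cases k with
  | zero => exact hy0 i
  | succ k => exact (proj_spec hwp.isClosed ⟨_, hy0 i⟩ _).1

lemma c_le_iter_my (ω : Ω) (k : ℕ) (i : Fin n) : θ.c ≤ (iter Q W θ x0 y0 ξx ξy k ω).my i := by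
  induction k with
  | zero => exact le_rfl
  | succ k ih => exact ih.trans (le_add_of_nonneg_right (sq_nonneg _))

lemma iter_ubar_pos (hn : 0 < n) (hc : 0 < θ.c) (ω : Ω) (k : ℕ) :
    0 < (iter Q W θ x0 y0 ξx ξy k ω).ubar := by
  refine hc.trans_le ?_
  rw [← inv_card_mul_sum_const hn θ.c]
  unfold State.ubar
  gcongr with i
  exact c_le_iter_my ω k i

lemma iter_vbar_pos (hn : 0 < n) (hc : 0 < θ.c) (ω : Ω) (k : ℕ) :
    0 < (iter Q W θ x0 y0 ξx ξy k ω).vbar :=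
  (iter_ubar_pos hn hc ω k).trans_le (ubar_le_vbar _)

lemma measurable_iter_xy (hwp : Q.WellPosed) (hne : Q.Y.Nonempty) (k : ℕ) (i : Fin n) :
    Measurable[past ξx ξy k] fun ω =>
      ((iter Q W θ x0 y0 ξx ξy k ω).x i, (iter Q W θ x0 y0 ξx ξy k ω).y i) := by
  have h := measurableState_iter (W := W) (θ := θ) (x0 := x0) (y0 := y0) (ξx := ξx) (ξy := ξy)
    hwp hne k
  exact Measurable.prodMk (h.x i) (h.y i)

lemma ae_norm_sampleGradX_le (hwp : Q.WellPosed) (hbu : Q.BoundedUnbiased C)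
    (hs : Q.Sampling P ξx ξy) (hy0 : ∀ i, y0 i ∈ Q.Y) (k : ℕ) (i : Fin n) :
    ∀ᵐ ω ∂P, ‖sampleGradX Q (iter Q W θ x0 y0 ξx ξy) ξx ω k i‖ ≤ C := by
  have hU := measurable_iter_xy (W := W) (θ := θ) (x0 := x0) (y0 := y0) (ξx := ξx) (ξy := ξy)
    hwp ⟨_, hy0 i⟩ k i
  refine ae_of_indepFun (q := fun z => ‖Q.sgradX i z.1.1 z.1.2 z.2‖ ≤ C)
    (hU.mono (past_le hs k) le_rfl) (hs.measurable_x k i) (indepFun_past_x hs k i hU)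
    (measurableSet_le (hwp.measurable_sgradX i).norm measurable_const) fun ω => ?_
  rw [hs.law_x]
  exact hbu.bounded_X i _ _ (iter_y_mem hwp hy0 ω k i)

lemma ae_norm_sampleGradY_le (hwp : Q.WellPosed) (hbu : Q.BoundedUnbiased C)
    (hs : Q.Sampling P ξx ξy) (hy0 : ∀ i, y0 i ∈ Q.Y) (k : ℕ) (i : Fin n) :
    ∀ᵐ ω ∂P, ‖sampleGradY Q (iter Q W θ x0 y0 ξx ξy) ξy ω k i‖ ≤ C := by
  have hU := measurable_iter_xy (W := W) (θ := θ) (x0 := x0) (y0 := y0) (ξx := ξx) (ξy := ξy)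
    hwp ⟨_, hy0 i⟩ k i
  refine ae_of_indepFun (q := fun z => ‖Q.sgradY i z.1.1 z.1.2 z.2‖ ≤ C)
    (hU.mono (past_le hs k) le_rfl) (hs.measurable_y k i) (indepFun_past_y hs k i hU)
    (measurableSet_le (hwp.measurable_sgradY i).norm measurable_const) fun ω => ?_
  rw [hs.law_y]
  exact hbu.bounded_Y i _ _ (iter_y_mem hwp hy0 ω k i)

/-- Almost every sample path of the algorithm is a trajectory. -/
lemma ae_trajectory (hn : 0 < n) (hθ : θ.Admissible) (hQ : Q.Regular L μ C)
    (hs : Q.Sampling P ξx ξy) (hW : W ∈ doublyStochastic ℝ (Fin n)) (hρ : rho W < 1)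
    (hy0 : ∀ i, y0 i ∈ Q.Y)
    (hR : (1 / (n : ℝ)) * ∑ i, ‖x0 i - (1 / (n : ℝ)) • ∑ j, x0 j‖ ^ 2 ≤ R)
    (hζv : 0 ≤ ζv) (hζv1 : ζv ≤ 1) (hζu : 0 ≤ ζu)
    (hzv : ∀ᵐ ω ∂P, ∀ k i, |(iter Q W θ x0 y0 ξx ξy (k + 1) ω).v i ^ (-θ.α)
        - (iter Q W θ x0 y0 ξx ξy (k + 1) ω).vbar ^ (-θ.α)|
      ≤ ζv * (iter Q W θ x0 y0 ξx ξy (k + 1) ω).vbar ^ (-θ.α))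
    (hzu : ∀ᵐ ω ∂P, ∀ k i, |(iter Q W θ x0 y0 ξx ξy (k + 1) ω).u i ^ (-θ.β)
        - (iter Q W θ x0 y0 ξx ξy (k + 1) ω).ubar ^ (-θ.β)|
      ≤ ζu * (iter Q W θ x0 y0 ξx ξy (k + 1) ω).ubar ^ (-θ.β)) :
    ∀ᵐ ω ∂P, Trajectory Q W θ C ζv ζu R (fun k => iter Q W θ x0 y0 ξx ξy k ω)
      (sampleGradX Q (iter Q W θ x0 y0 ξx ξy) ξx ω)
      (sampleGradY Q (iter Q W θ x0 y0 ξx ξy) ξy ω) := by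
  have hx := ae_all_iff.2 fun k => ae_all_iff.2 fun i =>
    ae_norm_sampleGradX_le (W := W) (θ := θ) (x0 := x0) hQ.wp hQ.bu hs hy0 k i
  have hy := ae_all_iff.2 fun k => ae_all_iff.2 fun i =>
    ae_norm_sampleGradY_le (W := W) (θ := θ) (x0 := x0) hQ.wp hQ.bu hs hy0 k i
  filter_upwards [hx, hy, hzv, hzu] with ω h1 h2 h3 h4
  exact
    { n_pos := hn
      adm := hθ
      C_pos := hQ.C_pos
      mix := hW
      rho_lt := hρ
      y_mem := iter_y_mem hQ.wp hy0 ω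
      x_succ := fun _ _ => rfl
      y_succ := fun _ _ => rfl
      mx_zero := fun _ => rfl
      my_zero := fun _ => rfl
      mx_succ := fun _ _ => rfl
      my_succ := fun _ _ => rfl
      norm_gx_le := h1
      norm_gy_le := h2
      zv_nonneg := hζv
      zv_le_one := hζv1
      zv := h3
      zu_nonneg := hζu
      zu := h4
      dispersion := hR }

lemma integrable_norm_gradient_sq (hn : 0 < n) (hQ : Q.Regular L μ C)
    (hs : Q.Sampling P ξx ξy) (hne : Q.Y.Nonempty) (k : ℕ) :
    Integrable (fun ω => ‖gradient Q.Phi (iter Q W θ x0 y0 ξx ξy k ω).xbar‖ ^ 2) P := by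
  have h := (measurableState_iter (W := W) (θ := θ) (x0 := x0) (y0 := y0) (ξx := ξx) (ξy := ξy)
    hQ.wp hne k).mono (past_le hs k)
  have h1 := (Problem.continuous_gradient_Phi hn hQ.L_pos hQ.μ_pos hQ.wp hQ.sc hQ.js
    hQ.argmax).measurable.comp h.xbar
  refine Integrable.of_bound (C := C ^ 2) (h1.norm.pow_const 2).aestronglyMeasurable
    (Filter.Eventually.of_forall fun ω => ?_)
  rw [Real.norm_of_nonneg (sq_nonneg _)]
  exact pow_le_pow_left₀ (norm_nonneg _) (Problem.norm_gradient_Phi_le hn hQ.L_pos hQ.μ_pos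
    hQ.C_pos hQ.wp hQ.sc hQ.js hQ.bu hQ.argmax _) 2

end Random

/-! ### Gradient noise has no effect in expectation -/

namespace Trajectory

variable {n p d : ℕ} {Ξ : Type*} [MeasurableSpace Ξ] {Q : Problem n p d Ξ}
  {W : Matrix (Fin n) (Fin n) ℝ} {θ : Params} {C ζv ζu R L μ : ℝ} {S : ℕ → State n p d}
  {gx : ℕ → Fin n → Vec p} {gy : ℕ → Fin n → Vec d}

lemma norm_noiseX_le (h : Trajectory Q W θ C ζv ζu R S gx gy) (hQ : Q.Regular L μ C) {b : ℝ}
    (hb : 0 ≤ b) (V : ℝ) (k : ℕ) :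
    ‖noiseX Q θ b V S k‖
      ≤ 6 * C + 16 * b * (2 * (θ.γx * θ.c ^ (-θ.α)) * (2 * C * (θ.γx * θ.c ^ (-θ.α)))) := by
  have h1 := Problem.norm_gradient_Phi_le h.n_pos hQ.L_pos hQ.μ_pos hQ.C_pos hQ.wp hQ.sc hQ.js
    hQ.bu hQ.argmax (S k).xbar
  have h2 := h.norm_lag_le k
  have h3 := h.stepRatio_le k
  have h4 := h.stepRatio_nonneg k
  have h5 := h.emaRate_pos k
  have h6 := h.emaRate_le_one k
  have hC := hQ.C_pos
  have hγ := h.adm.γx_pos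
  have hc := h.adm.c_pos
  have h7 : ‖lagWeight θ V S k‖
      ≤ 2 * (θ.γx * θ.c ^ (-θ.α)) * (2 * C * (θ.γx * θ.c ^ (-θ.α))) := by
    unfold lagWeight
    split_ifs
    · rw [norm_smul, Real.norm_of_nonneg
        (mul_nonneg (mul_nonneg zero_le_two (by linarith)) h4)]
      refine mul_le_mul ?_ h2 (norm_nonneg _) (by positivity)
      refine mul_le_mul (by linarith) h3 h4 zero_le_two
    · rw [norm_zero]; positivity
  rw [noiseX, norm_neg]
  refine (norm_add_le _ _).trans ?_
  rw [norm_smul, norm_smul, Real.norm_of_nonneg (by norm_num : (0 : ℝ) ≤ 6),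
    Real.norm_of_nonneg (by positivity : (0 : ℝ) ≤ 16 * b)]
  gcongr

lemma norm_noiseY_le (h : Trajectory Q W θ C ζv ζu R S gx gy) (hQ : Q.Regular L μ C) {a : ℝ}
    (ha : 0 ≤ a) (k : ℕ) : ‖noiseY Q θ a S k‖ ≤ a * (2 * C / μ) := by
  have hC := hQ.C_pos
  have hμ := hQ.μ_pos
  have h1 := h.norm_sub_yset_le hQ (h.mean_y_mem hQ.wp k)
    (hQ.argmax (ema θ S (k + 1))).1
  rw [noiseY, norm_smul, Real.norm_of_nonneg ha]
  refine mul_le_mul_of_nonneg_left ?_ ha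
  exact (pow_le_pow_iff_left₀ (norm_nonneg _) (by positivity) two_ne_zero).1 h1

end Trajectory

section Expectation

variable {n p d : ℕ} {Ξ : Type*} [MeasurableSpace Ξ] {Q : Problem n p d Ξ}
  {W : Matrix (Fin n) (Fin n) ℝ} {θ : Params} {L μ C ζv ζu R : ℝ} {Ω : Type*} [MeasurableSpace Ω]
  {P : Measure Ω} [IsProbabilityMeasure P] {ξx ξy : ℕ → Fin n → Ω → Ξ} {x0 : Fin n → Vec p}
  {y0 : Fin n → Vec d}

/-- The primal gradient noise is uncorrelated with bounded vectors known before the iteration. -/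
lemma integral_inner_noiseX (hQ : Q.Regular L μ C) (hs : Q.Sampling P ξx ξy)
    (hy0 : ∀ i, y0 i ∈ Q.Y) {Z : Ω → Vec p} {k : ℕ} (hZ : Measurable[past ξx ξy k] Z) {B : ℝ}
    (hB : ∀ᵐ ω ∂P, ‖Z ω‖ ≤ B) :
    Integrable (fun ω => inner ℝ (Z ω) (mean (sampleGradX Q (iter Q W θ x0 y0 ξx ξy) ξx ω k)
        - meanGradX Q (iter Q W θ x0 y0 ξx ξy k ω))) P
      ∧ ∫ ω, inner ℝ (Z ω) (mean (sampleGradX Q (iter Q W θ x0 y0 ξx ξy) ξx ω k)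
        - meanGradX Q (iter Q W θ x0 y0 ξx ξy k ω)) ∂P = 0 := by
  have key : ∀ i, Integrable (fun ω => inner ℝ (Z ω)
        (sampleGradX Q (iter Q W θ x0 y0 ξx ξy) ξx ω k i
          - gradX (Q.local_f i) ((iter Q W θ x0 y0 ξx ξy k ω).x i)
            ((iter Q W θ x0 y0 ξx ξy k ω).y i))) P
      ∧ ∫ ω, inner ℝ (Z ω) (sampleGradX Q (iter Q W θ x0 y0 ξx ξy) ξx ω k i
          - gradX (Q.local_f i) ((iter Q W θ x0 y0 ξx ξy k ω).x i)
            ((iter Q W θ x0 y0 ξx ξy k ω).y i)) ∂P = 0 := fun i => by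
    have hU := measurable_iter_xy (W := W) (θ := θ) (x0 := x0) (y0 := y0) (ξx := ξx) (ξy := ξy)
      hQ.wp ⟨_, hy0 i⟩ k i
    have hle := past_le hs k
    have h := inner_noise_indep (P := P) (G := fun z => Q.sgradX i z.1.1 z.1.2 z.2)
      (g := fun u => gradX (Q.local_f i) u.1 u.2)
      (hQ.wp.measurable_sgradX i) (hU.mono hle le_rfl) (hZ.mono hle le_rfl) (hs.measurable_x k i)
      (indepFun_past_x hs k i (Measurable.prodMk hZ hU)) hB
      (fun ω => by
        rw [hs.law_x]; exact hQ.bu.bounded_X i _ _ (iter_y_mem hQ.wp hy0 ω k i))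
      (fun ω => by
        rw [hs.law_x]; exact hQ.bu.unbiased_X i _ _ (iter_y_mem hQ.wp hy0 ω k i))
    exact h
  simp only [meanGradX, ← mean_sub, inner_mean]
  refine ⟨(integrable_finsetSum _ fun i _ => (key i).1).const_mul _, ?_⟩
  rw [integral_const_mul, integral_finsetSum _ fun i _ => (key i).1,
    Finset.sum_eq_zero fun i _ => (key i).2, mul_zero]

/-- The dual gradient noise is uncorrelated with bounded vectors known before the iteration. -/
lemma integral_inner_noiseY (hQ : Q.Regular L μ C) (hs : Q.Sampling P ξx ξy)
    (hy0 : ∀ i, y0 i ∈ Q.Y) {Z : Ω → Vec d} {k : ℕ} (hZ : Measurable[past ξx ξy k] Z) {B : ℝ}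
    (hB : ∀ᵐ ω ∂P, ‖Z ω‖ ≤ B) :
    Integrable (fun ω => inner ℝ (Z ω) (mean (sampleGradY Q (iter Q W θ x0 y0 ξx ξy) ξy ω k)
        - meanGradY Q (iter Q W θ x0 y0 ξx ξy k ω))) P
      ∧ ∫ ω, inner ℝ (Z ω) (mean (sampleGradY Q (iter Q W θ x0 y0 ξx ξy) ξy ω k)
        - meanGradY Q (iter Q W θ x0 y0 ξx ξy k ω)) ∂P = 0 := by
  have key : ∀ i, Integrable (fun ω => inner ℝ (Z ω)
        (sampleGradY Q (iter Q W θ x0 y0 ξx ξy) ξy ω k i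
          - gradY (Q.local_f i) ((iter Q W θ x0 y0 ξx ξy k ω).x i)
            ((iter Q W θ x0 y0 ξx ξy k ω).y i))) P
      ∧ ∫ ω, inner ℝ (Z ω) (sampleGradY Q (iter Q W θ x0 y0 ξx ξy) ξy ω k i
          - gradY (Q.local_f i) ((iter Q W θ x0 y0 ξx ξy k ω).x i)
            ((iter Q W θ x0 y0 ξx ξy k ω).y i)) ∂P = 0 := fun i => by
    have hU := measurable_iter_xy (W := W) (θ := θ) (x0 := x0) (y0 := y0) (ξx := ξx) (ξy := ξy)
      hQ.wp ⟨_, hy0 i⟩ k i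
    have hle := past_le hs k
    have h := inner_noise_indep (P := P) (G := fun z => Q.sgradY i z.1.1 z.1.2 z.2)
      (g := fun u => gradY (Q.local_f i) u.1 u.2)
      (hQ.wp.measurable_sgradY i) (hU.mono hle le_rfl) (hZ.mono hle le_rfl) (hs.measurable_y k i)
      (indepFun_past_y hs k i (Measurable.prodMk hZ hU)) hB
      (fun ω => by
        rw [hs.law_y]; exact hQ.bu.bounded_Y i _ _ (iter_y_mem hQ.wp hy0 ω k i))
      (fun ω => by
        rw [hs.law_y]; exact hQ.bu.unbiased_Y i _ _ (iter_y_mem hQ.wp hy0 ω k i))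
    exact h
  simp only [meanGradY, ← mean_sub, inner_mean]
  refine ⟨(integrable_finsetSum _ fun i _ => (key i).1).const_mul _, ?_⟩
  rw [integral_const_mul, integral_finsetSum _ fun i _ => (key i).1,
    Finset.sum_eq_zero fun i _ => (key i).2, mul_zero]

/-- The constant of the rate in the bound of the average gradient norm, where `b` is the weight of
the lag and `V` the level of the accumulators from which the primal stepsize is small relative to
the dual one. -/
noncomputable def rateConst (θ : Params) (L μ C Δ R c₁ b V : ℝ) : ℝ :=
  6 * ((θ.c + C ^ 2) ^ θ.α / θ.γx * |Δ| + 8 * (L * (1 + 2 * (L / μ))) * θ.γx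
      * adaConst θ.c (θ.c + C ^ 2) θ.α)
    + 8 * (L ^ 2 * (2 * |R| + 32 * θ.γx ^ 2 * c₁ * adaConst θ.c (θ.c + C ^ 2) (2 * θ.α))
      + 8 * (L ^ 2 / μ) * trackConst θ L μ C R c₁ + 2 * b * lagConst θ C V)

/-- The expectation of the bound along a trajectory. The noise terms integrate to zero. -/
lemma sum_integral_gradient_le
    (htr : ∀ᵐ ω ∂P, Trajectory Q W θ C ζv ζu R (fun k => iter Q W θ x0 y0 ξx ξy k ω)
      (sampleGradX Q (iter Q W θ x0 y0 ξx ξy) ξx ω)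
      (sampleGradY Q (iter Q W θ x0 y0 ξx ξy) ξy ω))
    (hn : 0 < n) (hQ : Q.Regular L μ C) (hs : Q.Sampling P ξx ξy) (hy0 : ∀ i, y0 i ∈ Q.Y)
    {Δ : ℝ} (hΔ : ∀ x x' : Vec p, Q.Phi x - Q.Phi x' ≤ Δ) (hζ : ζu ≤ 1 ∨ Q.Y.Subsingleton)
    {V ε b : ℝ} (hb : b = 8 * (L ^ 2 / μ) * trackLag θ L μ C + 8 * L ^ 2 * (L / μ) ^ 2)
    (hb0 : 0 ≤ b) (hε : 128 * (ε ^ 2 * b) ≤ 1)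
    (hV : ∀ s : State n p d, V ≤ s.vbar → stepRatio θ s ≤ ε)
    {K : ℕ} (hK : 1 ≤ K) {c₁ : ℝ} (hc₁ : 0 ≤ c₁)
    (hthr : 1 / (1 - rho W) ^ 2 ≤ c₁ * (K : ℝ) ^ θ.β) :
    ∑ k ∈ Finset.range K, ∫ ω, ‖gradient Q.Phi (iter Q W θ x0 y0 ξx ξy k ω).xbar‖ ^ 2 ∂P
      ≤ rateConst θ L μ C Δ R c₁ b V * rate θ (1 - rho W) K
        + K * (512 * (ζv ^ 2 + (L / μ) ^ 2 * ζu ^ 2) * C ^ 2) := by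
  have hne : Q.Y.Nonempty := ⟨_, hy0 ⟨0, hn⟩⟩
  have hμ := hQ.μ_pos
  have hms : ∀ k, ∀ j ≤ k, MeasurableState (past ξx ξy k) (iter Q W θ x0 y0 ξx ξy j) :=
    fun k j hj => measurableState_iter_of_le hQ.wp hne hj
  have hX := fun k => integral_inner_noiseX (P := P) (W := W) (θ := θ) (x0 := x0) hQ hs hy0
    (@measurable_noiseX n p d Ξ _ Q θ L μ C Ω (past ξx ξy k) hn hQ _ k (hms k) b V)
    (htr.mono fun ω h => h.norm_noiseX_le hQ hb0 V k)
  have hY := fun k => integral_inner_noiseY (P := P) (W := W) (θ := θ) (x0 := x0) hQ hs hy0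
    (@measurable_noiseY n p d Ξ _ Q θ L μ C Ω (past ξx ξy k) hn hQ _ k (hms k) (128 * (L ^ 2 / μ)))
    (htr.mono fun ω h => h.norm_noiseY_le hQ (by positivity) k)
  have hG := fun k => integrable_norm_gradient_sq (P := P) (W := W) (θ := θ) (x0 := x0) (y0 := y0)
    hn hQ hs hne k
  have hXY := fun k => (hX k).1.add (hY k).1
  rw [← integral_finsetSum _ fun k _ => hG k]
  have hle := integral_mono_ae (integrable_finsetSum (Finset.range K) fun k _ => hG k)
    ((integrable_const (rateConst θ L μ C Δ R c₁ b V * rate θ (1 - rho W) K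
        + K * (512 * (ζv ^ 2 + (L / μ) ^ 2 * ζu ^ 2) * C ^ 2))).add
      (integrable_finsetSum (Finset.range K) fun k _ => hXY k))
    (htr.mono fun ω h => by
      have := h.sum_gradient_bound hQ hΔ hζ hb hε (fun k => hV _) hK hc₁ hthr
      simpa [rateConst] using this)
  refine hle.trans (le_of_eq ?_)
  rw [integral_add' (integrable_const _) (integrable_finsetSum _ fun k _ => hXY k),
    integral_finsetSum _ fun k _ => hXY k]
  have h0 : ∀ k, ∫ ω, (((fun ω => inner ℝ (noiseX Q θ b V
      (fun t => iter Q W θ x0 y0 ξx ξy t ω) k)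
        (mean (sampleGradX Q (iter Q W θ x0 y0 ξx ξy) ξx ω k)
        - meanGradX Q (iter Q W θ x0 y0 ξx ξy k ω))) + fun ω => inner ℝ (noiseY Q θ
        (128 * (L ^ 2 / μ)) (fun t => iter Q W θ x0 y0 ξx ξy t ω) k)
        (mean (sampleGradY Q (iter Q W θ x0 y0 ξx ξy) ξy ω k)
        - meanGradY Q (iter Q W θ x0 y0 ξx ξy k ω))) : Ω → ℝ) ω ∂P = 0 := fun k => by
    rw [integral_add' (hX k).1 (hY k).1, (hX k).2, (hY k).2, add_zero]
  rw [Finset.sum_eq_zero fun k _ => h0 k]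
  simp

end Expectation

/-! ### Stepsize inconsistency -/

section Inconsistency

variable {Ω : Type*} [MeasurableSpace Ω] {P : Measure Ω}

/-- Almost surely, the relative deviation is at most the root of its essential supremum. -/
lemma ae_abs_sub_le_of_essSup_le {a b : Ω → ℝ} (hb : ∀ ω, 0 < b ω) {z : ℝ≥0∞} (hz : z ≠ ⊤)
    (h : essSup (fun ω => ENNReal.ofReal ((a ω - b ω) ^ 2 / (b ω) ^ 2)) P ≤ z) :
    ∀ᵐ ω ∂P, |a ω - b ω| ≤ √z.toReal * b ω := by
  filter_upwards [ENNReal.ae_le_essSup fun ω => ENNReal.ofReal ((a ω - b ω) ^ 2 / (b ω) ^ 2)]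
    with ω hω
  have h1 := (ENNReal.ofReal_le_iff_le_toReal hz).1 (hω.trans h)
  rw [← div_pow] at h1
  have h2 := Real.abs_le_sqrt h1
  rwa [abs_div, abs_of_pos (hb ω), div_le_iff₀ (hb ω)] at h2

variable {n p d : ℕ} {S : ℕ → Ω → State n p d}

lemma ae_v_rpow_sub_le {α : ℝ} (hS : ∀ ω k, 0 < (S k ω).vbar) (h : zetaVSq P α S ≠ ⊤) :
    ∀ᵐ ω ∂P, ∀ k i, |(S (k + 1) ω).v i ^ (-α) - (S (k + 1) ω).vbar ^ (-α)|
      ≤ √(zetaVSq P α S).toReal * (S (k + 1) ω).vbar ^ (-α) :=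
  ae_all_iff.2 fun k => ae_all_iff.2 fun i =>
    ae_abs_sub_le_of_essSup_le (fun ω => Real.rpow_pos_of_pos (hS ω (k + 1)) _) h
      (le_iSup_of_le i (le_iSup_of_le (k + 1) (le_iSup_of_le k.succ_pos le_rfl)))

lemma ae_u_rpow_sub_le {β : ℝ} (hS : ∀ ω k, 0 < (S k ω).ubar) (h : zetaUSq P β S ≠ ⊤) :
    ∀ᵐ ω ∂P, ∀ k i, |(S (k + 1) ω).u i ^ (-β) - (S (k + 1) ω).ubar ^ (-β)|
      ≤ √(zetaUSq P β S).toReal * (S (k + 1) ω).ubar ^ (-β) :=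
  ae_all_iff.2 fun k => ae_all_iff.2 fun i =>
    ae_abs_sub_le_of_essSup_le (fun ω => Real.rpow_pos_of_pos (hS ω (k + 1)) _) h
      (le_iSup_of_le i (le_iSup_of_le (k + 1) (le_iSup_of_le k.succ_pos le_rfl)))

end Inconsistency

/-! ### Constants and thresholds -/

/-- The rate divided by the number of iterations. The spectral gap enters the second summand only by
weakening it, since `δ ^ α ≤ 1`. -/
lemma rate_div_le {θ : Params} {δ : ℝ} {K : ℕ} (hα : 0 ≤ θ.α) (hδ : 0 < δ) (hδ1 : δ ≤ 1)
    (hK : 1 ≤ K) :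
    1 / (K : ℝ) * rate θ δ K ≤ (1 + Real.log K)
      * ((1 / (K : ℝ) ^ (1 - θ.α) + 1 / (δ ^ θ.α * (K : ℝ) ^ θ.α))
        + (1 / (K : ℝ) ^ (1 - θ.β) + 1 / (δ * (K : ℝ) ^ θ.β))) := by
  have hK0 : (0 : ℝ) < K := by exact_mod_cast hK
  have h1 := one_le_one_add_log K
  have e : ∀ s : ℝ, 1 / (K : ℝ) * (K : ℝ) ^ s = 1 / (K : ℝ) ^ (1 - s) := fun s => by
    rw [Real.rpow_sub hK0, Real.rpow_one, one_div_div, div_mul_eq_mul_div, one_mul]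
  have e2 : ∀ s : ℝ, 1 / (K : ℝ) * (K : ℝ) ^ (1 - s) = 1 / (K : ℝ) ^ s := fun s => by
    rw [e]; congr 2; ring
  have h2 : 1 / (K : ℝ) ^ θ.α ≤ 1 / (δ ^ θ.α * (K : ℝ) ^ θ.α) := by
    refine one_div_le_one_div_of_le (by positivity) ?_
    exact mul_le_of_le_one_left (by positivity) (Real.rpow_le_one hδ.le hδ1 hα)
  have e3 : 1 / (K : ℝ) * rate θ δ K = (1 + Real.log K) * ((1 / (K : ℝ) * (K : ℝ) ^ θ.α
      + 1 / (K : ℝ) * (K : ℝ) ^ (1 - θ.α)) + (1 / (K : ℝ) * (K : ℝ) ^ θ.β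
      + 1 / (K : ℝ) * (K : ℝ) ^ (1 - θ.β) * (1 / δ))) := by
    unfold rate; ring
  rw [e3, e2, e2, e, e, one_div_mul_one_div, mul_comm ((K : ℝ) ^ θ.β) δ]
  gcongr

/-- The part of the lower bound on the number of iterations that involves the network. -/
lemma one_le_and_gap_le_of_threshold {θ : Params} (hθ : θ.Admissible) {c₀ δ T : ℝ} {K : ℕ}
    (hc₀ : 0 < c₀) (hδ : 0 < δ)
    (h : c₀ * max T ((1 / δ ^ 2) ^ max (1 / θ.α) (1 / θ.β)) ≤ (K : ℝ)) :
    1 ≤ K ∧ 1 / δ ^ 2 ≤ c₀ ^ (-θ.β) * (K : ℝ) ^ θ.β := by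
  have hβ := hθ.β_pos
  rw [max_eq_right (one_div_le_one_div_of_le hβ hθ.β_lt_α.le)] at h
  have h1 : c₀ * (1 / δ ^ 2) ^ (1 / θ.β) ≤ K :=
    (mul_le_mul_of_nonneg_left (le_max_right _ _) hc₀.le).trans h
  have h2 : 0 < c₀ * (1 / δ ^ 2) ^ (1 / θ.β) := by positivity
  refine ⟨by exact_mod_cast h2.trans_le h1, ?_⟩
  have h3 := Real.rpow_le_rpow h2.le h1 hβ.le
  rw [Real.mul_rpow hc₀.le (by positivity), ← Real.rpow_mul (by positivity),
    one_div_mul_cancel hβ.ne', Real.rpow_one] at h3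
  rw [Real.rpow_neg hc₀.le]
  exact (le_inv_mul_iff₀ (by positivity)).2 h3

/-- The level of the accumulators from which the ratio of stepsizes is at most `ε`. -/
lemma stepRatio_le_of_le_vbar {θ : Params} (hθ : θ.Admissible) {ε : ℝ} (hε : 0 < ε) {n p d : ℕ}
    (s : State n p d) (h : (θ.γx * θ.c ^ (-θ.β) / ε) ^ (1 / (θ.α - θ.β)) ≤ s.vbar) :
    stepRatio θ s ≤ ε := by
  have hγ := hθ.γx_pos
  have hc := hθ.c_pos
  have hαβ : 0 < θ.α - θ.β := sub_pos.2 hθ.β_lt_α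
  set a := θ.γx * θ.c ^ (-θ.β) with ha
  have ha0 : 0 < a := by positivity
  have h1 := Real.rpow_le_rpow_of_nonpos (z := θ.β - θ.α) (by positivity) h (by linarith)
  rw [← Real.rpow_mul (by positivity), show 1 / (θ.α - θ.β) * (θ.β - θ.α) = -1 by
    rw [← neg_sub θ.α θ.β]; field_simp, Real.rpow_neg_one, inv_div] at h1
  calc stepRatio θ s ≤ a * (ε / a) := by rw [stepRatio]; gcongr
    _ = ε := by field_simp

lemma ofReal_mul_add_le {A G κ x T : ℝ} (hA : 0 ≤ A) {zv zu : ℝ≥0∞} (hv : zv ≠ ⊤) (hu : zu ≠ ⊤)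
    (h : x ≤ T + A * (√zv.toReal ^ 2 + κ ^ 2 * √zu.toReal ^ 2) * G ^ 2) :
    ENNReal.ofReal x ≤ ENNReal.ofReal T
      + ENNReal.ofReal A * (zv + ENNReal.ofReal (κ ^ 2) * zu) * ENNReal.ofReal (G ^ 2) := by
  rw [Real.sq_sqrt ENNReal.toReal_nonneg, Real.sq_sqrt ENNReal.toReal_nonneg] at h
  have e : ENNReal.ofReal A * (zv + ENNReal.ofReal (κ ^ 2) * zu) * ENNReal.ofReal (G ^ 2)
      = ENNReal.ofReal (A * (zv.toReal + κ ^ 2 * zu.toReal) * G ^ 2) := by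
    rw [ENNReal.ofReal_mul (by positivity), ENNReal.ofReal_mul hA,
      ENNReal.ofReal_add ENNReal.toReal_nonneg (by positivity), ENNReal.ofReal_mul (sq_nonneg κ),
      ENNReal.ofReal_toReal hv, ENNReal.ofReal_toReal hu]
  rw [e]
  exact (ENNReal.ofReal_le_ofReal h).trans ENNReal.ofReal_add_le

end DTiAda

open DTiAda
theorem corollary1 :
    ∃ A : ℝ, 0 < A ∧
    ∀ (θ : Params), θ.Admissible →
    ∀ (L μ C Δ R c₀ : ℝ), 0 < L → 0 < μ → 0 < C → 0 < c₀ →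
    ∃ (M : ℝ) (q : ℕ), 0 < M ∧
    ∀ (n p d : ℕ), 0 < n →
    ∀ (Ξ : Type*) [MeasurableSpace Ξ] (Q : Problem n p d Ξ),
      Q.WellPosed → Q.StronglyConcave μ → Q.JointlySmooth L → Q.BoundedUnbiased C →
      (∀ x x' : Vec p, Q.Phi x - Q.Phi x' ≤ Δ) →
    ∀ (W : Matrix (Fin n) (Fin n) ℝ), W ∈ doublyStochastic ℝ (Fin n) → rho W < 1 →
    ∀ (x0 : Fin n → Vec p) (y0 : Fin n → Vec d), (∀ i, y0 i ∈ Q.Y) →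
      (1 / (n : ℝ)) * ∑ i, ‖x0 i - (1 / (n : ℝ)) • ∑ j, x0 j‖ ^ 2 ≤ R →
    ∀ (Ω : Type*) [MeasurableSpace Ω] (P : Measure Ω) [IsProbabilityMeasure P]
      (ξx ξy : ℕ → Fin n → Ω → Ξ), Q.Sampling P ξx ξy →
      (∀ x, Q.IsArgmax x (Q.yStar x)) ∧
      Differentiable ℝ Q.Phi ∧
      (∀ k, Integrable
        (fun ω => ‖gradient Q.Phi (iter Q W θ x0 y0 ξx ξy k ω).xbar‖ ^ 2) P) ∧
      ∀ K : ℕ,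
        c₀ * max ((θ.γx ^ 2 * (L / μ) ^ 4 / θ.γy ^ 2) ^ (1 / (θ.α - θ.β)))
            ((1 / (1 - rho W) ^ 2) ^ max (1 / θ.α) (1 / θ.β)) ≤ (K : ℝ) →
        ENNReal.ofReal ((1 / (K : ℝ)) * ∑ k ∈ Finset.range K,
            ∫ ω, ‖gradient Q.Phi (iter Q W θ x0 y0 ξx ξy k ω).xbar‖ ^ 2 ∂P)
          ≤ ENNReal.ofReal (M * (1 + Real.log K) ^ q *
              ((1 / (K : ℝ) ^ (1 - θ.α) + 1 / ((1 - rho W) ^ θ.α * (K : ℝ) ^ θ.α))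
                + (1 / (K : ℝ) ^ (1 - θ.β) + 1 / ((1 - rho W) * (K : ℝ) ^ θ.β))))
            + ENNReal.ofReal A
              * (zetaVSq P θ.α (iter Q W θ x0 y0 ξx ξy)
                  + ENNReal.ofReal ((L / μ) ^ 2) * zetaUSq P θ.β (iter Q W θ x0 y0 ξx ξy))
              * ENNReal.ofReal (C ^ 2) := by
  -- the constant of the dual inconsistency in the bound along a trajectory
  refine ⟨512, by norm_num, fun θ hθ L μ C Δ R c₀ hL hμ hC hc₀ => ?_⟩
  have hγy := hθ.γy_pos
  have hc := hθ.c_pos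
  set b := 8 * (L ^ 2 / μ) * Trajectory.trackLag θ L μ C + 8 * L ^ 2 * (L / μ) ^ 2 with hb
  have hb0 : 0 ≤ b := by rw [hb, Trajectory.trackLag]; positivity
  -- the smallness of the ratio of stepsizes that lets the gradients absorb the lag
  set ε := 1 / (16 * (b + 1)) with hε
  have hε0 : 0 < ε := by positivity
  have hεb : 128 * (ε ^ 2 * b) ≤ 1 := by
    have e : 128 * (ε ^ 2 * b) = b / (2 * (b + 1) ^ 2) := by rw [hε]; field_simp; ring
    rw [e, div_le_one (by positivity)]
    nlinarith
  set V := (θ.γx * θ.c ^ (-θ.β) / ε) ^ (1 / (θ.α - θ.β)) with hV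
  set m := rateConst θ L μ C Δ R (c₀ ^ (-θ.β)) b V with hm
  refine ⟨|m| + 1, 1, by positivity, ?_⟩
  intro n p d hn Ξ _ Q hwp hsc hjs hbu hΔ W hW hρ x0 y0 hy0 hR Ω _ P _ ξx ξy hs
  have hne : Q.Y.Nonempty := ⟨_, hy0 ⟨0, hn⟩⟩
  have hys := Problem.isArgmax_yStar hn hμ hC hwp hsc hjs hbu hne
  have hQ : Q.Regular L μ C := ⟨hL, hμ, hC, hwp, hsc, hjs, hbu, hys⟩
  have hint := integrable_norm_gradient_sq (P := P) (W := W) (θ := θ) (x0 := x0) (y0 := y0)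
    hn hQ hs hne
  refine ⟨hys, fun x => (Problem.hasGradientAt_Phi hn hL hμ hwp hsc hjs hys x).differentiableAt,
    hint, fun K hK => ?_⟩
  have hδ : 0 < 1 - rho W := by linarith
  have hδ1 : 1 - rho W ≤ 1 := by linarith [rho_nonneg W]
  obtain ⟨hK1, hthr⟩ := one_le_and_gap_le_of_threshold hθ hc₀ hδ hK
  have hK0 : (0 : ℝ) < K := by exact_mod_cast hK1
  set zv := zetaVSq P θ.α (iter Q W θ x0 y0 ξx ξy)
  set zu := zetaUSq P θ.β (iter Q W θ x0 y0 ξx ξy)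
  by_cases hz : 1 ≤ zv + ENNReal.ofReal ((L / μ) ^ 2) * zu
  · -- the gradient of `Φ` is bounded by `C`
    have h1 : (1 / (K : ℝ)) * ∑ k ∈ Finset.range K,
        ∫ ω, ‖gradient Q.Phi (iter Q W θ x0 y0 ξx ξy k ω).xbar‖ ^ 2 ∂P ≤ C ^ 2 := by
      rw [one_div, inv_mul_le_iff₀ hK0]
      refine (Finset.sum_le_card_nsmul _ _ (C ^ 2) fun k _ => ?_).trans_eq (by simp)
      refine (integral_mono (hint k) (integrable_const (C ^ 2)) fun ω => ?_).trans_eq (by simp)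
      exact pow_le_pow_left₀ (norm_nonneg _)
        (Problem.norm_gradient_Phi_le hn hL hμ hC hwp hsc hjs hbu hys _) 2
    refine le_trans ?_ le_add_self
    calc _ ≤ 1 * 1 * ENNReal.ofReal (C ^ 2) := by
          simpa using ENNReal.ofReal_le_ofReal h1
      _ ≤ _ := by
          gcongr
          rw [← ENNReal.ofReal_one]
          exact ENNReal.ofReal_le_ofReal (by norm_num)
  · rw [not_le] at hz
    have hκ : ENNReal.ofReal ((L / μ) ^ 2) ≠ 0 := by
      rw [Ne, ENNReal.ofReal_eq_zero, not_le]; positivity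
    have hv1 : zv ≤ 1 := le_self_add.trans hz.le
    have hu1 : ENNReal.ofReal ((L / μ) ^ 2) * zu ≤ 1 := le_add_self.trans hz.le
    have hvt : zv ≠ ⊤ := ne_top_of_le_ne_top ENNReal.one_ne_top hv1
    have hut : zu ≠ ⊤ := fun h => by simp [h, ENNReal.mul_top hκ] at hu1
    have hζv : √zv.toReal ≤ 1 :=
      Real.sqrt_le_one.2 (ENNReal.toReal_le_of_le_ofReal zero_le_one (by simpa using hv1))
    have hζu : √zu.toReal ≤ 1 ∨ Q.Y.Subsingleton := by
      refine or_iff_not_imp_right.2 fun hsub => ?_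
      -- two distinct feasible points force `μ ≤ L`
      obtain ⟨y, hy, y', hy', hyy⟩ := Set.not_subsingleton_iff.1 hsub
      have hμL := Problem.mu_le_of_ne hn hL hsc hjs hy hy' hyy
      have hκ1 : 1 ≤ ENNReal.ofReal ((L / μ) ^ 2) := by
        rw [← ENNReal.ofReal_one]
        exact ENNReal.ofReal_le_ofReal (one_le_pow₀ ((one_le_div hμ).2 hμL))
      have hzu : zu ≤ 1 := le_trans (by simpa using mul_le_mul_left hκ1 zu) hu1
      exact Real.sqrt_le_one.2 (ENNReal.toReal_le_of_le_ofReal zero_le_one (by simpa using hzu))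
    have htr := ae_trajectory (P := P) (x0 := x0) (y0 := y0) hn hθ hQ hs hW hρ hy0 hR
      (Real.sqrt_nonneg _) hζv (Real.sqrt_nonneg _)
      (ae_v_rpow_sub_le (fun ω k => iter_vbar_pos hn hc ω k) hvt)
      (ae_u_rpow_sub_le (fun ω k => iter_ubar_pos hn hc ω k) hut)
    have hmain := sum_integral_gradient_le htr hn hQ hs hy0 hΔ hζu hb hb0 hεb
      (fun s => stepRatio_le_of_le_vbar hθ hε0 s) hK1 (by positivity) hthr
    refine ofReal_mul_add_le (by norm_num) hvt hut ?_
    have h1 := mul_le_mul_of_nonneg_left hmain (show 0 ≤ 1 / (K : ℝ) by positivity)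
    have h2 := rate_div_le (by linarith [hθ.β_pos, hθ.β_lt_α]) hδ hδ1 hK1
    have h3 : 0 ≤ 1 / (K : ℝ) * rate θ (1 - rho W) K :=
      mul_nonneg (by positivity) (zero_le_one.trans (one_le_rate hθ.β_pos hδ hK1))
    have h4 : m * (1 / (K : ℝ) * rate θ (1 - rho W) K)
        ≤ (|m| + 1) * (1 / (K : ℝ) * rate θ (1 - rho W) K) :=
      mul_le_mul_of_nonneg_right (by linarith [le_abs_self m]) h3
    have h5 := h4.trans (mul_le_mul_of_nonneg_left h2 (by positivity : 0 ≤ |m| + 1))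
    rw [mul_add, ← mul_assoc (1 / (K : ℝ)) (K : ℝ), one_div_mul_cancel hK0.ne', one_mul,
      mul_left_comm] at h1
    rw [pow_one, mul_assoc]
    exact h1.trans (by linarith)
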